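/- All manifolds, functions and brackets are either $C^\infty$ over $\mathbb K=\mathbb R$ or holomorphic over $\mathbb K=\mathbb C$. Let $M$ be a finite-dimensional manifold with a bihamiltonian structure, i.e. two Poisson brackets $\{,\}_1,\{,\}_2$ such that $a\{,\}_1+b\{,\}_2$ is Poisson for all $a,b\in\mathbb K$. At each $m\in M$ the brackets define two skew-symmetric bilinear pairings on $T_m^*M$. **Definitions.** * *Homogeneous.* The structure is homogeneous on an open set $U\subset M$ if there are $k_1,\dots,k_l\ge 1$ such that for every $m\in U$ the pair of pairings on $T^*_mM$ is an orthogonal direct sum of indecomposable blocks of dimensions $2k_1-1,\dots,2k_l-1$. * *Action dimension.* The Kronecker pair of dimension $2k-1$ has a basis $w_0,\dots,w_{2k-2}$ whose only nonzero pairings (up to skew-symmetry) are $(w_{2s},w_{2s+1})_1=1$ and $(w_{2s+1},w_{2s+2})_2=1$. The action dimension of a vector space $V$ with a pair of skew-symmetric pairings is $\frac{\dim V+r}{2}$, where $r$ is the number of Kronecker pairs in a decomposition of $V$ into indecomposable blocks. The action dimension of $M$ at $m_0$ is $\liminf_{m\to m_0}$ of the action dimensions of $T_m^*M$. * *Independence.*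 A finite collection of functions on an open set $U$ is independent if their differentials are linearly independent at the points of an open dense subset of $U$. A function on $U$ depends on a collection if, at the points of an open dense subset of $U$, its differential is a linear combination of the differentials of the collection. * *Casimir functions.* $F$ is a Casimir function for a bracket $\{,\}$ if $\{F,f\}=0$ for all local functions $f$. A maximal independent collection of Casimir functions on $U$ is an independent collection of Casimir functions on $U$ such that every Casimir function on every open subset $V\subset U$ depends on it on $V$. * *Strictly Lenard-integrable.* The structure is strictly Lenard-integrable at $m_0$ if on some open neighbourhood $U$ of $m_0$ there are infinite sequences of functions $H^{(t)}_0,H^{(t)}_1,H^{(t)}_2,\dots$, $1\le t\le r$, and integers $k_1,\dots,k_r\ge0$ such that 1. $H^{(1)}_0,\dots,H^{(r)}_0$ is a maximal independent collection of Casimir functions for $\{,\}_1$ on $U$; 2. $\{H^{(t)}_i,f\}_2=-\{H^{(t)}_{i+1},f\}_1$ for all $t$, all $i\ge0$ and all local functions $f$ on $U$; 3. the functions $H^{(t)}_i$ with $0\le i\le k_t$ are independent on $U$, and all functions $H^{(t)}_i$, $i\ge0$, depend on them; 4. the number $\sum_t(k_t+1)$ of these functions equals the action dimension of $M$ at $m_0$.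 **Statement.** 1. If the bihamiltonian structure is homogeneous on $M$, then it is strictly Lenard-integrable at every point $m_0\in M$. 2. Conversely, if a bihamiltonian structure on $M$ is strictly Lenard-integrable at a point $m_0\in M$, then it is homogeneous on some open subset $U\subset M$ whose closure contains $m_0$. -/

import Mathlib

open scoped Manifold ContDiff Topology

noncomputable section

namespace Bihamiltonian

/-! ### Pairs of skew-symmetric bilinear pairings on a vector space -/

section LinearAlgebra

variable {𝕜 V : Type*} [Field 𝕜] [AddCommGroup V] [Module 𝕜 V]

/-- Two subspaces are orthogonal with respect to both pairings. -/
def Orthogonal (B₁ B₂ : LinearMap.BilinForm 𝕜 V) (W W' : Submodule 𝕜 V) : Prop :=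
  ∀ x ∈ W, ∀ y ∈ W', B₁ x y = 0 ∧ B₂ x y = 0 ∧ B₁ y x = 0 ∧ B₂ y x = 0

/-- The restriction of the pair of pairings to the subspace `W` is indecomposable: `W` is nonzero
and it is not the direct sum of two nonzero mutually orthogonal subspaces. -/
def IsIndecomposable (B₁ B₂ : LinearMap.BilinForm 𝕜 V) (W : Submodule 𝕜 V) : Prop :=
  W ≠ ⊥ ∧ ∀ W' W'' : Submodule 𝕜 V, W' ⊔ W'' = W → W' ⊓ W'' = ⊥ →
    Orthogonal B₁ B₂ W' W'' → W' = ⊥ ∨ W'' = ⊥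

/-- `V` with the pair of pairings is the orthogonal direct sum of the indecomposable
blocks `W i`. -/
structure IsBlockDecomposition (B₁ B₂ : LinearMap.BilinForm 𝕜 V) {l : ℕ}
    (W : Fin l → Submodule 𝕜 V) : Prop where
  independent : iSupIndep W
  span : ⨆ i, W i = ⊤
  orthogonal : ∀ i j, i ≠ j → Orthogonal B₁ B₂ (W i) (W j)
  indecomposable : ∀ i, IsIndecomposable B₁ B₂ (W i)

/-- The restriction of the pair of pairings to `W` is isomorphic to the Kronecker pair of
dimension `2k-1` for some `k ≥ 1`: there is a basis `w₀, …, w_{2k-2}` of `W` in which the only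
nonzero pairings are `(w_{2s}, w_{2s+1})₁ = 1` and `(w_{2s+1}, w_{2s+2})₂ = 1`, up to
skew-symmetry. -/
def IsKroneckerBlock (B₁ B₂ : LinearMap.BilinForm 𝕜 V) (W : Submodule 𝕜 V) : Prop :=
  ∃ k : ℕ, 1 ≤ k ∧ ∃ w : Module.Basis (Fin (2 * k - 1)) 𝕜 W, ∀ i j : Fin (2 * k - 1),
    B₁ (w i) (w j) =
      (if Even (i : ℕ) ∧ (j : ℕ) = i + 1 then 1
        else if Even (j : ℕ) ∧ (i : ℕ) = j + 1 then -1 else 0) ∧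
    B₂ (w i) (w j) =
      (if Odd (i : ℕ) ∧ (j : ℕ) = i + 1 then 1
        else if Odd (j : ℕ) ∧ (i : ℕ) = j + 1 then -1 else 0)

/-- The number of Kronecker blocks in a decomposition of `V` into indecomposable blocks. For
skew-symmetric pairings in finite dimension decompositions exist and all of them have the same
number of Kronecker blocks, so that `sInf` is taken over a one-element set. For real pairings the
number is the same before and after complexification. -/
def kroneckerCount (B₁ B₂ : LinearMap.BilinForm 𝕜 V) : ℕ :=
  sInf {r | ∃ (l : ℕ) (W : Fin l → Submodule 𝕜 V), IsBlockDecomposition B₁ B₂ W ∧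
    r = {i | IsKroneckerBlock B₁ B₂ (W i)}.ncard}

/-- The action dimension `(dim V + r) / 2` of a pair of pairings, where `r` is the number of
Kronecker blocks; `dim V + r` is even for skew-symmetric pairings. -/
def linearActionDim (B₁ B₂ : LinearMap.BilinForm 𝕜 V) : ℕ :=
  (Module.finrank 𝕜 V + kroneckerCount B₁ B₂) / 2

end LinearAlgebra

/-! ### Brackets

`M` is a manifold without boundary over `𝕜`. For `𝕜 = ℝ` functions and brackets are `C^∞`; for
`𝕜 = ℂ` they are holomorphic, because `C^∞` over `ℂ` means complex differentiable. Functions on an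
open subset `U` are functions on `M` of which only the restriction to `U` is used. -/

section Brackets

variable {𝕜 : Type*} [RCLike 𝕜] {E : Type*} [NormedAddCommGroup E] [NormedSpace 𝕜 E]
  {M : Type*} [TopologicalSpace M] [ChartedSpace E M]

/-- The cotangent space of `M` at `m`. -/
abbrev Cotangent (𝕜 : Type*) [RCLike 𝕜] (E : Type*) [NormedAddCommGroup E] [NormedSpace 𝕜 E]
    {M : Type*} [TopologicalSpace M] [ChartedSpace E M] (m : M) : Type _ :=
  TangentSpace 𝓘(𝕜, E) m →L[𝕜] 𝕜

/-- A contravariant tensor field of valence two: a bilinear pairing on every cotangent space. -/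
abbrev TensorField (𝕜 : Type*) [RCLike 𝕜] (E : Type*) [NormedAddCommGroup E] [NormedSpace 𝕜 E]
    (M : Type*) [TopologicalSpace M] [ChartedSpace E M] : Type _ :=
  ∀ m : M, LinearMap.BilinForm 𝕜 (Cotangent 𝕜 E m)

variable (E) in
/-- `f` is a smooth function on `U`. -/
def SmoothOn (f : M → 𝕜) (U : Set M) : Prop :=
  ContMDiffOn 𝓘(𝕜, E) 𝓘(𝕜, 𝕜) ∞ f U

variable (E) in
/-- The differential of the function `f` at `m`. -/
def diffAt (f : M → 𝕜) (m : M) : Cotangent 𝕜 E m :=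
  mfderiv 𝓘(𝕜, E) 𝓘(𝕜, 𝕜) f m

/-- The bracket `{f, g}` defined by a tensor field. -/
def bracket (P : TensorField 𝕜 E M) (f g : M → 𝕜) : M → 𝕜 :=
  fun m => P m (diffAt E f m) (diffAt E g m)

/-- `P` is a smooth bivector field, that is, the pairings are skew-symmetric and the bracket of two
smooth functions on an open set is smooth. -/
structure IsBracket (P : TensorField 𝕜 E M) : Prop where
  skew : ∀ (m : M) (α β : Cotangent 𝕜 E m), P m α β = -P m β α
  smooth : ∀ (U : Set M), IsOpen U → ∀ f g : M → 𝕜, SmoothOn E f U → SmoothOn E g U →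
    SmoothOn E (bracket P f g) U

/-- A Poisson bracket is a bracket that satisfies the Jacobi identity. -/
structure IsPoisson (P : TensorField 𝕜 E M) : Prop extends IsBracket P where
  jacobi : ∀ (U : Set M), IsOpen U → ∀ f g h : M → 𝕜,
    SmoothOn E f U → SmoothOn E g U → SmoothOn E h U → ∀ m ∈ U,
      bracket P f (bracket P g h) m + bracket P g (bracket P h f) m +
        bracket P h (bracket P f g) m = 0

/-- Two compatible Poisson brackets. -/
structure IsBihamiltonian (P₁ P₂ : TensorField 𝕜 E M) : Prop where
  poisson₁ : IsPoisson P₁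
  poisson₂ : IsPoisson P₂
  compatible : ∀ a b : 𝕜, IsPoisson (a • P₁ + b • P₂)

/-- The structure is homogeneous on `U`: for some fixed sequence `k₁, …, k_l ≥ 1` the pair of
pairings at every point of `U` is a direct sum of indecomposable blocks of dimensions
`2k₁-1, …, 2k_l-1`. -/
def IsHomogeneousOn (P₁ P₂ : TensorField 𝕜 E M) (U : Set M) : Prop :=
  ∃ (l : ℕ) (k : Fin l → ℕ), (∀ i, 1 ≤ k i) ∧ ∀ m ∈ U,
    ∃ W : Fin l → Submodule 𝕜 (Cotangent 𝕜 E m),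
      IsBlockDecomposition (P₁ m) (P₂ m) W ∧ ∀ i, Module.finrank 𝕜 (W i) = 2 * k i - 1

/-- The action dimension at `m₀`: the lower limit, as `m → m₀`, of the action dimensions of the
pairs of pairings on the cotangent spaces at `m`. -/
def actionDimAt (P₁ P₂ : TensorField 𝕜 E M) (m₀ : M) : ℕ :=
  Filter.liminf (fun m => linearActionDim (P₁ m) (P₂ m)) (𝓝 m₀)

/-! ### Independence of functions -/

/-- `p` holds at generic points of `U`, that is, on an open dense subset of `U`. -/
def Generically (U : Set M) (p : M → Prop) : Prop :=
  ∃ V : Set M, IsOpen V ∧ V ⊆ U ∧ U ⊆ closure V ∧ ∀ m ∈ V, p m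

variable (E) in
/-- The functions `F i` are independent on `U`: at generic points of `U` their differentials are
linearly independent. -/
def IndependentOn {ι : Type*} (F : ι → M → 𝕜) (U : Set M) : Prop :=
  Generically U fun m => LinearIndependent 𝕜 fun i => diffAt E (F i) m

variable (E) in
/-- The function `G` depends functionally on the functions `F i` on `U`: at generic points of `U`
its differential is a linear combination of theirs. -/
def DependsOn {ι : Type*} (G : M → 𝕜) (F : ι → M → 𝕜) (U : Set M) : Prop :=
  Generically U fun m => diffAt E G m ∈ Submodule.span 𝕜 (Set.range fun i => diffAt E (F i) m)

/-! ### The anchored Lenard scheme -/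

/-- `F` is a Casimir function on `U` for the bracket defined by `P`. -/
def IsCasimirOn (P : TensorField 𝕜 E M) (F : M → 𝕜) (U : Set M) : Prop :=
  SmoothOn E F U ∧ ∀ V : Set M, IsOpen V → V ⊆ U → ∀ f : M → 𝕜, SmoothOn E f V →
    ∀ m ∈ V, bracket P F f m = 0

/-- The functions `F i` form a maximal independent collection of Casimir functions on `U`: they
are independent Casimir functions, and every Casimir function on an open subset of `U` depends
on them. -/
structure IsMaximalCasimirCollection (P : TensorField 𝕜 E M) {ι : Type*} (F : ι → M → 𝕜)
    (U : Set M) : Prop where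
  casimir : ∀ i, IsCasimirOn P (F i) U
  independent : IndependentOn E F U
  maximal : ∀ V : Set M, IsOpen V → V ⊆ U → ∀ G : M → 𝕜, IsCasimirOn P G V → DependsOn E G F V

/-- The formal series `H₀ + λ⁻¹ H₁ + λ⁻² H₂ + …` is an anchored formal `λ`-family on `U`:
`H₀` is a Casimir function for the first bracket, and `{H_i, f}₂ = -{H_{i+1}, f}₁` for every `i`
and `f`. -/
structure IsAnchoredFamily (P₁ P₂ : TensorField 𝕜 E M) (H : ℕ → M → 𝕜) (U : Set M) : Prop where
  smooth : ∀ i, SmoothOn E (H i) U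
  anchored : IsCasimirOn P₁ (H 0) U
  recurrence : ∀ i, ∀ V : Set M, IsOpen V → V ⊆ U → ∀ f : M → 𝕜, SmoothOn E f V →
    ∀ m ∈ V, bracket P₂ (H i) f m = -bracket P₁ (H (i + 1)) f m

/-- The infinite sequences `H t 0, H t 1, …`, `t = 1, …, r`, are an output on `U` of the anchored
Lenard scheme, continued indefinitely: the initial functions form a maximal independent collection
of Casimir functions for the first bracket, each sequence solves the recurrence relations, the
functions `H t i` with `i ≤ k t` are independent, and all `H t i` depend on them. -/
structure IsAnchoredLenardScheme (P₁ P₂ : TensorField 𝕜 E M) (U : Set M) {r : ℕ}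
    (H : Fin r → ℕ → M → 𝕜) (k : Fin r → ℕ) : Prop where
  initial : IsMaximalCasimirCollection P₁ (fun t => H t 0) U
  family : ∀ t, IsAnchoredFamily P₁ P₂ (H t) U
  independent : IndependentOn E (fun p : Σ t : Fin r, Fin (k t + 1) => H p.1 p.2) U
  dependent : ∀ t i, DependsOn E (H t i) (fun p : Σ t : Fin r, Fin (k t + 1) => H p.1 p.2) U

/-- The structure is strictly Lenard-integrable at `m₀`: on a neighbourhood of `m₀` the anchored
Lenard scheme can be continued indefinitely, and the number of independent functions it provides
is the action dimension at `m₀`. -/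
def IsStrictlyLenardIntegrableAt (P₁ P₂ : TensorField 𝕜 E M) (m₀ : M) : Prop :=
  ∃ U : Set M, IsOpen U ∧ m₀ ∈ U ∧ ∃ (r : ℕ) (H : Fin r → ℕ → M → 𝕜) (k : Fin r → ℕ),
    IsAnchoredLenardScheme P₁ P₂ U H k ∧ ∑ t, (k t + 1) = actionDimAt P₁ P₂ m₀

end Brackets

end Bihamiltonian

end

/-! Pointwise, everything is Kronecker's theory of pencils `B₁ + μ B₂` of skew forms. Call covectors
`a₀, a₁, …` with `B₁ a₀ = 0` and `B₂ aᵢ = -B₁ aᵢ₊₁` a solution; the differentials of an anchored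
family form one. The space splits into Kronecker blocks of dimensions `2kⱼ-1` and a rest `J` on
which the pencil is nondegenerate for almost all `μ` (`exists_kronecker_summand`,
`IsBlockDecomposition.exists_frame`). Solutions vanish on `J` (`eq_zero_of_isNondegenerateOn`) and
involve only the even basis vectors of the blocks, so they stay in a space of dimension `∑ kⱼ`
(`KroneckerFrame.solution_mem_evenSpan`). The action dimension is `∑ kⱼ + dim J / 2`; solutions can
fill it only if `J = 0`.

From integrability to homogeneity: the number of Kronecker blocks is the least corank in the pencil,
so the action dimension is upper semicontinuous, and the points where it is at most its lower limit
at `m₀` form an open set adhering to `m₀`. At generic points of this set the Lenard functions force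
`J = 0`. To make the block sizes constant, consider solutions of length `n` that end by zeros: they
form a space of dimension `∑ (n+1-kⱼ)⁺`, these dimensions are upper semicontinuous, and they
determine the sizes (`exists_equiv_of_sum_eq`). Finitely many such functions become constant on a
common open set that still adheres to `m₀` (`exists_isOpen_const`).

From homogeneity to integrability: indecomposable blocks of odd dimension are Kronecker, so every
form of the pencil has corank equal to the number `l` of blocks. The Poisson structures of the
pencil then have `l` independent Casimir functions depending smoothly on `μ`
(`exists_parametric_casimirs`), and their Taylor coefficients at `μ = 0` solve the recurrence
(`exists_lenard_sequences`). At `m₀` the differentials span the even vectors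
(`KroneckerFrame.span_solutions_eq`) and initial segments form a basis of this span
(`exists_basis_of_solutions`). Independence persists nearby, and there the dimension of the space of
even vectors makes all other terms dependent.

The analytic input is a Frobenius theorem over `ℝ` and `ℂ` at once (`exists_firstIntegrals`): the
leaf equation is solved along real rays, as an integral equation in a Banach space of continuous
curves, by the inverse function theorem. -/

noncomputable section

namespace Bihamiltonian

/-! ### Superposition operators on spaces of continuous maps. -/

section Superposition

universe u

variable {𝕜 : Type*} [RCLike 𝕜] {K : Type*} [TopologicalSpace K] [CompactSpace K]
  {F G : Type u} [NormedAddCommGroup F] [NormedSpace 𝕜 F] [NormedAddCommGroup G] [NormedSpace 𝕜 G]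

open Classical in
/-- The superposition operator `u ↦ f ∘ u` on continuous maps, with value `0` where `f ∘ u` is
discontinuous. -/
def superposition (f : F → G) (u : C(K, F)) : C(K, G) :=
  if h : Continuous (f ∘ u) then ⟨f ∘ u, h⟩ else 0

/-- The continuous maps with values in `Ω`. -/
def mapsInto (K : Type*) [TopologicalSpace K] (Ω : Set F) : Set C(K, F) := {u | ∀ k, u k ∈ Ω}

lemma isOpen_mapsInto {Ω : Set F} (hΩ : IsOpen Ω) : IsOpen (mapsInto K Ω) := by
  have := ContinuousMap.isOpen_setOfPred_mapsTo (isCompact_univ (X := K)) hΩ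
  simpa [mapsInto, Set.MapsTo] using this

lemma superposition_apply {f : F → G} {Ω : Set F} (hf : ContinuousOn f Ω) {u : C(K, F)}
    (hu : u ∈ mapsInto K Ω) (k : K) : superposition f u k = f (u k) := by
  have h : Continuous (f ∘ u) := hf.comp_continuous u.continuous hu
  simp [superposition, h]

/-- Pointwise application of a continuous family of operators to a continuous map. -/
def pointwiseApply (𝕜 : Type*) [RCLike 𝕜] (K : Type*) [TopologicalSpace K] [CompactSpace K]
    (F G : Type u) [NormedAddCommGroup F] [NormedSpace 𝕜 F] [NormedAddCommGroup G]
    [NormedSpace 𝕜 G] : C(K, F →L[𝕜] G) →L[𝕜] C(K, F) →L[𝕜] C(K, G) :=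
  LinearMap.mkContinuous₂
    (LinearMap.mk₂ 𝕜 (fun (A : C(K, F →L[𝕜] G)) (h : C(K, F)) =>
        (⟨fun k => A k (h k), A.continuous.clm_apply h.continuous⟩ : C(K, G)))
      (fun A B h => by ext; simp) (fun c A h => by ext; simp)
      (fun A h h' => by ext; simp) (fun c A h => by ext; simp)) 1
    (fun A h => by
      rw [one_mul]
      refine (ContinuousMap.norm_le _ (by positivity)).2 fun k => ?_
      exact ((A k).le_opNorm _).trans
        (mul_le_mul (A.norm_coe_le_norm k) (h.norm_coe_le_norm k) (norm_nonneg _) (by positivity)))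

@[simp] lemma pointwiseApply_apply (A : C(K, F →L[𝕜] G)) (h : C(K, F)) (k : K) :
    pointwiseApply 𝕜 K F G A h k = A k (h k) := rfl

/-- The image of `u` is compact, so it has a uniform neighbourhood inside `Ω`, and `f` is uniformly
continuous at its points. Hence one `δ` serves all `k`. -/
lemma exists_uniform_radius {f : F → G} {Ω : Set F} (hΩ : IsOpen Ω) (hf : ContinuousOn f Ω)
    {u : C(K, F)} (hu : u ∈ mapsInto K Ω) {ε : ℝ} (hε : 0 < ε) :
    ∃ δ > 0, ∀ k, ∀ y, dist y (u k) < δ → y ∈ Ω ∧ dist (f y) (f (u k)) < ε := by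
  have hc : IsCompact (Set.range u) := isCompact_range u.continuous
  have hsub : Set.range u ⊆ Ω := by rintro _ ⟨k, rfl⟩; exact hu k
  have h1 := hc.uniformContinuousAt_of_continuousAt f
    (fun a ha => hf.continuousAt (hΩ.mem_nhds (hsub ha))) (Metric.dist_mem_uniformity hε)
  obtain ⟨δ₁, hδ₁, h1⟩ := Metric.mem_uniformity_dist.1 h1
  obtain ⟨δ₂, hδ₂, h2⟩ := hc.exists_thickening_subset_open hΩ hsub
  refine ⟨min δ₁ δ₂, lt_min hδ₁ hδ₂, fun k y hy => ⟨h2 ?_, ?_⟩⟩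
  · exact Metric.mem_thickening_iff.2 ⟨u k, ⟨k, rfl⟩, hy.trans_le (min_le_right _ _)⟩
  · have := h1 (a := u k) (b := y) (by rw [dist_comm]; exact hy.trans_le (min_le_left _ _)) ⟨k, rfl⟩
    rw [dist_comm]; exact this

lemma continuousOn_superposition {f : F → G} {Ω : Set F} (hΩ : IsOpen Ω) (hf : ContinuousOn f Ω) :
    ContinuousOn (superposition f : C(K, F) → C(K, G)) (mapsInto K Ω) := by
  intro u hu
  refine ContinuousAt.continuousWithinAt (Metric.continuousAt_iff.2 fun ε hε => ?_)
  -- The distance of continuous maps is a supremum: strict pointwise bounds only give `≤`, hence `ε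
  -- / 2`.
  obtain ⟨δ, hδ, h⟩ := exists_uniform_radius hΩ hf hu (half_pos hε)
  refine ⟨δ, hδ, fun v hv => ?_⟩
  have hv' : ∀ k, dist (v k) (u k) < δ := fun k => (ContinuousMap.dist_apply_le_dist k).trans_lt hv
  have hvΩ : v ∈ mapsInto K Ω := fun k => (h k _ (hv' k)).1
  refine lt_of_le_of_lt ((ContinuousMap.dist_le (half_pos hε).le).2 fun k => ?_) (half_lt_self hε)
  rw [superposition_apply hf hu, superposition_apply hf hvΩ]
  exact (h k _ (hv' k)).2.le

/-- At each `k` this is the mean value inequality for `f` minus its linear part at `u k`, on a ball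
where the derivative varies by less than `ε`. The radius does not depend on `k`. -/
lemma hasFDerivAt_superposition {f : F → G} {Ω : Set F} (hΩ : IsOpen Ω) (hf : ContDiffOn 𝕜 1 f Ω)
    {u : C(K, F)} (hu : u ∈ mapsInto K Ω) :
    HasFDerivAt (superposition f : C(K, F) → C(K, G))
      (pointwiseApply 𝕜 K F G (superposition (fderiv 𝕜 f) u)) u := by
  have hd : ContinuousOn (fderiv 𝕜 f) Ω := hf.continuousOn_fderiv_of_isOpen hΩ le_rfl
  have hfc := hf.continuousOn
  rw [hasFDerivAt_iff_isLittleO_nhds_zero, Asymptotics.isLittleO_iff]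
  intro ε hε
  obtain ⟨δ, hδ, h⟩ := exists_uniform_radius hΩ hd hu hε
  filter_upwards [Metric.ball_mem_nhds (0 : C(K, F)) hδ] with v hv
  have hv' : ∀ k, dist (u k + v k) (u k) < δ := fun k => by
    rw [dist_eq_norm, add_sub_cancel_left]
    exact (v.norm_coe_le_norm k).trans_lt (by simpa using hv)
  have hvΩ : u + v ∈ mapsInto K Ω := fun k => (h k _ (hv' k)).1
  refine (ContinuousMap.norm_le _ (by positivity)).2 fun k => ?_
  rw [ContinuousMap.sub_apply, ContinuousMap.sub_apply, pointwiseApply_apply,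
    superposition_apply hfc hvΩ, superposition_apply hfc hu, superposition_apply hd hu]
  let _ : NormedSpace ℝ F := NormedSpace.restrictScalars ℝ 𝕜 F
  have key := (convex_ball (u k) δ).norm_image_sub_le_of_norm_hasFDerivWithin_le' (𝕜 := 𝕜)
    (f := f) (f' := fderiv 𝕜 f) (φ := fderiv 𝕜 f (u k)) (C := ε)
    (fun x hx => (((hf.differentiableOn one_ne_zero).differentiableAt
      (hΩ.mem_nhds (h k x hx).1)).hasFDerivAt).hasFDerivWithinAt)
    (fun x hx => by rw [← dist_eq_norm]; exact (h k x hx).2.le)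
    (Metric.mem_ball_self hδ) (Metric.mem_ball.2 (hv' k))
  rw [add_sub_cancel_left] at key
  rw [ContinuousMap.add_apply]
  exact key.trans (mul_le_mul_of_nonneg_left (v.norm_coe_le_norm k) hε.le)

/-- The derivative of `superposition f` is `superposition (fderiv 𝕜 f)` followed by a continuous
linear map, so the order of smoothness is raised by induction. The step replaces `G` by `F →L[𝕜] G`;
hence the quantifier over `G` and the common universe of `F` and `G`. -/
lemma contDiffOn_superposition_nat {Ω : Set F} (hΩ : IsOpen Ω) (n : ℕ) :
    ∀ (G : Type u) [NormedAddCommGroup G] [NormedSpace 𝕜 G] (f : F → G), ContDiffOn 𝕜 n f Ω →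
      ContDiffOn 𝕜 n (superposition f : C(K, F) → C(K, G)) (mapsInto K Ω) := by
  induction n with
  | zero =>
    intro G _ _ f hf
    exact contDiffOn_zero.2 (continuousOn_superposition hΩ hf.continuousOn)
  | succ n ih =>
    intro G _ _ f hf
    have hf1 : ContDiffOn 𝕜 1 f Ω := hf.of_le (by simp)
    have hO := isOpen_mapsInto (K := K) hΩ
    push_cast at hf ⊢
    rw [contDiffOn_succ_iff_fderiv_of_isOpen hΩ] at hf
    rw [contDiffOn_succ_iff_fderiv_of_isOpen hO]
    refine ⟨fun u hu =>
      (hasFDerivAt_superposition hΩ hf1 hu).differentiableAt.differentiableWithinAt,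
      by simp, ?_⟩
    refine ContDiffOn.congr (f := pointwiseApply 𝕜 K F G ∘ superposition (fderiv 𝕜 f)) ?_
      fun u hu => (hasFDerivAt_superposition hΩ hf1 hu).fderiv
    exact (pointwiseApply 𝕜 K F G).contDiff.comp_contDiffOn (ih _ _ hf.2.2)

theorem contDiffOn_superposition {f : F → G} {Ω : Set F} (hΩ : IsOpen Ω)
    (hf : ContDiffOn 𝕜 ∞ f Ω) :
    ContDiffOn 𝕜 ∞ (superposition f : C(K, F) → C(K, G)) (mapsInto K Ω) :=
  contDiffOn_infty.2 fun n => contDiffOn_superposition_nat hΩ n G f (contDiffOn_infty.1 hf n)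

end Superposition

/-! ### The inverse function theorem on an open set. -/

section InverseFunction

variable {𝕜 : Type*} [RCLike 𝕜] {X Y : Type*} [NormedAddCommGroup X] [NormedSpace 𝕜 X]
  [CompleteSpace X] [NormedAddCommGroup Y] [NormedSpace 𝕜 Y]

/-- The inverse function theorem with a local inverse that is smooth on an open set. -/
theorem exists_contDiffOn_localInverse {f : X → Y} {S : Set X} (hS : IsOpen S) {x₀ : X}
    (hx₀ : x₀ ∈ S) (hf : ContDiffOn 𝕜 ∞ f S) (f' : X ≃L[𝕜] Y)
    (hf' : HasFDerivAt f (f' : X →L[𝕜] Y) x₀) :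
    ∃ e : OpenPartialHomeomorph X Y, x₀ ∈ e.source ∧ e.source ⊆ S ∧ (∀ x, e x = f x) ∧
      (∀ x ∈ e.source, (fderiv 𝕜 f x).IsInvertible) ∧ ContDiffOn 𝕜 ∞ e.symm e.target := by
  have hat : ContDiffAt 𝕜 ∞ f x₀ := hf.contDiffAt (hS.mem_nhds hx₀)
  let e₀ := hat.toOpenPartialHomeomorph f hf' (by simp)
  have hcont : ContinuousOn (fderiv 𝕜 f) S := hf.continuousOn_fderiv_of_isOpen hS (by simp)
  set R : Set (X →L[𝕜] Y) := Set.range ((↑) : (X ≃L[𝕜] Y) → X →L[𝕜] Y) with hR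
  have hRo : IsOpen R := ContinuousLinearEquiv.isOpen
  -- Invertibility of the derivative is an open condition. Shrinking to it makes the inverse smooth
  -- on the whole target and not only at the image of `x₀`.
  set S' := S ∩ fderiv 𝕜 f ⁻¹' R with hS'
  have hS'o : IsOpen S' := hcont.isOpen_inter_preimage hS hRo
  have hx₀' : x₀ ∈ S' := ⟨hx₀, by rw [Set.mem_preimage, hf'.fderiv]; exact ⟨f', rfl⟩⟩
  refine ⟨e₀.restrOpen S' hS'o, ?_, ?_, ?_, ?_, ?_⟩
  · exact ⟨hat.mem_toOpenPartialHomeomorph_source hf' (by simp), hx₀'⟩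
  · exact fun x hx => hx.2.1
  · intro x; rfl
  · rintro x ⟨-, -, g, hg⟩
    exact ⟨g, hg⟩
  · intro y hy
    refine ContDiffAt.contDiffWithinAt ?_
    have hx := (e₀.restrOpen S' hS'o).map_target hy
    obtain ⟨-, hxS, g, hg⟩ := id hx
    refine (e₀.restrOpen S' hS'o).contDiffAt_symm (f₀' := g) hy ?_ ?_
    · rw [hg]
      exact ((hf.differentiableOn (by simp)).differentiableAt (hS.mem_nhds hxS)).hasFDerivAt
    · exact hf.contDiffAt (hS.mem_nhds hxS)

end InverseFunction

/-! ### Total differential equations along rays. -/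

section Frobenius

universe u

open unitInterval

/-- Integration of a continuous map on the unit interval, from `1`. -/
def integralFromOne (𝕜 : Type*) [RCLike 𝕜] (B : Type*) [NormedAddCommGroup B] [NormedSpace 𝕜 B]
    [NormedSpace ℝ B] [IsScalarTower ℝ 𝕜 B] : C(I, B) →L[𝕜] C(I, B) :=
  LinearMap.mkContinuous
    { toFun := fun g => ⟨fun s => ∫ τ in (1 : ℝ)..s, Set.IccExtend zero_le_one g τ,
        (intervalIntegral.continuous_primitive
          (fun a b => (g.continuous.Icc_extend' (h := zero_le_one)).intervalIntegrable a b) 1).comp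
          continuous_subtype_val⟩
      map_add' := fun g g' => by
        ext s
        exact intervalIntegral.integral_add
          ((g.continuous.Icc_extend' (h := zero_le_one)).intervalIntegrable _ _)
          ((g'.continuous.Icc_extend' (h := zero_le_one)).intervalIntegrable _ _)
      map_smul' := fun c g => by
        ext s
        exact intervalIntegral.integral_smul c _ } 1
    (fun g => by
      rw [one_mul]
      refine (ContinuousMap.norm_le _ (by positivity)).2 fun s => ?_
      refine (intervalIntegral.norm_integral_le_of_norm_le_const (C := ‖g‖)
        fun τ _ => g.norm_coe_le_norm _).trans ?_
      have h0 := s.2.1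
      have h1 := s.2.2
      have : |(s : ℝ) - 1| ≤ 1 := by rw [abs_le]; constructor <;> linarith
      exact mul_le_of_le_one_right (norm_nonneg _) this)

variable {𝕜 : Type*} [RCLike 𝕜]

lemma integralFromOne_apply {B : Type*} [NormedAddCommGroup B] [NormedSpace 𝕜 B]
    [NormedSpace ℝ B] [IsScalarTower ℝ 𝕜 B] (g : C(I, B)) (s : I) :
    integralFromOne 𝕜 B g s = ∫ τ in (1 : ℝ)..s, Set.IccExtend zero_le_one g τ := rfl

variable {A B : Type u} [NormedAddCommGroup A] [NormedSpace 𝕜 A]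
  [NormedAddCommGroup B] [NormedSpace 𝕜 B]
  [NormedSpace ℝ A] [IsScalarTower ℝ 𝕜 A] [NormedSpace ℝ B] [IsScalarTower ℝ 𝕜 B]

/-- The ray `τ ↦ τ • a`. -/
def rayMap (𝕜 : Type*) [RCLike 𝕜] (A : Type*) [NormedAddCommGroup A] [NormedSpace 𝕜 A]
    [NormedSpace ℝ A] [IsScalarTower ℝ 𝕜 A] : A →L[𝕜] C(I, A) :=
  LinearMap.mkContinuous
    { toFun := fun a => ⟨fun τ => (τ : ℝ) • a, by fun_prop⟩
      map_add' := fun a b => by ext; simp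
      map_smul' := fun c a => by ext τ; exact smul_comm (τ : ℝ) c a } 1
    (fun a => by
      rw [one_mul]
      refine (ContinuousMap.norm_le _ (by positivity)).2 fun τ => ?_
      change ‖(τ : ℝ) • a‖ ≤ _
      rw [norm_smul, Real.norm_of_nonneg τ.2.1]
      exact mul_le_of_le_one_left (norm_nonneg _) τ.2.2)

/-- Constant maps. -/
def constMap (𝕜 : Type*) [RCLike 𝕜] (A : Type*) [NormedAddCommGroup A] [NormedSpace 𝕜 A] :
    A →L[𝕜] C(I, A) :=
  LinearMap.mkContinuous
    { toFun := fun a => ContinuousMap.const I a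
      map_add' := fun a b => by ext; simp
      map_smul' := fun c a => by ext τ; simp } 1
    (fun a => by
      rw [one_mul]
      exact (ContinuousMap.norm_le _ (by positivity)).2 fun τ => le_rfl)

/-- Triples of continuous maps. -/
def tripleMap (𝕜 : Type*) [RCLike 𝕜] (A B D : Type*) [NormedAddCommGroup A] [NormedSpace 𝕜 A]
    [NormedAddCommGroup B] [NormedSpace 𝕜 B] [NormedAddCommGroup D] [NormedSpace 𝕜 D] :
    (C(I, A) × C(I, B) × C(I, D)) →L[𝕜] C(I, A × B × D) :=
  LinearMap.mkContinuous
    { toFun := fun p => p.1.prodMk (p.2.1.prodMk p.2.2)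
      map_add' := fun a b => by ext <;> simp
      map_smul' := fun c a => by ext <;> simp } 1
    (fun p => by
      rw [one_mul]
      refine (ContinuousMap.norm_le _ (by positivity)).2 fun τ => ?_
      refine norm_prod_le_iff.2 ⟨(p.1.norm_coe_le_norm τ).trans (norm_fst_le p),
        norm_prod_le_iff.2 ⟨?_, ?_⟩⟩
      · exact (p.2.1.norm_coe_le_norm τ).trans ((norm_fst_le p.2).trans (norm_snd_le p))
      · exact (p.2.2.norm_coe_le_norm τ).trans ((norm_snd_le p.2).trans (norm_snd_le p)))

/-- The argument `τ ↦ (τ • a, y τ, a)` of the total differential equation along rays. -/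
def rayArgument (𝕜 : Type*) [RCLike 𝕜] (A B : Type u) [NormedAddCommGroup A] [NormedSpace 𝕜 A]
    [NormedAddCommGroup B] [NormedSpace 𝕜 B] [NormedSpace ℝ A] [IsScalarTower ℝ 𝕜 A] :
    ((A × B) × C(I, B)) →L[𝕜] C(I, A × B × A) :=
  (tripleMap 𝕜 A B A).comp
    (((rayMap 𝕜 A).comp ((ContinuousLinearMap.fst 𝕜 A B).comp
        (ContinuousLinearMap.fst 𝕜 (A × B) C(I, B)))).prod
      ((ContinuousLinearMap.snd 𝕜 (A × B) C(I, B)).prod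
        ((constMap 𝕜 A).comp ((ContinuousLinearMap.fst 𝕜 A B).comp
          (ContinuousLinearMap.fst 𝕜 (A × B) C(I, B))))))

lemma rayArgument_apply (p : (A × B) × C(I, B)) (τ : I) :
    rayArgument 𝕜 A B p τ = ((τ : ℝ) • p.1.1, p.2 τ, p.1.1) := rfl

/-- The integrand `(a', b', a) ↦ W (a', b') a` of the total differential equation. -/
def rayField (W : A × B → A →L[𝕜] B) (p : A × B × A) : B := W (p.1, p.2.1) p.2.2

/-- The integrated total differential equation along rays, as a fibered map. -/
def rayEquation (W : A × B → A →L[𝕜] B) (p : (A × B) × C(I, B)) : (A × B) × C(I, B) :=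
  (p.1, p.2 - constMap 𝕜 B p.1.2 -
    integralFromOne 𝕜 B (superposition (rayField W) (rayArgument 𝕜 A B p)))

/-- The domain of the integrand. -/
def rayDomain (Ω : Set (A × B)) : Set (A × B × A) := {p | (p.1, p.2.1) ∈ Ω}

lemma isOpen_rayDomain {Ω : Set (A × B)} (hΩ : IsOpen Ω) : IsOpen (rayDomain Ω) :=
  hΩ.preimage (by fun_prop : Continuous fun p : A × B × A => (p.1, p.2.1))

lemma contDiffOn_rayField {Ω : Set (A × B)} {W : A × B → A →L[𝕜] B}
    (hW : ContDiffOn 𝕜 ∞ W Ω) : ContDiffOn 𝕜 ∞ (rayField W) (rayDomain Ω) := by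
  have h1 : ContDiff 𝕜 ∞ fun p : A × B × A => (p.1, p.2.1) := by fun_prop
  have h2 : ContDiff 𝕜 ∞ fun p : A × B × A => p.2.2 := by fun_prop
  exact (hW.comp h1.contDiffOn (fun p hp => hp)).clm_apply h2.contDiffOn

lemma fderiv_rayField {Ω : Set (A × B)} (hΩ : IsOpen Ω) {W : A × B → A →L[𝕜] B}
    (hW : ContDiffOn 𝕜 ∞ W Ω) {p : A × B × A} (hp : p ∈ rayDomain Ω) (q : A × B × A) :
    fderiv 𝕜 (rayField W) p q =
      fderiv 𝕜 W (p.1, p.2.1) (q.1, q.2.1) p.2.2 + W (p.1, p.2.1) q.2.2 := by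
  have h1 : HasFDerivAt (fun p : A × B × A => (p.1, p.2.1))
      ((ContinuousLinearMap.fst 𝕜 A (B × A)).prod
        ((ContinuousLinearMap.fst 𝕜 B A).comp (ContinuousLinearMap.snd 𝕜 A (B × A)))) p :=
    ContinuousLinearMap.hasFDerivAt ((ContinuousLinearMap.fst 𝕜 A (B × A)).prod
        ((ContinuousLinearMap.fst 𝕜 B A).comp (ContinuousLinearMap.snd 𝕜 A (B × A))))
  have h2 : HasFDerivAt (fun p : A × B × A => p.2.2)
      ((ContinuousLinearMap.snd 𝕜 B A).comp (ContinuousLinearMap.snd 𝕜 A (B × A))) p :=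
    ContinuousLinearMap.hasFDerivAt
      ((ContinuousLinearMap.snd 𝕜 B A).comp (ContinuousLinearMap.snd 𝕜 A (B × A)))
  have h3 : HasFDerivAt W (fderiv 𝕜 W (p.1, p.2.1)) (p.1, p.2.1) :=
    ((hW.differentiableOn (by simp)).differentiableAt (hΩ.mem_nhds hp)).hasFDerivAt
  have h4 := (HasFDerivAt.comp (g := W) p h3 h1).clm_apply h2
  have h5 : HasFDerivAt (rayField W) _ p := h4
  rw [h5.fderiv]
  simp [add_comm]

/-- The domain of `rayEquation`. -/
def rayEquationDomain (𝕜 : Type*) [RCLike 𝕜] {A B : Type u} [NormedAddCommGroup A]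
    [NormedSpace 𝕜 A] [NormedAddCommGroup B] [NormedSpace 𝕜 B] [NormedSpace ℝ A]
    [IsScalarTower ℝ 𝕜 A] (Ω : Set (A × B)) : Set ((A × B) × C(I, B)) :=
  rayArgument 𝕜 A B ⁻¹' mapsInto I (rayDomain Ω)

/-- The point `(a, b)` is carried along as first component, so that the inverse function theorem
yields the curve with `y' = W (τ a, y) a` and `y 1 = b` as a smooth function of `(a, b)`. -/
lemma contDiffOn_rayEquation {Ω : Set (A × B)} (hΩ : IsOpen Ω) {W : A × B → A →L[𝕜] B}
    (hW : ContDiffOn 𝕜 ∞ W Ω) :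
    ContDiffOn 𝕜 ∞ (rayEquation W) (rayEquationDomain 𝕜 Ω) := by
  have h1 : ContDiffOn 𝕜 ∞ (fun p => superposition (rayField W) (rayArgument 𝕜 A B p))
      (rayEquationDomain 𝕜 Ω) :=
    (contDiffOn_superposition (K := I) (isOpen_rayDomain hΩ) (contDiffOn_rayField hW)).comp
      (rayArgument 𝕜 A B).contDiff.contDiffOn (fun p hp => hp)
  have h2 := (integralFromOne 𝕜 B).contDiff (n := ∞).comp_contDiffOn h1
  have h3 : ContDiff 𝕜 ∞ fun p : (A × B) × C(I, B) => p.2 - constMap 𝕜 B p.1.2 := by fun_prop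
  exact contDiff_fst.contDiffOn.prodMk (h3.contDiffOn.sub h2)

lemma hasFDerivAt_rayEquation {Ω : Set (A × B)} (hΩ : IsOpen Ω) {W : A × B → A →L[𝕜] B}
    (hW : ContDiffOn 𝕜 ∞ W Ω) {p : (A × B) × C(I, B)} (hp : p ∈ rayEquationDomain 𝕜 Ω)
    (q : (A × B) × C(I, B)) :
    fderiv 𝕜 (rayEquation W) p q = (q.1, q.2 - constMap 𝕜 B q.1.2 -
      integralFromOne 𝕜 B (pointwiseApply 𝕜 I _ _
        (superposition (fderiv 𝕜 (rayField W)) (rayArgument 𝕜 A B p)) (rayArgument 𝕜 A B q))) := by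
  have h1 := hasFDerivAt_superposition (𝕜 := 𝕜) (isOpen_rayDomain hΩ)
    ((contDiffOn_rayField hW).of_le (by simp)) hp
  have h2 := (integralFromOne 𝕜 B).hasFDerivAt.comp p (h1.comp p (rayArgument 𝕜 A B).hasFDerivAt)
  have h3 : HasFDerivAt (fun p : (A × B) × C(I, B) => p.2 - constMap 𝕜 B p.1.2)
      (ContinuousLinearMap.snd 𝕜 (A × B) C(I, B) - (constMap 𝕜 B).comp
        ((ContinuousLinearMap.snd 𝕜 A B).comp (ContinuousLinearMap.fst 𝕜 (A × B) C(I, B)))) p :=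
    ContinuousLinearMap.hasFDerivAt (ContinuousLinearMap.snd 𝕜 (A × B) C(I, B) -
      (constMap 𝕜 B).comp
        ((ContinuousLinearMap.snd 𝕜 A B).comp (ContinuousLinearMap.fst 𝕜 (A × B) C(I, B))))
  have h4 : HasFDerivAt (rayEquation W) _ p := hasFDerivAt_fst.prodMk (h3.sub h2)
  rw [h4.fderiv]
  rfl

end Frobenius

/-! ### First integrals: the local Frobenius theorem. -/

section Frobenius

universe u

open unitInterval

variable {𝕜 : Type*} [RCLike 𝕜] {A B : Type u} [NormedAddCommGroup A] [NormedSpace 𝕜 A]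
  [NormedAddCommGroup B] [NormedSpace 𝕜 B]
  [NormedSpace ℝ A] [IsScalarTower ℝ 𝕜 A] [NormedSpace ℝ B] [IsScalarTower ℝ 𝕜 B]

lemma IccExtend_eventuallyEq {X : Type*} (f : ℝ → X) (g : I → X) (h : ∀ τ : I, g τ = f τ) {t : ℝ}
    (ht : t ∈ Set.Ioo (0 : ℝ) 1) : Set.IccExtend zero_le_one g =ᶠ[𝓝 t] f := by
  filter_upwards [isOpen_Ioo.mem_nhds ht] with τ hτ
  rw [Set.IccExtend_of_mem _ _ ⟨hτ.1.le, hτ.2.le⟩, h]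

/-- Along a solution of the integrated equation, `(v, W v)` and `τ ↦ τ • W v` solve the linearized
equation. -/
lemma fderiv_rayEquation_apply [CompleteSpace B] {Ω : Set (A × B)} (hΩ : IsOpen Ω)
    {W : A × B → A →L[𝕜] B} (hW : ContDiffOn 𝕜 ∞ W Ω)
    (hsymm : ∀ x ∈ Ω, ∀ u v, fderiv 𝕜 W x (u, W x u) v = fderiv 𝕜 W x (v, W x v) u)
    {p : (A × B) × C(I, B)} (hp : p ∈ rayEquationDomain 𝕜 Ω) (hsol : (rayEquation W p).2 = 0)
    (v : A) :
    p.1 ∈ Ω ∧ ∃ ζ : C(I, B), ζ 0 = 0 ∧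
      fderiv 𝕜 (rayEquation W) p ((v, W p.1 v), ζ) = ((v, W p.1 v), 0) := by
  obtain ⟨⟨a, b⟩, y⟩ := p
  have hmem : ∀ τ : I, ((τ : ℝ) • a, y τ) ∈ Ω := fun τ => hp τ
  set g : C(I, B) := superposition (rayField W) (rayArgument 𝕜 A B ((a, b), y)) with hg
  have hgτ : ∀ τ : I, g τ = W ((τ : ℝ) • a, y τ) a := fun τ => by
    rw [hg, superposition_apply (contDiffOn_rayField hW).continuousOn hp]; rfl
  have hy : ∀ s : I, y s = b + ∫ τ in (1 : ℝ)..s, Set.IccExtend zero_le_one g τ := fun s => by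
    have h1 : y - constMap 𝕜 B b - integralFromOne 𝕜 B g = 0 := hsol
    have h2 := congrArg (fun f : C(I, B) => f s) h1
    have h3 : y s - b - integralFromOne 𝕜 B g s = 0 := h2
    rw [integralFromOne_apply, sub_sub, sub_eq_zero] at h3
    exact h3
  have hy1 : y 1 = b := by simpa using hy 1
  have hpΩ : (a, b) ∈ Ω := by simpa [hy1] using hmem 1
  have hWc : Continuous fun τ : I => W ((τ : ℝ) • a, y τ) :=
    hW.continuousOn.comp_continuous (by fun_prop) hmem
  -- Moving `(a, b)` by `(v, W v)` should keep it in its leaf. Over the point `τ • a` the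
  -- displacement of the base is `τ • v`, so the curve moves by `τ • W v`, which vanishes at `τ =
  -- 0`.
  let ζ : C(I, B) := ⟨fun τ => (τ : ℝ) • W ((τ : ℝ) • a, y τ) v,
    continuous_subtype_val.smul (hWc.clm_apply continuous_const)⟩
  have hζ : ∀ τ, ζ τ = (τ : ℝ) • W ((τ : ℝ) • a, y τ) v := fun τ => rfl
  refine ⟨hpΩ, ζ, by simp [hζ], ?_⟩
  rw [hasFDerivAt_rayEquation hΩ hW hp]
  refine Prod.ext rfl ?_
  set k : C(I, B) := pointwiseApply 𝕜 I _ _ (superposition (fderiv 𝕜 (rayField W))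
    (rayArgument 𝕜 A B ((a, b), y))) (rayArgument 𝕜 A B ((v, W (a, b) v), ζ)) with hk
  have hkτ : ∀ τ : I, k τ = fderiv 𝕜 W ((τ : ℝ) • a, y τ)
      ((τ : ℝ) • v, ζ τ) a + W ((τ : ℝ) • a, y τ) v := fun τ => by
    rw [hk, pointwiseApply_apply, superposition_apply
      ((contDiffOn_rayField hW).continuousOn_fderiv_of_isOpen (isOpen_rayDomain hΩ) (by simp)) hp,
      fderiv_rayField hΩ hW (hp τ)]
    rfl
  have hderivy : ∀ t ∈ Set.Ioo (0 : ℝ) 1, HasDerivAt (Set.IccExtend zero_le_one y)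
      (Set.IccExtend zero_le_one g t) t := fun t ht => by
    have h1 : HasDerivAt (fun s : ℝ => b + ∫ τ in (1 : ℝ)..s, Set.IccExtend zero_le_one g τ)
        (Set.IccExtend zero_le_one g t) t :=
      (((g.continuous.Icc_extend' (h := zero_le_one)).integral_hasStrictDerivAt 1
        t).hasDerivAt).const_add b
    exact h1.congr_of_eventuallyEq (IccExtend_eventuallyEq _ _ hy ht)
  have hderivζ : ∀ t ∈ Set.Ioo (0 : ℝ) 1, HasDerivAt (Set.IccExtend zero_le_one ζ)
      (Set.IccExtend zero_le_one k t) t := fun t ht => by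
    have htI : t ∈ Set.Icc (0 : ℝ) 1 := ⟨ht.1.le, ht.2.le⟩
    have hext : Set.IccExtend zero_le_one y t = y ⟨t, htI⟩ := Set.IccExtend_of_mem _ _ htI
    have hcurve : HasDerivAt (fun s : ℝ => (s • a, Set.IccExtend zero_le_one y s))
        (a, W (t • a, y ⟨t, htI⟩) a) t := by
      have h1 := ((hasDerivAt_id t).smul_const a).prodMk (hderivy t ht)
      rw [Set.IccExtend_of_mem _ _ htI, hgτ] at h1
      simpa using h1
    have hWd : HasFDerivAt W ((fderiv 𝕜 W (t • a, y ⟨t, htI⟩)).restrictScalars ℝ)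
        (t • a, Set.IccExtend zero_le_one y t) := by
      rw [hext]
      exact (((hW.differentiableOn (by simp)).differentiableAt
        (hΩ.mem_nhds (hmem ⟨t, htI⟩))).hasFDerivAt).restrictScalars ℝ
    have h2 := hWd.comp_hasDerivAt t hcurve
    have h3 : HasDerivAt (fun s : ℝ => W (s • a, Set.IccExtend zero_le_one y s) v)
        (fderiv 𝕜 W (t • a, y ⟨t, htI⟩) (a, W (t • a, y ⟨t, htI⟩) a) v) t :=
      ((((ContinuousLinearMap.apply 𝕜 B v).restrictScalars ℝ).hasFDerivAt).comp_hasDerivAt t h2)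
    have h4 := (hasDerivAt_id t).smul h3
    -- Integrability enters here: `hsymm` exchanges `a` and `v` and identifies the derivative of `W
    -- v` along the curve with the linearized integrand.
    have h5 : Set.IccExtend zero_le_one k t = id t • fderiv 𝕜 W (t • a, y ⟨t, htI⟩)
        (a, W (t • a, y ⟨t, htI⟩) a) v +
          (1 : ℝ) • W (t • a, Set.IccExtend zero_le_one y t) v := by
      rw [Set.IccExtend_of_mem _ _ htI, hkτ, hζ, hext, one_smul, id, ← hsymm _ (hmem ⟨t, htI⟩) v a]
      have : (t • v, t • W (t • a, y ⟨t, htI⟩) v) = t • (v, W (t • a, y ⟨t, htI⟩) v) := rfl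
      have h6 : ∀ (L : (A × B) →L[𝕜] A →L[𝕜] B) (q : A × B), L (t • q) a = t • L q a :=
        fun L q => by rw [← algebraMap_smul 𝕜 t q, map_smul, smul_apply, algebraMap_smul]
      rw [this, h6]
    rw [h5]
    refine h4.congr_of_eventuallyEq ?_
    filter_upwards [isOpen_Ioo.mem_nhds ht] with τ hτ
    have hτI : τ ∈ Set.Icc (0 : ℝ) 1 := ⟨hτ.1.le, hτ.2.le⟩
    simp [Set.IccExtend_of_mem _ _ hτI, hζ]
  change ζ - constMap 𝕜 B (W (a, b) v) - integralFromOne 𝕜 B k = 0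
  ext s
  change ζ s - W (a, b) v - integralFromOne 𝕜 B k s = 0
  -- The fundamental theorem of calculus on `[s, 1]`. The derivative is known only in the open
  -- interval, because outside `I` the curves are extended by constants.
  have hint := intervalIntegral.integral_eq_sub_of_hasDerivAt_of_le s.2.2
    ((ζ.continuous.Icc_extend' (h := zero_le_one)).continuousOn)
    (fun t ht => hderivζ t ⟨s.2.1.trans_lt ht.1, ht.2⟩)
    ((k.continuous.Icc_extend' (h := zero_le_one)).intervalIntegrable _ _)
  rw [Set.IccExtend_of_mem _ _ s.2, Set.IccExtend_of_mem _ _ (Set.right_mem_Icc.2 zero_le_one),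
    hζ ⟨1, _⟩] at hint
  have hy1' : y ⟨1, Set.right_mem_Icc.2 zero_le_one⟩ = b := hy1
  rw [integralFromOne_apply, intervalIntegral.integral_symm, hint, hy1']
  simp

/-- The local Frobenius theorem in the form of first integrals of a total differential equation. -/
theorem exists_firstIntegrals_aux [CompleteSpace A] [CompleteSpace B] {Ω : Set (A × B)}
    (hΩ : IsOpen Ω) (h0 : (0, 0) ∈ Ω) {W : A × B → A →L[𝕜] B} (hW : ContDiffOn 𝕜 ∞ W Ω)
    (hsymm : ∀ x ∈ Ω, ∀ u v, fderiv 𝕜 W x (u, W x u) v = fderiv 𝕜 W x (v, W x v) u) :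
    ∃ Ω' : Set (A × B), IsOpen Ω' ∧ (0, 0) ∈ Ω' ∧ Ω' ⊆ Ω ∧ ∃ h : A × B → B,
      ContDiffOn 𝕜 ∞ h Ω' ∧ (∀ x ∈ Ω', ∀ v, fderiv 𝕜 h x (v, W x v) = 0) ∧
        ∀ w, fderiv 𝕜 h (0, 0) (0, w) = w := by
  set p₀ : (A × B) × C(I, B) := 0 with hp₀
  have hp₀mem : p₀ ∈ rayEquationDomain 𝕜 Ω := fun τ => by
    simpa [rayArgument_apply, rayDomain, hp₀] using h0
  have harg : rayArgument 𝕜 A B p₀ = 0 := map_zero _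
  have hval : rayEquation W p₀ = 0 := by
    have : superposition (rayField W) (rayArgument 𝕜 A B p₀) = 0 := by
      ext τ
      rw [superposition_apply (contDiffOn_rayField hW).continuousOn hp₀mem, harg]
      simp [rayField]
    refine Prod.ext rfl ?_
    change (0 : C(I, B)) - constMap 𝕜 B 0 - integralFromOne 𝕜 B (superposition (rayField W)
      (rayArgument 𝕜 A B p₀)) = 0
    rw [this]
    simp
  have hdom : IsOpen (rayEquationDomain 𝕜 Ω) :=
    (isOpen_mapsInto (isOpen_rayDomain hΩ)).preimage (rayArgument 𝕜 A B).continuous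
  -- At the base point `a = 0`, so the integrand has zero derivative in `y`. The linearization is
  -- therefore triangular with identities on the diagonal, and `T` is its off-diagonal entry.
  let T : (A × B) →L[𝕜] C(I, B) := -((constMap 𝕜 B).comp (ContinuousLinearMap.snd 𝕜 A B)) -
    (integralFromOne 𝕜 B).comp ((constMap 𝕜 B).comp ((W (0, 0)).comp
      (ContinuousLinearMap.fst 𝕜 A B)))
  let f' : ((A × B) × C(I, B)) ≃L[𝕜] ((A × B) × C(I, B)) :=
    (ContinuousLinearEquiv.refl 𝕜 (A × B)).skewProd (ContinuousLinearEquiv.refl 𝕜 C(I, B)) T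
  have hdiff : ∀ p ∈ rayEquationDomain 𝕜 Ω,
      HasFDerivAt (rayEquation W) (fderiv 𝕜 (rayEquation W) p) p := fun p hp =>
    (((contDiffOn_rayEquation hΩ hW).differentiableOn (by simp)).differentiableAt
      (hdom.mem_nhds hp)).hasFDerivAt
  have hf' : HasFDerivAt (rayEquation W) (f' : ((A × B) × C(I, B)) →L[𝕜] _) p₀ := by
    convert hdiff p₀ hp₀mem using 1
    refine ContinuousLinearMap.ext fun q => ?_
    rw [hasFDerivAt_rayEquation hΩ hW hp₀mem]
    have : pointwiseApply 𝕜 I _ _ (superposition (fderiv 𝕜 (rayField W))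
        (rayArgument 𝕜 A B p₀)) (rayArgument 𝕜 A B q) = constMap 𝕜 B (W (0, 0) q.1.1) := by
      ext τ
      rw [pointwiseApply_apply, superposition_apply
        ((contDiffOn_rayField hW).continuousOn_fderiv_of_isOpen (isOpen_rayDomain hΩ) (by simp))
        hp₀mem, fderiv_rayField hΩ hW (hp₀mem τ), rayArgument_apply, rayArgument_apply]
      simp [hp₀, constMap]
    rw [this]
    refine Prod.ext rfl ?_
    change q.2 + (-(constMap 𝕜 B q.1.2) - integralFromOne 𝕜 B (constMap 𝕜 B (W (0, 0) q.1.1))) =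
      q.2 - constMap 𝕜 B q.1.2 - integralFromOne 𝕜 B (constMap 𝕜 B (W (0, 0) q.1.1))
    abel
  obtain ⟨e, he₀, heS, heq, hinv, hsm⟩ := exists_contDiffOn_localInverse hdom hp₀mem
    (contDiffOn_rayEquation hΩ hW) f' hf'
  let ι : (A × B) →L[𝕜] (A × B) × C(I, B) := ContinuousLinearMap.inl 𝕜 _ _
  -- The first integral is the value at `τ = 0` of the curve with `y 1 = b`, the place where the
  -- leaf through `(a, b)` meets `a = 0`.
  let ev : ((A × B) × C(I, B)) →L[𝕜] B :=
    (ContinuousMap.evalCLM 𝕜 (0 : I)).comp (ContinuousLinearMap.snd 𝕜 (A × B) C(I, B))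
  set Ω' : Set (A × B) := ι ⁻¹' e.target with hΩ'
  have hΩ'o : IsOpen Ω' := e.open_target.preimage ι.continuous
  have hsol : ∀ x ∈ Ω', rayEquation W (e.symm (ι x)) = ι x := fun x hx => by
    rw [← heq]; exact e.right_inv hx
  have hfst : ∀ x ∈ Ω', (e.symm (ι x)).1 = x := fun x hx => congrArg Prod.fst (hsol x hx)
  have hsymmdiff : ∀ x ∈ Ω', HasFDerivAt (fun x => e.symm (ι x))
      ((fderiv 𝕜 e.symm (ι x)).comp ι) x := fun x hx =>
    (((hsm.differentiableOn (by simp)).differentiableAt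
      (e.open_target.mem_nhds hx)).hasFDerivAt).comp x ι.hasFDerivAt
  have hchain : ∀ x ∈ Ω', ∀ q, fderiv 𝕜 (rayEquation W) (e.symm (ι x))
      (fderiv 𝕜 e.symm (ι x) (ι q)) = ι q := fun x hx q => by
    have h1 := (hdiff _ (heS (e.map_target hx))).comp x (hsymmdiff x hx)
    have h2 : HasFDerivAt ι ι x := ι.hasFDerivAt
    have h3 := h2.congr_of_eventuallyEq (f₁ := rayEquation W ∘ fun x => e.symm (ι x)) (by
      filter_upwards [hΩ'o.mem_nhds hx] with z hz using hsol z hz)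
    exact congrArg (fun L : (A × B) →L[𝕜] _ => L q) (h1.unique h3)
  have hder : ∀ x ∈ Ω', ∀ q, fderiv 𝕜 (fun x => ev (e.symm (ι x))) x q =
      (fderiv 𝕜 e.symm (ι x) (ι q)).2 0 := fun x hx q => by
    have h1 : HasFDerivAt (fun x => ev (e.symm (ι x))) _ x :=
      ev.hasFDerivAt.comp x (hsymmdiff x hx)
    rw [h1.fderiv]; rfl
  -- Injectivity identifies the variation of the solution with any explicit solution of the
  -- linearized equation.
  have hinj : ∀ x ∈ Ω', Function.Injective (fderiv 𝕜 (rayEquation W) (e.symm (ι x))) :=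
    fun x hx => by
      obtain ⟨g, hg⟩ := hinv _ (e.map_target hx)
      rw [← hg]; exact g.injective
  have h0mem : ((0, 0) : A × B) ∈ Ω' := by
    have := e.map_source he₀
    rw [heq, hval] at this
    exact this
  have he0 : e.symm (ι (0, 0)) = p₀ := by
    have h1 := e.left_inv he₀
    rw [heq, hval] at h1
    exact h1
  refine ⟨Ω', hΩ'o, h0mem, fun x hx => ?_, fun x => ev (e.symm (ι x)),
    ev.contDiff.comp_contDiffOn (hsm.comp ι.contDiff.contDiffOn fun x hx => hx), ?_, ?_⟩
  · have := (fderiv_rayEquation_apply hΩ hW hsymm (heS (e.map_target hx))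
      (congrArg Prod.snd (hsol x hx)) 0).1
    rwa [hfst x hx] at this
  · intro x hx v
    obtain ⟨-, ζ, hζ0, hζ⟩ := fderiv_rayEquation_apply hΩ hW hsymm (heS (e.map_target hx))
      (congrArg Prod.snd (hsol x hx)) v
    rw [hfst x hx] at hζ
    rw [hder x hx, hinj x hx ((hchain x hx (v, W x v)).trans hζ.symm)]
    exact hζ0
  · intro w
    have h1 := hchain _ h0mem (0, w)
    -- Over `a = 0` the solution curves are constant, so their variation in the direction `(0, w)`
    -- is the constant `w`.
    have h2 : fderiv 𝕜 (rayEquation W) (e.symm (ι (0, 0))) (((0, w), constMap 𝕜 B w)) =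
        ι (0, w) := by
      rw [he0, hf'.fderiv]
      refine Prod.ext rfl ?_
      change constMap 𝕜 B w + (-(constMap 𝕜 B w) -
        integralFromOne 𝕜 B (constMap 𝕜 B (W (0, 0) 0))) = 0
      simp
    rw [hder _ h0mem, hinj _ h0mem (h1.trans h2.symm)]
    rfl

/-- The symmetry hypothesis is the integrability of the distribution spanned by the vectors `(v, W x
v)`. The rays have a real parameter also for `𝕜 = ℂ`; the real structures come from restriction of
scalars. -/
theorem exists_firstIntegrals {𝕜 : Type*} [RCLike 𝕜] {A B : Type u} [NormedAddCommGroup A]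
    [NormedSpace 𝕜 A] [CompleteSpace A] [NormedAddCommGroup B] [NormedSpace 𝕜 B] [CompleteSpace B]
    {Ω : Set (A × B)} (hΩ : IsOpen Ω) (h0 : (0, 0) ∈ Ω) {W : A × B → A →L[𝕜] B}
    (hW : ContDiffOn 𝕜 ∞ W Ω)
    (hsymm : ∀ x ∈ Ω, ∀ u v, fderiv 𝕜 W x (u, W x u) v = fderiv 𝕜 W x (v, W x v) u) :
    ∃ Ω' : Set (A × B), IsOpen Ω' ∧ (0, 0) ∈ Ω' ∧ Ω' ⊆ Ω ∧ ∃ h : A × B → B,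
      ContDiffOn 𝕜 ∞ h Ω' ∧ (∀ x ∈ Ω', ∀ v, fderiv 𝕜 h x (v, W x v) = 0) ∧
        ∀ w, fderiv 𝕜 h (0, 0) (0, w) = w := by
  let _ : NormedSpace ℝ A := NormedSpace.restrictScalars ℝ 𝕜 A
  let _ : NormedSpace ℝ B := NormedSpace.restrictScalars ℝ 𝕜 B
  have : IsScalarTower ℝ 𝕜 A := ⟨fun r c a => by
    change (r • c) • a = (algebraMap ℝ 𝕜 r) • c • a
    rw [Algebra.smul_def, mul_smul]⟩
  have : IsScalarTower ℝ 𝕜 B := ⟨fun r c a => by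
    change (r • c) • a = (algebraMap ℝ 𝕜 r) • c • a
    rw [Algebra.smul_def, mul_smul]⟩
  exact exists_firstIntegrals_aux hΩ h0 hW hsymm

end Frobenius

/-! ### Casimir functions of a family of Poisson structures of constant rank. -/

section Casimirs

variable {𝕜 : Type*} [RCLike 𝕜] {E : Type*} [NormedAddCommGroup E] [NormedSpace 𝕜 E]

lemma eq_zero_of_forall_dual {x : E} (h : ∀ β : E →L[𝕜] 𝕜, β x = 0) : x = 0 :=
  SeparatingDual.eq_zero_of_forall_dual_eq_zero (R := 𝕜) h

lemma fderiv_clm_comp_apply {X F G H : Type*} [NormedAddCommGroup X] [NormedSpace 𝕜 X]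
    [NormedAddCommGroup F] [NormedSpace 𝕜 F] [NormedAddCommGroup G] [NormedSpace 𝕜 G]
    [NormedAddCommGroup H] [NormedSpace 𝕜 H] {Q : X → G →L[𝕜] H} {S : X → F →L[𝕜] G} {p : X}
    (hQ : DifferentiableAt 𝕜 Q p) (hS : DifferentiableAt 𝕜 S p) (z : X) (v : F) :
    fderiv 𝕜 (fun p => (Q p).comp (S p)) p z v =
      fderiv 𝕜 Q p z (S p v) + Q p (fderiv 𝕜 S p z v) := by
  rw [(hQ.hasFDerivAt.clm_comp hS.hasFDerivAt).fderiv]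
  simp [add_comm]

lemma fderiv_const_comp_apply {X F G H : Type*} [NormedAddCommGroup X] [NormedSpace 𝕜 X]
    [NormedAddCommGroup F] [NormedSpace 𝕜 F] [NormedAddCommGroup G] [NormedSpace 𝕜 G]
    [NormedAddCommGroup H] [NormedSpace 𝕜 H] (L : G →L[𝕜] H) {S : X → F →L[𝕜] G} {p : X}
    (hS : DifferentiableAt 𝕜 S p) (z : X) (v : F) :
    fderiv 𝕜 (fun p => L.comp (S p)) p z v = L (fderiv 𝕜 S p z v) := by
  rw [fderiv_clm_comp_apply (differentiableAt_const L) hS]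
  simp

lemma dual_fderiv_skew {Ω : Set (E × 𝕜)} (hΩ : IsOpen Ω) {Q : E × 𝕜 → (E →L[𝕜] 𝕜) →L[𝕜] E}
    (hQ : ContDiffOn 𝕜 ∞ Q Ω) (hskew : ∀ p ∈ Ω, ∀ α β : E →L[𝕜] 𝕜, α (Q p β) = -β (Q p α))
    {p : E × 𝕜} (hp : p ∈ Ω) (z : E × 𝕜) (α β : E →L[𝕜] 𝕜) :
    α (fderiv 𝕜 Q p z β) = -β (fderiv 𝕜 Q p z α) := by
  have hd : HasFDerivAt Q (fderiv 𝕜 Q p) p :=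
    ((hQ.differentiableOn (by simp)).differentiableAt (hΩ.mem_nhds hp)).hasFDerivAt
  have h : ∀ α β : E →L[𝕜] 𝕜, HasFDerivAt (fun p => α (Q p β))
      (α.comp ((ContinuousLinearMap.apply 𝕜 E β).comp (fderiv 𝕜 Q p))) p := fun α β =>
    HasFDerivAt.comp (g := α.comp (ContinuousLinearMap.apply 𝕜 E β)) p
      (ContinuousLinearMap.hasFDerivAt _) hd
  have h2 := (h β α).neg.congr_of_eventuallyEq (f₁ := fun p => α (Q p β)) (by
    filter_upwards [hΩ.mem_nhds hp] with q hq using hskew q hq α β)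
  exact congrArg (fun L : (E × 𝕜) →L[𝕜] 𝕜 => L z) ((h α β).unique h2)

/-- The Jacobi identity for a pair of Hamiltonian vector fields and a covector in the kernel. -/
lemma ker_fderiv_symm {Ω : Set (E × 𝕜)} (hΩ : IsOpen Ω) {Q : E × 𝕜 → (E →L[𝕜] 𝕜) →L[𝕜] E}
    (hQ : ContDiffOn 𝕜 ∞ Q Ω) (hskew : ∀ p ∈ Ω, ∀ α β : E →L[𝕜] 𝕜, α (Q p β) = -β (Q p α))
    (hjac : ∀ p ∈ Ω, ∀ α β γ : E →L[𝕜] 𝕜, γ (fderiv 𝕜 Q p (Q p α, 0) β) +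
      α (fderiv 𝕜 Q p (Q p β, 0) γ) + β (fderiv 𝕜 Q p (Q p γ, 0) α) = 0)
    {p : E × 𝕜} (hp : p ∈ Ω) {ξ : E →L[𝕜] 𝕜} (hξ : Q p ξ = 0) (α β : E →L[𝕜] 𝕜) :
    ξ (fderiv 𝕜 Q p (Q p α, 0) β) = ξ (fderiv 𝕜 Q p (Q p β, 0) α) := by
  have h1 := hjac p hp α β ξ
  have h2 : ((0 : E), (0 : 𝕜)) = 0 := rfl
  rw [hξ, h2, map_zero, dual_fderiv_skew hΩ hQ hskew hp _ α ξ] at h1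
  simp only [zero_apply, map_zero, add_zero] at h1
  exact add_neg_eq_zero.1 h1

variable [FiniteDimensional 𝕜 E]

/-- Coordinates adapted to a subspace. -/
lemma exists_adapted_coordinates (S : Submodule 𝕜 E) {d l : ℕ} (hd : Module.finrank 𝕜 S = d)
    (hl : d + l = Module.finrank 𝕜 E) :
    ∃ Θ : ((Fin d → 𝕜) × (Fin l → 𝕜)) ≃L[𝕜] E, ∀ x, x ∈ S ↔ ∃ a, Θ (a, 0) = x := by
  obtain ⟨T, hT⟩ := S.exists_isCompl
  have hTl : Module.finrank 𝕜 T = l := by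
    have := Submodule.finrank_add_eq_of_isCompl hT
    omega
  let e₁ : (Fin d → 𝕜) ≃ₗ[𝕜] S := LinearEquiv.ofFinrankEq _ _ (by simp [hd])
  let e₂ : (Fin l → 𝕜) ≃ₗ[𝕜] T := LinearEquiv.ofFinrankEq _ _ (by simp [hTl])
  refine ⟨((e₁.prodCongr e₂).trans (Submodule.prodEquivOfIsCompl S T hT)).toContinuousLinearEquiv,
    fun x => ⟨fun hx => ⟨e₁.symm ⟨x, hx⟩, ?_⟩, ?_⟩⟩
  · simp
  · rintro ⟨a, rfl⟩
    simp

set_option maxHeartbeats 1000000 in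
-- For a fixed parameter the images of `Q p` form an integrable distribution, by the Jacobi
-- identity, and its first integrals are Casimir functions, since by skew-symmetry `Q p` kills the
-- covectors annihilating its image. Near the base point the images are graphs over the image at
-- `(x₀, 0)`, which is the form required by `exists_firstIntegrals`. The parameter joins the
-- transversal variables, as a coordinate that is constant on leaves.
theorem exists_parametric_casimirs {Ω : Set (E × 𝕜)} (hΩ : IsOpen Ω) {x₀ : E} (hx₀ : (x₀, 0) ∈ Ω)
    {Q : E × 𝕜 → (E →L[𝕜] 𝕜) →L[𝕜] E} (hQ : ContDiffOn 𝕜 ∞ Q Ω)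
    (hskew : ∀ p ∈ Ω, ∀ α β : E →L[𝕜] 𝕜, α (Q p β) = -β (Q p α))
    (hjac : ∀ p ∈ Ω, ∀ α β γ : E →L[𝕜] 𝕜, γ (fderiv 𝕜 Q p (Q p α, 0) β) +
      α (fderiv 𝕜 Q p (Q p β, 0) γ) + β (fderiv 𝕜 Q p (Q p γ, 0) α) = 0)
    {l : ℕ} (hker : ∀ p ∈ Ω, Module.finrank 𝕜 (LinearMap.ker (Q p).toLinearMap) = l) :
    ∃ Ω' : Set (E × 𝕜), IsOpen Ω' ∧ (x₀, 0) ∈ Ω' ∧ Ω' ⊆ Ω ∧ ∃ C : Fin l → E × 𝕜 → 𝕜,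
      (∀ t, ContDiffOn 𝕜 ∞ (C t) Ω') ∧
      (∀ p ∈ Ω', ∀ t, Q p ((fderiv 𝕜 (C t) p).comp (ContinuousLinearMap.inl 𝕜 E 𝕜)) = 0) ∧
      LinearIndependent 𝕜 fun t =>
        (fderiv 𝕜 (C t) (x₀, 0)).comp (ContinuousLinearMap.inl 𝕜 E 𝕜) := by
  have hdual : Module.finrank 𝕜 (E →L[𝕜] 𝕜) = Module.finrank 𝕜 E := by
    rw [← (LinearMap.toContinuousLinearMap (𝕜 := 𝕜) (E := E) (F' := 𝕜)).finrank_eq]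
    exact Subspace.dual_finrank_eq
  set d := Module.finrank 𝕜 (LinearMap.range (Q (x₀, 0)).toLinearMap) with hd
  have hrk : ∀ p ∈ Ω, Module.finrank 𝕜 (LinearMap.range (Q p).toLinearMap) + l =
      Module.finrank 𝕜 E := fun p hp => by
    have := (Q p).toLinearMap.finrank_range_add_finrank_ker
    rw [hker p hp, hdual] at this
    exact this
  have hrange : ∀ p ∈ Ω, Module.finrank 𝕜 (LinearMap.range (Q p).toLinearMap) = d := fun p hp => by
    have h1 := hrk p hp
    have h2 := hrk _ hx₀
    omega
  obtain ⟨Θ, hΘ⟩ := exists_adapted_coordinates _ hd.symm (hrk _ hx₀)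
  let pA : E →L[𝕜] (Fin d → 𝕜) :=
    (ContinuousLinearMap.fst 𝕜 (Fin d → 𝕜) (Fin l → 𝕜)).comp (Θ.symm : E →L[𝕜] _)
  let pB : E →L[𝕜] (Fin l → 𝕜) :=
    (ContinuousLinearMap.snd 𝕜 (Fin d → 𝕜) (Fin l → 𝕜)).comp (Θ.symm : E →L[𝕜] _)
  have hpΘ : ∀ x, Θ (pA x, pB x) = x := fun x => Θ.apply_symm_apply x
  have hpA : ∀ a b, pA (Θ (a, b)) = a := fun a b => congrArg Prod.fst (Θ.symm_apply_apply (a, b))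
  have hpB : ∀ a b, pB (Θ (a, b)) = b := fun a b => congrArg Prod.snd (Θ.symm_apply_apply (a, b))
  -- a right inverse of `Q (x₀, 0)` on its range
  obtain ⟨σ₀, hσ₀⟩ : ∃ σ₀ : (Fin d → 𝕜) →L[𝕜] (E →L[𝕜] 𝕜), ∀ a, Q (x₀, 0) (σ₀ a) = Θ (a, 0) := by
    have h1 : ∀ i, ∃ β : E →L[𝕜] 𝕜, Q (x₀, 0) β = Θ (Pi.single i 1, 0) := fun i =>
      (hΘ _).2 ⟨_, rfl⟩
    choose β hβ using h1
    let L := (Pi.basisFun 𝕜 (Fin d)).constr 𝕜 β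
    refine ⟨LinearMap.toContinuousLinearMap L, fun a => ?_⟩
    have h2 : (Q (x₀, 0)).toLinearMap ∘ₗ L =
        Θ.toLinearEquiv.toLinearMap ∘ₗ LinearMap.inl 𝕜 (Fin d → 𝕜) (Fin l → 𝕜) :=
      (Pi.basisFun 𝕜 (Fin d)).ext fun i => by
        have h3 : L (Pi.basisFun 𝕜 (Fin d) i) = β i := Module.Basis.constr_basis _ _ _ _
        rw [LinearMap.comp_apply, h3]
        simpa using hβ i
    exact congrArg (fun L => L a) h2
  -- `Mat p` is the component of `Q p ∘ σ₀` along the image at `(x₀, 0)`. It is the identity there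
  -- and invertible nearby; dividing by it turns `R p` into a section of `pA` with values in the
  -- image of `Q p`.
  let Mat : E × 𝕜 → (Fin d → 𝕜) →L[𝕜] (Fin d → 𝕜) := fun p => pA.comp ((Q p).comp σ₀)
  have hMat : ContDiffOn 𝕜 ∞ Mat Ω := contDiffOn_const.clm_comp (hQ.clm_comp contDiffOn_const)
  set Ω₁ : Set (E × 𝕜) := Ω ∩ Mat ⁻¹' {M | IsUnit M} with hΩ₁
  have hΩ₁o : IsOpen Ω₁ := hMat.continuousOn.isOpen_inter_preimage hΩ Units.isOpen
  have hx₀₁ : (x₀, 0) ∈ Ω₁ := by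
    refine ⟨hx₀, ?_⟩
    have : Mat (x₀, 0) = 1 := by
      ext1 a
      change pA (Q (x₀, 0) (σ₀ a)) = a
      rw [hσ₀, hpA]
    rw [Set.mem_preimage, this]
    exact isUnit_one
  let S : E × 𝕜 → (Fin d → 𝕜) →L[𝕜] (E →L[𝕜] 𝕜) := fun p => σ₀.comp (Ring.inverse (Mat p))
  have hS : ContDiffOn 𝕜 ∞ S Ω₁ := by
    refine contDiffOn_const.clm_comp fun p hp => ?_
    obtain ⟨u, hu⟩ := hp.2
    have h1 : ContDiffAt 𝕜 ∞ Ring.inverse (Mat p) := by rw [← hu]; exact contDiffAt_ringInverse 𝕜 u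
    exact h1.comp_contDiffWithinAt p ((hMat p hp.1).mono Set.inter_subset_left)
  let R : E × 𝕜 → (Fin d → 𝕜) →L[𝕜] E := fun p => (Q p).comp (S p)
  have hR : ContDiffOn 𝕜 ∞ R Ω₁ := (hQ.mono Set.inter_subset_left).clm_comp hS
  have hpAR : ∀ p ∈ Ω₁, ∀ a, pA (R p a) = a := fun p hp a => by
    have h1 : Mat p * Ring.inverse (Mat p) = 1 := Ring.mul_inverse_cancel _ hp.2
    exact congrArg (fun L : (Fin d → 𝕜) →L[𝕜] (Fin d → 𝕜) => L a) h1
  let w : E × 𝕜 → (Fin d → 𝕜) →L[𝕜] (Fin l → 𝕜) := fun p => pB.comp (R p)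
  have hw : ContDiffOn 𝕜 ∞ w Ω₁ := contDiffOn_const.clm_comp hR
  have hRΘ : ∀ p ∈ Ω₁, ∀ a, R p a = Θ (a, w p a) := fun p hp a => by
    rw [← hpΘ (R p a), hpAR p hp]; rfl
  -- the range of `Q p` is the graph of `w p`
  have hgraph : ∀ p ∈ Ω₁, ∀ β, pB (Q p β) = w p (pA (Q p β)) := fun p hp β => by
    have h1 : LinearMap.range (R p).toLinearMap = LinearMap.range (Q p).toLinearMap := by
      -- Constancy of the rank: the image of `R p` lies in that of `Q p`, and both have dimension
      -- `d`.
      refine Submodule.eq_of_le_of_finrank_eq ?_ ?_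
      · rintro _ ⟨a, rfl⟩
        exact ⟨S p a, rfl⟩
      · rw [hrange p hp.1, LinearMap.finrank_range_of_inj, Module.finrank_fin_fun]
        exact Function.LeftInverse.injective (g := pA) (hpAR p hp)
    have h2 : Q p β ∈ LinearMap.range (R p).toLinearMap := by rw [h1]; exact ⟨β, rfl⟩
    obtain ⟨a, ha⟩ := h2
    change R p a = Q p β at ha
    rw [← ha, hpAR p hp]; rfl
  -- the coordinate change
  let τ : (Fin d → 𝕜) × ((Fin l → 𝕜) × 𝕜) → E × 𝕜 := fun q => (x₀ + Θ (q.1, q.2.1), q.2.2)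
  let τi : E × 𝕜 → (Fin d → 𝕜) × ((Fin l → 𝕜) × 𝕜) := fun p => (pA (p.1 - x₀), (pB (p.1 - x₀), p.2))
  have hττi : ∀ p, τ (τi p) = p := fun p => by
    refine Prod.ext ?_ rfl
    change x₀ + Θ (pA (p.1 - x₀), pB (p.1 - x₀)) = p.1
    rw [hpΘ]; abel
  let τ' : ((Fin d → 𝕜) × ((Fin l → 𝕜) × 𝕜)) →L[𝕜] E × 𝕜 :=
    ((Θ : _ →L[𝕜] E).comp ((ContinuousLinearMap.fst 𝕜 _ _).prod
      ((ContinuousLinearMap.fst 𝕜 _ _).comp (ContinuousLinearMap.snd 𝕜 _ _)))).prod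
      ((ContinuousLinearMap.snd 𝕜 _ _).comp (ContinuousLinearMap.snd 𝕜 _ _))
  have hτ' : ∀ q, HasFDerivAt τ τ' q := fun q => by
    have h1 : τ = fun q => (x₀, 0) + τ' q := by
      funext q
      refine Prod.ext rfl ?_
      change q.2.2 = 0 + q.2.2
      rw [zero_add]
    rw [h1]
    exact τ'.hasFDerivAt.const_add _
  let τi' : (E × 𝕜) →L[𝕜] ((Fin d → 𝕜) × ((Fin l → 𝕜) × 𝕜)) :=
    (pA.comp (ContinuousLinearMap.fst 𝕜 _ _)).prod
      ((pB.comp (ContinuousLinearMap.fst 𝕜 _ _)).prod (ContinuousLinearMap.snd 𝕜 _ _))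
  have hτi_eq : τi = fun p => τi' (p - (x₀, 0)) := by
    funext p
    refine Prod.ext rfl (Prod.ext rfl ?_)
    change p.2 = p.2 - 0
    rw [sub_zero]
  have hτi' : ∀ p, HasFDerivAt τi τi' p := fun p => by
    rw [hτi_eq]
    exact τi'.hasFDerivAt.comp p ((hasFDerivAt_id p).sub_const _)
  have hτc : ContDiff 𝕜 ∞ τ := by
    have h1 : ContDiff 𝕜 ∞ fun q : (Fin d → 𝕜) × ((Fin l → 𝕜) × 𝕜) => Θ (q.1, q.2.1) :=
      Θ.contDiff.comp (by fun_prop)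
    exact (contDiff_const.add h1).prodMk (by fun_prop)
  have hτic : ContDiff 𝕜 ∞ τi := by
    rw [hτi_eq]
    exact τi'.contDiff.comp (contDiff_id.sub contDiff_const)
  let W : (Fin d → 𝕜) × ((Fin l → 𝕜) × 𝕜) → (Fin d → 𝕜) →L[𝕜] ((Fin l → 𝕜) × 𝕜) :=
    fun q => (ContinuousLinearMap.inl 𝕜 (Fin l → 𝕜) 𝕜).comp (w (τ q))
  have hW : ContDiffOn 𝕜 ∞ W (τ ⁻¹' Ω₁) :=
    contDiffOn_const.clm_comp (hw.comp hτc.contDiffOn fun q hq => hq)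
  have hΩW : IsOpen (τ ⁻¹' Ω₁) := hΩ₁o.preimage hτc.continuous
  have h0 : ((0, 0) : (Fin d → 𝕜) × ((Fin l → 𝕜) × 𝕜)) ∈ τ ⁻¹' Ω₁ := by
    have : τ (0, 0) = (x₀, 0) := by
      refine Prod.ext ?_ rfl
      change x₀ + Θ (0, 0) = x₀
      rw [show ((0, 0) : (Fin d → 𝕜) × (Fin l → 𝕜)) = 0 from rfl, map_zero, add_zero]
    rw [Set.mem_preimage, this]
    exact hx₀₁
  have hDW : ∀ q ∈ τ ⁻¹' Ω₁, ∀ u v, fderiv 𝕜 W q (u, W q u) v =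
      (fderiv 𝕜 w (τ q) (R (τ q) u, 0) v, 0) := fun q hq u v => by
    have h1 : HasFDerivAt w (fderiv 𝕜 w (τ q)) (τ q) :=
      ((hw.differentiableOn (by simp)).differentiableAt (hΩ₁o.mem_nhds hq)).hasFDerivAt
    have h2 : HasFDerivAt (fun q => w (τ q)) _ q := h1.comp q (hτ' q)
    have h4 : τ' (u, W q u) = (R (τ q) u, 0) := by
      rw [hRΘ _ hq]; rfl
    have h5 := fderiv_const_comp_apply (ContinuousLinearMap.inl 𝕜 (Fin l → 𝕜) 𝕜)
      h2.differentiableAt (u, W q u) v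
    rw [h2.fderiv] at h5
    refine h5.trans ?_
    rw [← h4]
    rfl
  have hsymm : ∀ q ∈ τ ⁻¹' Ω₁, ∀ u v,
      fderiv 𝕜 W q (u, W q u) v = fderiv 𝕜 W q (v, W q v) u := fun q hq u v => by
    rw [hDW q hq, hDW q hq]
    refine Prod.ext ?_ rfl
    change fderiv 𝕜 w (τ q) (R (τ q) u, 0) v = fderiv 𝕜 w (τ q) (R (τ q) v, 0) u
    set p := τ q with hp
    funext i
    -- `ξ` is the `i`-th equation of the graph of `w p`. It annihilates the image of `Q p`, so it
    -- lies in the kernel of `Q p` by skew-symmetry.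
    let ξ : E →L[𝕜] 𝕜 := (ContinuousLinearMap.proj i).comp (pB - (w p).comp pA)
    have hξ : ∀ x, ξ x = pB x i - w p (pA x) i := fun x => rfl
    have hξQ : ∀ β, ξ (Q p β) = 0 := fun β => by rw [hξ, hgraph p hq, sub_self]
    have hQξ : Q p ξ = 0 := eq_zero_of_forall_dual (𝕜 := 𝕜) fun β => by
      rw [hskew p hq.1, hξQ, neg_zero]
    -- Differentiate `R = Q S`. Since `pA ∘ R` is the identity, `pA` kills the derivative of `R`,
    -- and `ξ` kills the term with the derivative of `S`. Only the derivative of `Q` remains, and to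
    -- it the Jacobi identity applies.
    have key : ∀ z v, fderiv 𝕜 w p z v i = ξ (fderiv 𝕜 Q p z (S p v)) := fun z v => by
      have hQd : DifferentiableAt 𝕜 Q p :=
        (hQ.differentiableOn (by simp)).differentiableAt (hΩ.mem_nhds hq.1)
      have hSd : DifferentiableAt 𝕜 S p :=
        (hS.differentiableOn (by simp)).differentiableAt (hΩ₁o.mem_nhds hq)
      have hRd0 : DifferentiableAt 𝕜 R p :=
        (hR.differentiableOn (by simp)).differentiableAt (hΩ₁o.mem_nhds hq)
      have hRd' : fderiv 𝕜 R p z v = fderiv 𝕜 Q p z (S p v) + Q p (fderiv 𝕜 S p z v) :=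
        fderiv_clm_comp_apply hQd hSd z v
      have hwd' : fderiv 𝕜 w p z v = pB (fderiv 𝕜 R p z v) := fderiv_const_comp_apply pB hRd0 z v
      have hAc : HasFDerivAt (fun p => pA.comp (R p))
          (0 : (E × 𝕜) →L[𝕜] (Fin d → 𝕜) →L[𝕜] (Fin d → 𝕜)) p :=
        (hasFDerivAt_const (ContinuousLinearMap.id 𝕜 (Fin d → 𝕜)) p).congr_of_eventuallyEq (by
          filter_upwards [hΩ₁o.mem_nhds hq] with p' hp'
          ext1 a
          exact hpAR p' hp' a)
      have hA0 : pA (fderiv 𝕜 R p z v) = 0 := by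
        rw [← fderiv_const_comp_apply pA hRd0 z v, hAc.fderiv]; rfl
      have h5 : ξ (fderiv 𝕜 R p z v) = fderiv 𝕜 w p z v i := by
        rw [hξ, hA0, hwd', map_zero, Pi.zero_apply, sub_zero]
      rw [← h5, hRd', map_add, hξQ, add_zero]
    rw [key, key]
    exact ker_fderiv_symm hΩ hQ hskew hjac hq.1 hQξ _ _
  obtain ⟨Ω₂, hΩ₂o, h0₂, hΩ₂, h, hh, hhW, hh0⟩ := exists_firstIntegrals hΩW h0 hW hsymm
  have hτi0 : τi (x₀, 0) = (0, 0) := by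
    refine Prod.ext ?_ (Prod.ext ?_ rfl)
    · change pA (x₀ - x₀) = 0
      simp
    · change pB (x₀ - x₀) = 0
      simp
  let C : Fin l → E × 𝕜 → 𝕜 := fun t p => (h (τi p)).1 t
  have hC : ∀ p ∈ τi ⁻¹' Ω₂, ∀ t e, fderiv 𝕜 (C t) p (e, 0) =
      (fderiv 𝕜 h (τi p) (pA e, (pB e, 0))).1 t := fun p hp t e => by
    have h1 : HasFDerivAt h (fderiv 𝕜 h (τi p)) (τi p) :=
      ((hh.differentiableOn (by simp)).differentiableAt (hΩ₂o.mem_nhds hp)).hasFDerivAt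
    let ev : ((Fin l → 𝕜) × 𝕜) →L[𝕜] 𝕜 :=
      (ContinuousLinearMap.proj (R := 𝕜) (φ := fun _ : Fin l => 𝕜) t).comp
        (ContinuousLinearMap.fst 𝕜 (Fin l → 𝕜) 𝕜)
    have h2 : HasFDerivAt (C t) _ p := ev.hasFDerivAt.comp p (h1.comp p (hτi' p))
    rw [h2.fderiv]
    rfl
  refine ⟨τi ⁻¹' Ω₂, hΩ₂o.preimage hτic.continuous, ?_, ?_, C, ?_, ?_, ?_⟩
  · rw [Set.mem_preimage, hτi0]; exact h0₂
  · intro p hp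
    have := (hΩ₂ hp : τi p ∈ τ ⁻¹' Ω₁)
    rw [Set.mem_preimage, hττi] at this
    exact this.1
  · intro t
    have h1 : ContDiffOn 𝕜 ∞ (fun p => h (τi p)) (τi ⁻¹' Ω₂) :=
      hh.comp hτic.contDiffOn fun p hp => hp
    exact (contDiff_apply 𝕜 𝕜 t).comp_contDiffOn (contDiff_fst.comp_contDiffOn h1)
  · intro p hp t
    have hp₁ := (hΩ₂ hp : τi p ∈ τ ⁻¹' Ω₁)
    rw [Set.mem_preimage, hττi] at hp₁
    refine eq_zero_of_forall_dual (𝕜 := 𝕜) fun β => ?_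
    rw [hskew p hp₁.1, neg_eq_zero]
    change fderiv 𝕜 (C t) p (Q p β, 0) = 0
    have h1 := hhW (τi p) hp (pA (Q p β))
    have h2 : W (τi p) (pA (Q p β)) = (pB (Q p β), 0) := by
      change (w (τ (τi p)) (pA (Q p β)), (0 : 𝕜)) = _
      rw [hττi, hgraph p hp₁]
    rw [hC p hp, ← h2, h1]
    rfl
  · rw [Fintype.linearIndependent_iff]
    intro c hc s
    have h1 := congrArg (fun L : E →L[𝕜] 𝕜 => L (Θ (0, Pi.single s 1))) hc
    have h2 : ∀ t, fderiv 𝕜 (C t) (x₀, 0) (Θ (0, Pi.single s 1), 0) =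
        (Pi.single s 1 : Fin l → 𝕜) t := fun t => by
      rw [hC _ (by rw [Set.mem_preimage, hτi0]; exact h0₂), hpA, hpB, hτi0, hh0]
    simpa [h2, Pi.single_apply] using h1

end Casimirs

/-! ### Taylor coefficients of the Casimir functions of the pencil. -/

section LenardSequences

variable {𝕜 : Type*} [RCLike 𝕜] {E : Type*} [NormedAddCommGroup E] [NormedSpace 𝕜 E]

/-- The Taylor coefficients of `T` in the parameter, as functions of all variables. -/
def parameterTaylor (T : E × 𝕜 → 𝕜) : ℕ → E × 𝕜 → 𝕜
  | 0 => T
  | i + 1 => fun p => ((i : 𝕜) + 1)⁻¹ * fderiv 𝕜 (parameterTaylor T i) p (0, 1)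

/-- The differential along the first factor. -/
def partialDiff (T : E × 𝕜 → 𝕜) (p : E × 𝕜) : E →L[𝕜] 𝕜 :=
  (fderiv 𝕜 T p).comp (ContinuousLinearMap.inl 𝕜 E 𝕜)

lemma contDiffOn_fderiv_apply {Ω : Set (E × 𝕜)} (hΩ : IsOpen Ω) {T : E × 𝕜 → 𝕜}
    (hT : ContDiffOn 𝕜 ∞ T Ω) : ContDiffOn 𝕜 ∞ (fun p => fderiv 𝕜 T p (0, 1)) Ω :=
  (hT.fderiv_of_isOpen hΩ (by simp)).clm_apply contDiffOn_const

lemma contDiffOn_parameterTaylor {Ω : Set (E × 𝕜)} (hΩ : IsOpen Ω) {T : E × 𝕜 → 𝕜}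
    (hT : ContDiffOn 𝕜 ∞ T Ω) (i : ℕ) : ContDiffOn 𝕜 ∞ (parameterTaylor T i) Ω := by
  induction i with
  | zero => exact hT
  | succ i ih => exact contDiffOn_const.mul (contDiffOn_fderiv_apply hΩ ih)

/-- Symmetry of the second derivative: differentiation in the parameter commutes with the
differential along `E`. -/
lemma hasFDerivAt_partialDiff {Ω : Set (E × 𝕜)} (hΩ : IsOpen Ω) {T : E × 𝕜 → 𝕜}
    (hT : ContDiffOn 𝕜 ∞ T Ω) {p : E × 𝕜} (hp : p ∈ Ω) :
    DifferentiableAt 𝕜 (partialDiff T) p ∧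
      fderiv 𝕜 (partialDiff T) p (0, 1) = partialDiff (fun p => fderiv 𝕜 T p (0, 1)) p := by
  have h1 : DifferentiableAt 𝕜 (fderiv 𝕜 T) p :=
    ((hT.fderiv_of_isOpen hΩ (m := ∞) (by simp)).differentiableOn (by simp)).differentiableAt
      (hΩ.mem_nhds hp)
  have h2 : HasFDerivAt (partialDiff T) _ p :=
    h1.hasFDerivAt.clm_comp (hasFDerivAt_const (ContinuousLinearMap.inl 𝕜 E 𝕜) p)
  have h3 : HasFDerivAt (fun p => fderiv 𝕜 T p (0, 1)) _ p :=
    h1.hasFDerivAt.clm_apply (hasFDerivAt_const ((0 : E), (1 : 𝕜)) p)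
  have hsymm : IsSymmSndFDerivAt 𝕜 T p :=
    (hT.contDiffAt (hΩ.mem_nhds hp)).isSymmSndFDerivAt (by
      rw [minSmoothness_of_isRCLikeNormedField]; exact WithTop.coe_le_coe.2 le_top)
  refine ⟨h2.differentiableAt, ?_⟩
  ext e
  rw [h2.fderiv, partialDiff, h3.fderiv]
  simpa using hsymm.eq (0, 1) (e, 0)

/-- The pencil `Q₁ + μ Q₂` as a function of the point and the parameter. -/
def pencil (Q₁ Q₂ : E → (E →L[𝕜] 𝕜) →L[𝕜] E) (p : E × 𝕜) : (E →L[𝕜] 𝕜) →L[𝕜] E :=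
  Q₁ p.1 + p.2 • Q₂ p.1

lemma contDiffOn_add_smul {F : Type*} [NormedAddCommGroup F] [NormedSpace 𝕜 F] {G : Set E}
    {f g : E → F} (hf : ContDiffOn 𝕜 ∞ f G) (hg : ContDiffOn 𝕜 ∞ g G) :
    ContDiffOn 𝕜 ∞ (fun p : E × 𝕜 => f p.1 + p.2 • g p.1) (G ×ˢ Set.univ) :=
  (hf.comp contDiffOn_fst fun _ hp => hp.1).add
    (contDiffOn_snd.smul (hg.comp contDiffOn_fst fun _ hp => hp.1))

lemma fderiv_add_smul {F : Type*} [NormedAddCommGroup F] [NormedSpace 𝕜 F] {f g : E → F}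
    {p : E × 𝕜} (hf : DifferentiableAt 𝕜 f p.1) (hg : DifferentiableAt 𝕜 g p.1) (e : E) :
    fderiv 𝕜 (fun p : E × 𝕜 => f p.1 + p.2 • g p.1) p (0, 1) = g p.1 ∧
      fderiv 𝕜 (fun p : E × 𝕜 => f p.1 + p.2 • g p.1) p (e, 0) =
        fderiv 𝕜 (fun x => f x + p.2 • g x) p.1 e := by
  have h1 : HasFDerivAt (fun p : E × 𝕜 => f p.1) _ p :=
    HasFDerivAt.comp (g := f) p hf.hasFDerivAt (hasFDerivAt_fst (F := 𝕜))
  have h2 : HasFDerivAt (fun p : E × 𝕜 => g p.1) _ p :=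
    HasFDerivAt.comp (g := g) p hg.hasFDerivAt (hasFDerivAt_fst (F := 𝕜))
  have h3 : HasFDerivAt (fun p : E × 𝕜 => f p.1 + p.2 • g p.1) _ p :=
    h1.add (hasFDerivAt_snd.smul h2)
  have h4 : HasFDerivAt (fun x => f x + p.2 • g x) _ p.1 :=
    hf.hasFDerivAt.add (hg.hasFDerivAt.const_smul p.2)
  rw [h3.fderiv, h4.fderiv]
  constructor <;> simp

lemma contDiffOn_pencil {G : Set E} {Q₁ Q₂ : E → (E →L[𝕜] 𝕜) →L[𝕜] E}
    (h₁ : ContDiffOn 𝕜 ∞ Q₁ G) (h₂ : ContDiffOn 𝕜 ∞ Q₂ G) :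
    ContDiffOn 𝕜 ∞ (pencil Q₁ Q₂) (G ×ˢ Set.univ) :=
  contDiffOn_add_smul h₁ h₂

set_option maxHeartbeats 1000000 in
lemma fderiv_pencil {Q₁ Q₂ : E → (E →L[𝕜] 𝕜) →L[𝕜] E} {p : E × 𝕜}
    (h₁ : DifferentiableAt 𝕜 Q₁ p.1) (h₂ : DifferentiableAt 𝕜 Q₂ p.1) (e : E) :
    fderiv 𝕜 (pencil Q₁ Q₂) p (0, 1) = Q₂ p.1 ∧
      fderiv 𝕜 (pencil Q₁ Q₂) p (e, 0) = fderiv 𝕜 (fun x => Q₁ x + p.2 • Q₂ x) p.1 e :=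
  fderiv_add_smul (F := (E →L[𝕜] 𝕜) →L[𝕜] E) (f := Q₁) (g := Q₂) (p := p) h₁ h₂ e

/-- Differentiation of the hypothesis in the parameter, where the pencil has derivative `Q₂`. With
two functions `T` and `T'` the lemma covers both the base case (`T' = 0`) and the induction step of
`pencil_parameterTaylor`. -/
lemma pencil_partialDiff_deriv {G : Set E} (hG : IsOpen G) {Q₁ Q₂ : E → (E →L[𝕜] 𝕜) →L[𝕜] E}
    (h₁ : ContDiffOn 𝕜 ∞ Q₁ G) (h₂ : ContDiffOn 𝕜 ∞ Q₂ G) {Ω : Set (E × 𝕜)} (hΩ : IsOpen Ω)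
    (hsub : Ω ⊆ G ×ˢ Set.univ) {T T' : E × 𝕜 → 𝕜} (hT : ContDiffOn 𝕜 ∞ T Ω)
    (hT' : ContDiffOn 𝕜 ∞ T' Ω)
    (h : ∀ p ∈ Ω, pencil Q₁ Q₂ p (partialDiff T p) + Q₂ p.1 (partialDiff T' p) = 0)
    {p : E × 𝕜} (hp : p ∈ Ω) :
    pencil Q₁ Q₂ p (partialDiff (fun p => fderiv 𝕜 T p (0, 1)) p) + Q₂ p.1 (partialDiff T p) +
      Q₂ p.1 (partialDiff (fun p => fderiv 𝕜 T' p (0, 1)) p) = 0 := by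
  have d₁ : DifferentiableAt 𝕜 Q₁ p.1 :=
    (h₁.differentiableOn (by simp)).differentiableAt (hG.mem_nhds (hsub hp).1)
  have d₂ : DifferentiableAt 𝕜 Q₂ p.1 :=
    (h₂.differentiableOn (by simp)).differentiableAt (hG.mem_nhds (hsub hp).1)
  obtain ⟨e1, e2⟩ := hasFDerivAt_partialDiff hΩ hT hp
  obtain ⟨e1', e2'⟩ := hasFDerivAt_partialDiff hΩ hT' hp
  have dp : DifferentiableAt 𝕜 (pencil Q₁ Q₂) p :=
    ((contDiffOn_pencil h₁ h₂).differentiableOn (by simp)).differentiableAt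
      ((hG.prod isOpen_univ).mem_nhds (hsub hp))
  have d3 : HasFDerivAt (fun p : E × 𝕜 => Q₂ p.1) _ p :=
    HasFDerivAt.comp (g := Q₂) p d₂.hasFDerivAt
      (hasFDerivAt_fst (𝕜 := 𝕜) (E := E) (F := 𝕜) (p := p))
  have k1 := (dp.hasFDerivAt.clm_apply e1.hasFDerivAt).add (d3.clm_apply e1'.hasFDerivAt)
  have k2 := k1.unique ((hasFDerivAt_const (0 : E) p).congr_of_eventuallyEq (by
    filter_upwards [hΩ.mem_nhds hp] with q hq using h q hq))
  have k3 := congrArg (fun L : (E × 𝕜) →L[𝕜] E => L (0, 1)) k2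
  simp only [add_apply, ContinuousLinearMap.comp_apply, ContinuousLinearMap.flip_apply,
    (fderiv_pencil d₁ d₂ 0).1, e2, e2', map_zero, zero_apply,
    ContinuousLinearMap.coe_fst', add_zero] at k3
  exact k3

lemma partialDiff_const_mul {Ω : Set (E × 𝕜)} (hΩ : IsOpen Ω) {T : E × 𝕜 → 𝕜}
    (hT : ContDiffOn 𝕜 ∞ T Ω) {p : E × 𝕜} (hp : p ∈ Ω) (c : 𝕜) :
    partialDiff (fun p => c * T p) p = c • partialDiff T p := by
  have h : DifferentiableAt 𝕜 T p :=
    (hT.differentiableOn (by simp)).differentiableAt (hΩ.mem_nhds hp)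
  rw [partialDiff, fderiv_const_mul h]
  rfl

lemma fderiv_parameterTaylor (T : E × 𝕜 → 𝕜) (i : ℕ) :
    (fun p => fderiv 𝕜 (parameterTaylor T i) p (0, 1)) =
      fun p => ((i : 𝕜) + 1) * parameterTaylor T (i + 1) p := by
  funext p
  have : (i : 𝕜) + 1 ≠ 0 := Nat.cast_add_one_ne_zero i
  rw [parameterTaylor]
  field_simp

/-- This is the Taylor coefficient of order `i + 1` of the Casimir equation of the pencil. It is
kept at all parameter values because the induction differentiates in the parameter; no convergence
of Taylor series is involved. -/
lemma pencil_parameterTaylor {G : Set E} (hG : IsOpen G) {Q₁ Q₂ : E → (E →L[𝕜] 𝕜) →L[𝕜] E}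
    (h₁ : ContDiffOn 𝕜 ∞ Q₁ G) (h₂ : ContDiffOn 𝕜 ∞ Q₂ G) {Ω : Set (E × 𝕜)} (hΩ : IsOpen Ω)
    (hsub : Ω ⊆ G ×ˢ Set.univ) {T : E × 𝕜 → 𝕜} (hT : ContDiffOn 𝕜 ∞ T Ω)
    (h : ∀ p ∈ Ω, pencil Q₁ Q₂ p (partialDiff T p) = 0) (i : ℕ) :
    ∀ p ∈ Ω, pencil Q₁ Q₂ p (partialDiff (parameterTaylor T (i + 1)) p) +
      Q₂ p.1 (partialDiff (parameterTaylor T i) p) = 0 := by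
  have hsm := contDiffOn_parameterTaylor hΩ hT
  induction i with
  | zero =>
    intro p hp
    have hz : ∀ p : E × 𝕜, partialDiff (fun _ : E × 𝕜 => (0 : 𝕜)) p = 0 := fun p => by
      rw [partialDiff, fderiv_const_apply]; rfl
    have key := pencil_partialDiff_deriv hG h₁ h₂ hΩ hsub hT (contDiffOn_const (c := (0 : 𝕜)))
      (fun p hp => by rw [h p hp, hz, map_zero, add_zero]) hp
    have h0 := fderiv_parameterTaylor T 0
    simp only [Nat.cast_zero, zero_add, one_mul] at h0
    have h3 : (fun p : E × 𝕜 => fderiv 𝕜 (fun _ : E × 𝕜 => (0 : 𝕜)) p (0, 1)) = fun _ => 0 := by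
      funext p; rw [fderiv_const_apply]; rfl
    rw [h3, hz, map_zero, add_zero] at key
    change pencil Q₁ Q₂ p (partialDiff (fun p => fderiv 𝕜 (parameterTaylor T 0) p (0, 1)) p) + _ = 0
      at key
    rw [h0] at key
    exact key
  | succ i ih =>
    intro p hp
    have key := pencil_partialDiff_deriv hG h₁ h₂ hΩ hsub (hsm (i + 1)) (hsm i) ih hp
    rw [fderiv_parameterTaylor, fderiv_parameterTaylor, partialDiff_const_mul hΩ (hsm _) hp,
      partialDiff_const_mul hΩ (hsm _) hp, map_smul, map_smul] at key
    have hne : ((i + 1 : ℕ) : 𝕜) + 1 ≠ 0 := Nat.cast_add_one_ne_zero (i + 1)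
    -- Both terms acquire the factor `i + 2`. In the second it is `1` from the derivative of the
    -- pencil plus `i + 1` from `parameterTaylor T i`.
    have h4 : (((i + 1 : ℕ) : 𝕜) + 1) • (pencil Q₁ Q₂ p
        (partialDiff (parameterTaylor T (i + 1 + 1)) p) +
          Q₂ p.1 (partialDiff (parameterTaylor T (i + 1)) p)) = 0 := by
      rw [← key]
      push_cast
      module
    exact (smul_eq_zero.1 h4).resolve_left hne

variable [FiniteDimensional 𝕜 E]

/-- The sequences are the Taylor coefficients at `μ = 0` of Casimir functions of `Q₁ x + μ • Q₂ x`.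
Constancy of the corank in both `x` and `μ` is what allows these functions to depend smoothly on
`μ`. -/
theorem exists_lenard_sequences {G : Set E} (hG : IsOpen G) {x₀ : E} (hx₀ : x₀ ∈ G)
    {Q₁ Q₂ : E → (E →L[𝕜] 𝕜) →L[𝕜] E} (h₁ : ContDiffOn 𝕜 ∞ Q₁ G) (h₂ : ContDiffOn 𝕜 ∞ Q₂ G)
    (hskew : ∀ x ∈ G, ∀ μ : 𝕜, ∀ α β : E →L[𝕜] 𝕜,
      α ((Q₁ x + μ • Q₂ x) β) = -β ((Q₁ x + μ • Q₂ x) α))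
    (hjac : ∀ x ∈ G, ∀ μ : 𝕜, ∀ α β γ : E →L[𝕜] 𝕜,
      γ (fderiv 𝕜 (fun x => Q₁ x + μ • Q₂ x) x ((Q₁ x + μ • Q₂ x) α) β) +
      α (fderiv 𝕜 (fun x => Q₁ x + μ • Q₂ x) x ((Q₁ x + μ • Q₂ x) β) γ) +
      β (fderiv 𝕜 (fun x => Q₁ x + μ • Q₂ x) x ((Q₁ x + μ • Q₂ x) γ) α) = 0)
    {l : ℕ} (hker : ∀ x ∈ G, ∀ μ : 𝕜,
      Module.finrank 𝕜 (LinearMap.ker (Q₁ x + μ • Q₂ x).toLinearMap) = l) :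
    ∃ G' : Set E, IsOpen G' ∧ x₀ ∈ G' ∧ G' ⊆ G ∧ ∃ H : Fin l → ℕ → E → 𝕜,
      (∀ t i, ContDiffOn 𝕜 ∞ (H t i) G') ∧
      (∀ x ∈ G', ∀ t, Q₁ x (fderiv 𝕜 (H t 0) x) = 0) ∧
      (∀ x ∈ G', ∀ t i, Q₂ x (fderiv 𝕜 (H t i) x) = -Q₁ x (fderiv 𝕜 (H t (i + 1)) x)) ∧
      LinearIndependent 𝕜 fun t => fderiv 𝕜 (H t 0) x₀ := by
  have hdiff : ∀ p ∈ G ×ˢ (Set.univ : Set 𝕜),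
      DifferentiableAt 𝕜 Q₁ p.1 ∧ DifferentiableAt 𝕜 Q₂ p.1 := fun p hp =>
    ⟨(h₁.differentiableOn (by simp)).differentiableAt (hG.mem_nhds hp.1),
      (h₂.differentiableOn (by simp)).differentiableAt (hG.mem_nhds hp.1)⟩
  obtain ⟨Ω, hΩ, h0, hsub, C, hC, hker', hind⟩ := exists_parametric_casimirs
    (hG.prod isOpen_univ) (x₀ := x₀) ⟨hx₀, trivial⟩ (contDiffOn_pencil h₁ h₂)
    (fun p hp α β => hskew p.1 hp.1 p.2 α β)
    (fun p hp α β γ => by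
      have hd := fun e => (fderiv_pencil (hdiff p hp).1 (hdiff p hp).2 e).2
      rw [hd, hd, hd]
      exact hjac p.1 hp.1 p.2 α β γ) (l := l)
    (fun p hp => hker p.1 hp.1 p.2)
  let ι : E → E × 𝕜 := fun x => (x, 0)
  have hι : ∀ x, HasFDerivAt ι (ContinuousLinearMap.inl 𝕜 E 𝕜) x := fun x =>
    (ContinuousLinearMap.inl 𝕜 E 𝕜).hasFDerivAt
  have hιc : ContDiff 𝕜 ∞ ι := (ContinuousLinearMap.inl 𝕜 E 𝕜).contDiff
  have hsm : ∀ t i, ContDiffOn 𝕜 ∞ (parameterTaylor (C t) i) Ω := fun t =>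
    contDiffOn_parameterTaylor hΩ (hC t)
  have hfd : ∀ x ∈ ι ⁻¹' Ω, ∀ t i, fderiv 𝕜 (fun x => parameterTaylor (C t) i (ι x)) x =
      partialDiff (parameterTaylor (C t) i) (ι x) := fun x hx t i => by
    have hd : DifferentiableAt 𝕜 (parameterTaylor (C t) i) (ι x) :=
      ((hsm t i).differentiableOn (by simp)).differentiableAt (hΩ.mem_nhds hx)
    exact (hd.hasFDerivAt.comp x (hι x)).fderiv
  have hpen : ∀ x, pencil Q₁ Q₂ (ι x) = Q₁ x := fun x => by simp [pencil, ι]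
  refine ⟨ι ⁻¹' Ω, hΩ.preimage hιc.continuous, h0, fun x hx => (hsub hx).1,
    fun t i x => parameterTaylor (C t) i (ι x), ?_, ?_, ?_, ?_⟩
  · exact fun t i => (hsm t i).comp hιc.contDiffOn fun x hx => hx
  · intro x hx t
    rw [hfd x hx, ← hpen]
    exact hker' _ hx t
  · intro x hx t i
    rw [hfd x hx, hfd x hx, ← hpen]
    have := pencil_parameterTaylor hG h₁ h₂ hΩ hsub (hC t) (fun p hp => hker' p hp t) i (ι x) hx
    exact eq_neg_of_add_eq_zero_right this
  · convert hind using 2 with t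
    exact hfd x₀ h0 t 0

end LenardSequences

/-! ### Transfer between the manifold and a chart. -/

section Charts

variable {𝕜 : Type*} [RCLike 𝕜] {E : Type*} [NormedAddCommGroup E] [NormedSpace 𝕜 E]
  {M : Type*} [TopologicalSpace M] [ChartedSpace E M]

/-- The linear isomorphism of the cotangent space at `m` with the dual of the model space that is
given by the chart at `m₀`. -/
def chartCotangent [IsManifold 𝓘(𝕜, E) ∞ M] (m₀ : M) {m : M} (hm : m ∈ (chartAt E m₀).source) :
    (E →L[𝕜] 𝕜) ≃ₗ[𝕜] Cotangent 𝕜 E m :=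
  haveI : IsManifold 𝓘(𝕜, E) 1 M := IsManifold.of_le (n := ∞) (by simp)
  let D : TangentSpace 𝓘(𝕜, E) m ≃L[𝕜] E :=
    (mdifferentiable_chart (I := 𝓘(𝕜, E)) m₀).mfderiv hm
  { toFun := fun β => β.comp (D : TangentSpace 𝓘(𝕜, E) m →L[𝕜] E)
    invFun := fun α => α.comp (D.symm : E →L[𝕜] TangentSpace 𝓘(𝕜, E) m)
    map_add' := fun _ _ => rfl
    map_smul' := fun _ _ => rfl
    left_inv := fun β => by ext v; exact congrArg β (D.apply_symm_apply v)
    right_inv := fun α => by ext v; exact congrArg α (D.symm_apply_apply v) }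

variable [IsManifold 𝓘(𝕜, E) ∞ M]

lemma chartCotangent_apply (m₀ : M) {m : M} (hm : m ∈ (chartAt E m₀).source) (β : E →L[𝕜] 𝕜) :
    chartCotangent m₀ hm β =
      β.comp (mfderiv 𝓘(𝕜, E) 𝓘(𝕜, E) (chartAt E m₀) m : TangentSpace 𝓘(𝕜, E) m →L[𝕜] E) := rfl

/-- The chain rule in a chart. -/
lemma diffAt_eq_chartCotangent (m₀ : M) {m : M} (hm : m ∈ (chartAt E m₀).source) {f : M → 𝕜}
    {g : E → 𝕜} (hfg : f =ᶠ[𝓝 m] g ∘ chartAt E m₀) (hg : DifferentiableAt 𝕜 g (chartAt E m₀ m)) :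
    diffAt E f m = chartCotangent m₀ hm (fderiv 𝕜 g (chartAt E m₀ m)) := by
  have : IsManifold 𝓘(𝕜, E) 1 M := IsManifold.of_le (n := ∞) (by simp)
  have h1 : MDifferentiableAt 𝓘(𝕜, E) 𝓘(𝕜, E) (chartAt E m₀) m :=
    mdifferentiableAt_atlas (chart_mem_atlas E m₀) hm
  have h2 : MDifferentiableAt 𝓘(𝕜, E) 𝓘(𝕜, 𝕜) g (chartAt E m₀ m) := hg.mdifferentiableAt
  rw [diffAt, chartCotangent_apply]
  have h3 := (h2.hasMFDerivAt.comp m h1.hasMFDerivAt).congr_of_eventuallyEq hfg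
  have h4 := h3.mfderiv
  rw [mfderiv_eq_fderiv] at h4
  exact h4

lemma smoothOn_comp_chart (m₀ : M) {g : E → 𝕜} {G : Set E} (hg : ContDiffOn 𝕜 ∞ g G) :
    SmoothOn E (g ∘ chartAt E m₀) ((chartAt E m₀).source ∩ chartAt E m₀ ⁻¹' G) := by
  have h1 : ContMDiffOn 𝓘(𝕜, E) 𝓘(𝕜, E) ∞ (chartAt E m₀) (chartAt E m₀).source :=
    contMDiffOn_of_mem_maximalAtlas (IsManifold.chart_mem_maximalAtlas m₀)
  exact hg.contMDiffOn.comp (h1.mono Set.inter_subset_left) fun m hm => hm.2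

lemma contDiffOn_comp_chart_symm (m₀ : M) {f : M → 𝕜} {U : Set M} (hf : SmoothOn E f U) :
    ContDiffOn 𝕜 ∞ (f ∘ (chartAt E m₀).symm)
      ((chartAt E m₀).target ∩ (chartAt E m₀).symm ⁻¹' U) := by
  have h1 : ContMDiffOn 𝓘(𝕜, E) 𝓘(𝕜, E) ∞ (chartAt E m₀).symm (chartAt E m₀).target :=
    contMDiffOn_symm_of_mem_maximalAtlas (IsManifold.chart_mem_maximalAtlas m₀)
  exact (ContMDiffOn.comp (g := f) hf (h1.mono Set.inter_subset_left) fun m hm => hm.2).contDiffOn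

lemma smoothOn_dual_chart (m₀ : M) (β : E →L[𝕜] 𝕜) :
    SmoothOn E (β ∘ chartAt E m₀) (chartAt E m₀).source := by
  simpa using smoothOn_comp_chart m₀ (β.contDiff.contDiffOn (s := Set.univ))

lemma diffAt_dual_chart (m₀ : M) {m : M} (hm : m ∈ (chartAt E m₀).source) (β : E →L[𝕜] 𝕜) :
    diffAt E (β ∘ chartAt E m₀) m = chartCotangent m₀ hm β := by
  rw [diffAt_eq_chartCotangent m₀ hm (g := β) Filter.EventuallyEq.rfl β.differentiableAt,
    β.fderiv]

/-- Every covector is the differential of a function that is smooth near the point. -/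
lemma exists_smoothOn_diffAt (m : M) (α : Cotangent 𝕜 E m) :
    ∃ f : M → 𝕜, SmoothOn E f (chartAt E m).source ∧ diffAt E f m = α :=
  ⟨(chartCotangent m (mem_chart_source E m)).symm α ∘ chartAt E m, smoothOn_dual_chart m _, by
    rw [diffAt_dual_chart m (mem_chart_source E m), LinearEquiv.apply_symm_apply]⟩

variable [FiniteDimensional 𝕜 E]

/-- The Hamiltonian operator in the chart at `m₀`: the vector `chartOperator P m₀ x β` is the value
at `x` of the Hamiltonian vector field of the linear function `β`. -/
def chartOperator (P : TensorField 𝕜 E M) (m₀ : M) (x : E) : (E →L[𝕜] 𝕜) →L[𝕜] E :=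
  ∑ i, ∑ j, bracket P
      (LinearMap.toContinuousLinearMap ((Module.finBasis 𝕜 E).coord i) ∘ chartAt E m₀)
      (LinearMap.toContinuousLinearMap ((Module.finBasis 𝕜 E).coord j) ∘ chartAt E m₀)
        ((chartAt E m₀).symm x) •
    (ContinuousLinearMap.apply 𝕜 𝕜 (Module.finBasis 𝕜 E i)).smulRight (Module.finBasis 𝕜 E j)

lemma dual_eq_sum (β : E →L[𝕜] 𝕜) : β = ∑ i, β (Module.finBasis 𝕜 E i) •
    LinearMap.toContinuousLinearMap ((Module.finBasis 𝕜 E).coord i) := by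
  ext v
  have h := congrArg β ((Module.finBasis 𝕜 E).sum_repr v)
  rw [map_sum] at h
  rw [← h]
  simp [mul_comm]

lemma bracket_dual_chart (P : TensorField 𝕜 E M) (m₀ : M) {m : M}
    (hm : m ∈ (chartAt E m₀).source) (β γ : E →L[𝕜] 𝕜) :
    bracket P (β ∘ chartAt E m₀) (γ ∘ chartAt E m₀) m =
      P m (chartCotangent m₀ hm β) (chartCotangent m₀ hm γ) := by
  rw [bracket, diffAt_dual_chart m₀ hm, diffAt_dual_chart m₀ hm]

lemma chartOperator_apply (P : TensorField 𝕜 E M) (m₀ : M) {m : M}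
    (hm : m ∈ (chartAt E m₀).source) (β γ : E →L[𝕜] 𝕜) :
    γ (chartOperator P m₀ (chartAt E m₀ m) β) =
      P m (chartCotangent m₀ hm β) (chartCotangent m₀ hm γ) := by
  conv_rhs => rw [dual_eq_sum β, dual_eq_sum γ]
  simp only [chartOperator, (chartAt E m₀).left_inv hm, bracket_dual_chart P m₀ hm, map_sum,
    map_smul, sum_apply, smul_apply, LinearMap.sum_apply, LinearMap.smul_apply, smul_eq_mul,
    ContinuousLinearMap.smulRight_apply, ContinuousLinearMap.apply_apply]
  rw [Finset.sum_comm]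
  refine Finset.sum_congr rfl fun i _ => ?_
  rw [Finset.mul_sum]
  refine Finset.sum_congr rfl fun j _ => by ring

lemma contDiffOn_smul_vector {F : Type*} [NormedAddCommGroup F] [NormedSpace 𝕜 F] {c : E → 𝕜}
    {G : Set E} (hc : ContDiffOn 𝕜 ∞ c G) (v : F) : ContDiffOn 𝕜 ∞ (fun x => c x • v) G :=
  hc.smul contDiffOn_const

lemma contDiffOn_chartOperator {P : TensorField 𝕜 E M} (hP : IsBracket P) (m₀ : M) :
    ContDiffOn 𝕜 ∞ (chartOperator P m₀) (chartAt E m₀).target := by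
  refine ContDiffOn.sum fun i _ => ContDiffOn.sum fun j _ => ?_
  have h1 := contDiffOn_comp_chart_symm m₀ (hP.smooth _ (chartAt E m₀).open_source _ _
    (smoothOn_dual_chart m₀ (LinearMap.toContinuousLinearMap ((Module.finBasis 𝕜 E).coord i)))
    (smoothOn_dual_chart m₀ (LinearMap.toContinuousLinearMap ((Module.finBasis 𝕜 E).coord j))))
  have h2 := ContDiffOn.mono (t := (chartAt E m₀).target) h1
    fun x hx => ⟨hx, (chartAt E m₀).map_target hx⟩
  exact contDiffOn_smul_vector (F := (E →L[𝕜] 𝕜) →L[𝕜] E) h2 _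

lemma chartOperator_add_smul (P₁ P₂ : TensorField 𝕜 E M) (m₀ : M) (a b : 𝕜) :
    ∀ x, chartOperator (a • P₁ + b • P₂) m₀ x =
      a • chartOperator P₁ m₀ x + b • chartOperator P₂ m₀ x := fun x => by
  simp only [chartOperator, Finset.smul_sum, ← Finset.sum_add_distrib]
  refine Finset.sum_congr rfl fun i _ => Finset.sum_congr rfl fun j _ => ?_
  rw [smul_smul, smul_smul, ← add_smul]
  rfl

lemma chartOperator_skew {P : TensorField 𝕜 E M} (hP : IsBracket P) (m₀ : M) {x : E}
    (hx : x ∈ (chartAt E m₀).target) (α β : E →L[𝕜] 𝕜) :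
    α (chartOperator P m₀ x β) = -β (chartOperator P m₀ x α) := by
  have hm := (chartAt E m₀).map_target hx
  rw [← (chartAt E m₀).right_inv hx, chartOperator_apply P m₀ hm, chartOperator_apply P m₀ hm,
    hP.skew]

/-- The Jacobi identity is applied to linear functions of the chart. Their differentials are
constant in the chart, so only the derivative of the operator survives. -/
lemma chartOperator_jacobi {P : TensorField 𝕜 E M} (hP : IsPoisson P) (m₀ : M) {x : E}
    (hx : x ∈ (chartAt E m₀).target) (α β γ : E →L[𝕜] 𝕜) :
    γ (fderiv 𝕜 (chartOperator P m₀) x (chartOperator P m₀ x α) β) +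
      α (fderiv 𝕜 (chartOperator P m₀) x (chartOperator P m₀ x β) γ) +
      β (fderiv 𝕜 (chartOperator P m₀) x (chartOperator P m₀ x γ) α) = 0 := by
  have hm := (chartAt E m₀).map_target hx
  set m := (chartAt E m₀).symm x with hmx
  have hxm : chartAt E m₀ m = x := (chartAt E m₀).right_inv hx
  have hd : DifferentiableAt 𝕜 (chartOperator P m₀) x :=
    ((contDiffOn_chartOperator hP.toIsBracket m₀).differentiableOn (by simp)).differentiableAt
      ((chartAt E m₀).open_target.mem_nhds hx)
  have key : ∀ α β γ : E →L[𝕜] 𝕜, bracket P (α ∘ chartAt E m₀)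
      (bracket P (β ∘ chartAt E m₀) (γ ∘ chartAt E m₀)) m =
        γ (fderiv 𝕜 (chartOperator P m₀) x (chartOperator P m₀ x α) β) := fun α β γ => by
    have h1 : HasFDerivAt (fun y => γ (chartOperator P m₀ y β))
        ((γ.comp (ContinuousLinearMap.apply 𝕜 E β)).comp (fderiv 𝕜 (chartOperator P m₀) x)) x :=
      HasFDerivAt.comp (g := γ.comp (ContinuousLinearMap.apply 𝕜 E β)) x
        (ContinuousLinearMap.hasFDerivAt _) hd.hasFDerivAt
    have h2 : bracket P (β ∘ chartAt E m₀) (γ ∘ chartAt E m₀) =ᶠ[𝓝 m]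
        (fun y => γ (chartOperator P m₀ y β)) ∘ chartAt E m₀ := by
      filter_upwards [(chartAt E m₀).open_source.mem_nhds hm] with y hy
      rw [Function.comp_apply, chartOperator_apply P m₀ hy, bracket_dual_chart P m₀ hy]
    have h3 := diffAt_eq_chartCotangent m₀ hm h2 (by rw [hxm]; exact h1.differentiableAt)
    rw [bracket, h3, diffAt_dual_chart m₀ hm, ← chartOperator_apply P m₀ hm, hxm, h1.fderiv]
    rfl
  have := hP.jacobi _ (chartAt E m₀).open_source _ _ _ (smoothOn_dual_chart m₀ α)
    (smoothOn_dual_chart m₀ β) (smoothOn_dual_chart m₀ γ) m hm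
  rwa [key, key, key] at this

lemma chartOperator_eq_zero_iff (P : TensorField 𝕜 E M) (m₀ : M) {m : M}
    (hm : m ∈ (chartAt E m₀).source) (β : E →L[𝕜] 𝕜) :
    chartOperator P m₀ (chartAt E m₀ m) β = 0 ↔ P m (chartCotangent m₀ hm β) = 0 := by
  constructor
  · intro h0
    ext α
    obtain ⟨γ, rfl⟩ := (chartCotangent m₀ hm).surjective α
    rw [← chartOperator_apply P m₀ hm β γ, h0, map_zero]; rfl
  · intro h0
    refine eq_zero_of_forall_dual (𝕜 := 𝕜) fun γ => ?_
    rw [chartOperator_apply P m₀ hm β γ, h0]; rfl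

lemma finrank_ker_chartOperator (P : TensorField 𝕜 E M) (m₀ : M) {m : M}
    (hm : m ∈ (chartAt E m₀).source) :
    Module.finrank 𝕜 (LinearMap.ker (chartOperator P m₀ (chartAt E m₀ m)).toLinearMap) =
      Module.finrank 𝕜 (LinearMap.ker (P m)) := by
  have h : LinearMap.ker (chartOperator P m₀ (chartAt E m₀ m)).toLinearMap =
      (LinearMap.ker (P m)).comap (chartCotangent m₀ hm).toLinearMap := by
    ext β
    rw [Submodule.mem_comap, LinearMap.mem_ker, LinearMap.mem_ker]
    exact chartOperator_eq_zero_iff P m₀ hm β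
  rw [h]
  exact LinearEquiv.finrank_eq ((chartCotangent m₀ hm).ofSubmodule' _)

end Charts

/-! ### Minimal polynomial solutions of a singular pencil. -/

section KroneckerSummand

variable {𝕜 V : Type*} [Field 𝕜] [CharZero 𝕜] [AddCommGroup V] [Module 𝕜 V]

/-- `v 0 + X (v 1) + … + Xⁿ (v n)` is annihilated by `B₂ + X B₁`, and `v 0 ≠ 0`. -/
structure IsPolynomialSolution (B₁ B₂ : LinearMap.BilinForm 𝕜 V) (n : ℕ) (v : ℕ → V) : Prop where
  ne_zero : v 0 ≠ 0
  zero : B₂ (v 0) = 0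
  succ : ∀ s, B₂ (v (s + 1)) = -B₁ (v s)
  eq_zero : ∀ s, n < s → v s = 0

/-- The pencil `B₁ + μ B₂` degenerates for infinitely many `μ` only if there is a polynomial
solution. -/
theorem exists_isPolynomialSolution [FiniteDimensional 𝕜 V] (B₁ B₂ : LinearMap.BilinForm 𝕜 V)
    (hinf : {μ : 𝕜 | LinearMap.ker (B₁ + μ • B₂) ≠ ⊥}.Infinite) :
    ∃ n v, IsPolynomialSolution B₁ B₂ n v := by
  classical
  let b := Module.finBasis 𝕜 V
  let G : LinearMap.BilinForm 𝕜 V → Matrix (Fin (Module.finrank 𝕜 V)) (Fin (Module.finrank 𝕜 V)) 𝕜 :=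
    fun B => Matrix.of fun i j => B (b j) (b i)
  have hG : ∀ (B : LinearMap.BilinForm 𝕜 V) (c : Fin (Module.finrank 𝕜 V) → 𝕜),
      (G B).mulVec c = 0 ↔ B (∑ j, c j • b j) = 0 := fun B c => by
    have h1 : ∀ i, (G B).mulVec c i = B (∑ j, c j • b j) (b i) := fun i => by
      simp [Matrix.mulVec, dotProduct, G, mul_comm]
    constructor
    · intro h
      exact b.ext fun i => by rw [← h1, h]; rfl
    · intro h
      funext i
      rw [h1, h]; rfl
  let Mx : Matrix (Fin (Module.finrank 𝕜 V)) (Fin (Module.finrank 𝕜 V)) (Polynomial 𝕜) :=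
    Matrix.of fun i j => Polynomial.C (G B₂ i j) + Polynomial.X * Polynomial.C (G B₁ i j)
  have hdet : Mx.det = 0 := by
    refine Polynomial.eq_zero_of_infinite_isRoot _ ?_
    -- At `X = μ⁻¹` the matrix of `B₂ + X B₁` is that of `μ⁻¹ • (B₁ + μ • B₂)`. The value `μ = 0`
    -- corresponds to infinity and is dropped.
    have hinf' : ((fun μ : 𝕜 => μ⁻¹) ''
        ({μ : 𝕜 | LinearMap.ker (B₁ + μ • B₂) ≠ ⊥} \ {0})).Infinite :=
      (hinf.sdiff (Set.finite_singleton 0)).image inv_injective.injOn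
    refine hinf'.mono ?_
    rintro _ ⟨μ, ⟨hμ, hμ0⟩, rfl⟩
    obtain ⟨x, hx, hx0⟩ := Submodule.exists_mem_ne_zero_of_ne_bot hμ
    rw [LinearMap.mem_ker] at hx
    rw [Set.mem_ofPred_eq, Polynomial.IsRoot.def, ← Polynomial.coe_evalRingHom, RingHom.map_det,
      ← Matrix.exists_mulVec_eq_zero_iff]
    refine ⟨b.repr x, fun h => hx0 (b.repr.map_eq_zero_iff.1 (DFunLike.coe_injective h)), ?_⟩
    have h2 : (Polynomial.evalRingHom μ⁻¹).mapMatrix Mx = G (μ⁻¹ • (B₁ + μ • B₂)) := by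
      ext i j
      have : μ⁻¹ * μ = 1 := inv_mul_cancel₀ hμ0
      simp [Mx, G, ← mul_assoc, this, add_comm]
      ring
    rw [h2, hG, b.sum_repr, LinearMap.smul_apply, hx, smul_zero]
  obtain ⟨p, hp0, hp⟩ := Matrix.exists_mulVec_eq_zero_iff.2 hdet
  let v : ℕ → V := fun s => ∑ j, (p j).coeff s • b j
  have hcoeff : ∀ i s, (Mx.mulVec p i).coeff s = 0 := fun i s => by rw [hp]; simp
  have hv0 : B₂ (v 0) = 0 := (hG B₂ fun j => (p j).coeff 0).1 (by
    funext i
    rw [Pi.zero_apply, ← hcoeff i 0]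
    simp [Matrix.mulVec, dotProduct, Mx, Polynomial.finsetSum_coeff, add_mul, mul_assoc])
  have hvs : ∀ s, B₂ (v (s + 1)) = -B₁ (v s) := fun s => by
    rw [eq_neg_iff_add_eq_zero]
    refine b.ext fun i => ?_
    rw [LinearMap.zero_apply, ← hcoeff i (s + 1)]
    have hc : ∀ (a c : 𝕜) (q : Polynomial 𝕜), ((Polynomial.C a + Polynomial.X * Polynomial.C c) *
        q).coeff (s + 1) = q.coeff (s + 1) * a + q.coeff s * c := fun a c q => by
      rw [add_mul, mul_assoc, Polynomial.coeff_add, Polynomial.coeff_C_mul, Polynomial.coeff_X_mul,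
        Polynomial.coeff_C_mul]
      ring
    simp only [Matrix.mulVec, dotProduct, Mx, Matrix.of_apply, Polynomial.finsetSum_coeff, hc, v, G,
      Finset.sum_add_distrib, map_sum, map_smul, LinearMap.add_apply, LinearMap.sum_apply,
      LinearMap.smul_apply, smul_eq_mul]
  have hex : ∃ s, v s ≠ 0 := by
    by_contra! h
    refine hp0 (funext fun j => Polynomial.ext fun s => ?_)
    have h1 := congrFun (b.repr_sum_self fun j => (p j).coeff s) j
    rw [← h1, show ∑ j, (p j).coeff s • b j = 0 from h s]
    simp
  -- Division by `X ^ s₀` makes the constant coefficient nonzero.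
  let s₀ := Nat.find hex
  refine ⟨Finset.univ.sup fun j => (p j).natDegree, fun s => v (s + s₀),
    ⟨by simpa using Nat.find_spec hex, ?_, fun s => ?_, fun s hs => ?_⟩⟩
  · rw [zero_add]
    rcases h : s₀ with _ | r
    · exact hv0
    · have : v r = 0 := by
        have := Nat.find_min hex (m := r) (by change r < s₀; omega)
        simpa using this
      rw [hvs, this, map_zero, neg_zero]
  · rw [add_right_comm]; exact hvs _
  · refine Finset.sum_eq_zero fun j _ => ?_
    rw [Polynomial.coeff_eq_zero_of_natDegree_lt, zero_smul]
    have : (p j).natDegree ≤ _ :=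
      Finset.le_sup (f := fun j => (p j).natDegree) (Finset.mem_univ j)
    omega

/-- If the polynomial solution `v` has minimal degree, there is a dual chain `u`. -/
theorem IsPolynomialSolution.exists_dual_chain [FiniteDimensional 𝕜 V]
    {B₁ B₂ : LinearMap.BilinForm 𝕜 V} (h₁ : ∀ x y, B₁ x y = -B₁ y x) (h₂ : ∀ x y, B₂ x y = -B₂ y x)
    {n : ℕ} {v : ℕ → V} (hv : IsPolynomialSolution B₁ B₂ n v)
    (hmin : ∀ m < n, ∀ v', ¬ IsPolynomialSolution B₁ B₂ m v') :
    ∃ u : ℕ → V, (∀ s, s + 1 < n → B₁ (u (s + 1)) = -B₂ (u s)) ∧ (0 < n → B₁ (v 0) (u 0) = 1) := by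
  classical
  rcases n with _ | p
  · exact ⟨0, by simp, by simp⟩
  -- The kernel of `T` consists of the sequences with the relations wanted for `u`. If `φ` vanished
  -- on it, `φ` would factor through `T`, and the coefficients of this factorization, preceded by `v
  -- 0`, would be a polynomial solution of degree `p`, against minimality.
  let T : (Fin (p + 1) → V) →ₗ[𝕜] (Fin p → Module.Dual 𝕜 V) :=
    LinearMap.pi fun s => B₁ ∘ₗ LinearMap.proj s.succ + B₂ ∘ₗ LinearMap.proj s.castSucc
  let φ : Module.Dual 𝕜 (Fin (p + 1) → V) := B₁ (v 0) ∘ₗ LinearMap.proj 0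
  by_cases hker : LinearMap.ker T ≤ LinearMap.ker φ
  · exfalso
    have h1 : φ ∈ LinearMap.range T.dualMap := by
      rw [LinearMap.range_dualMap_eq_dualAnnihilator_ker, Submodule.mem_dualAnnihilator]
      exact fun u hu => hker hu
    obtain ⟨ψ, hψ⟩ := h1
    let e : Fin p → V := fun s =>
      (Module.evalEquiv 𝕜 V).symm (ψ ∘ₗ LinearMap.single 𝕜 (fun _ => Module.Dual 𝕜 V) s)
    have he : ∀ s f, ψ (Pi.single s f) = f (e s) := fun s f => by
      have := LinearMap.congr_fun ((Module.evalEquiv 𝕜 V).apply_symm_apply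
        (ψ ∘ₗ LinearMap.single 𝕜 (fun _ => Module.Dual 𝕜 V) s)) f
      exact this.symm
    obtain ⟨e', he0, he1, he2⟩ : ∃ e' : ℕ → V, e' 0 = v 0 ∧ (∀ s : Fin p, e' (s + 1) = e s) ∧
        ∀ s, p ≤ s → e' (s + 1) = 0 :=
      ⟨fun s => match s with
        | 0 => v 0
        | s + 1 => if h : s < p then e ⟨s, h⟩ else 0, rfl, fun s => by simp,
        fun s hs => by simp [hs]⟩
    have hU : ∀ U : ℕ → V, B₁ (v 0) (U 0) =
        ∑ s ∈ Finset.range p, (B₁ (U (s + 1)) (e' (s + 1)) + B₂ (U s) (e' (s + 1))) := fun U => by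
      have h2 := congrArg (fun L => L fun i : Fin (p + 1) => U i) hψ
      have h3 : T (fun i : Fin (p + 1) => U i) =
          ∑ s, Pi.single s (T (fun i : Fin (p + 1) => U i) s) := (Finset.univ_sum_single _).symm
      change ψ (T fun i : Fin (p + 1) => U i) = B₁ (v 0) (U 0) at h2
      rw [← h2, h3, map_sum, ← Fin.sum_univ_eq_sum_range
        (fun s => B₁ (U (s + 1)) (e' (s + 1)) + B₂ (U s) (e' (s + 1)))]
      refine Finset.sum_congr rfl fun s _ => ?_
      rw [he]
      rw [← he1]
      rfl
    have hB : ∀ (B : LinearMap.BilinForm 𝕜 V) (c : Prop) [Decidable c] (x y : V),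
        B (if c then x else 0) y = if c then B x y else 0 := fun B c _ x y => by
      split_ifs <;> simp
    refine hmin p (Nat.lt_succ_self p) e' ⟨by rw [he0]; exact hv.ne_zero, by rw [he0]; exact hv.zero,
      fun s => LinearMap.ext fun x => ?_, fun s hs => ?_⟩
    · rw [LinearMap.neg_apply, h₂, neg_inj]
      -- Sequences concentrated at one index separate the identity `hU` into the relations of a
      -- polynomial solution.
      have h2 := hU fun i => if i = s then x else 0
      rcases s with _ | s
      · simp only [hB, Nat.add_one_ne_zero, if_true, if_false, Finset.sum_add_distrib,
          Finset.sum_ite_eq', map_zero, LinearMap.zero_apply, zero_add,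
          Finset.mem_range] at h2
        rw [he0, h2]
        split_ifs with hp
        · rfl
        · rw [← zero_add 1, he2 0 (by omega), map_zero]
      · rcases lt_or_ge s p with hs | hs
        · simp only [hB, Nat.add_right_cancel_iff, Finset.sum_add_distrib, (Nat.succ_ne_zero s).symm,
            if_false, map_zero, Finset.sum_ite_eq', Finset.mem_range, hs, if_true] at h2
          have h3 : (if s + 1 < p then B₂ x (e' (s + 1 + 1)) else 0) = B₂ x (e' (s + 1 + 1)) := by
            split_ifs with hp
            · rfl
            · rw [he2 (s + 1) (by omega), map_zero]
          rw [h3] at h2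
          rw [h₁, eq_neg_of_add_eq_zero_right h2.symm]
        · rw [he2 s hs, he2 (s + 1) (by omega)]; simp
    · obtain ⟨r, rfl⟩ : ∃ r, s = r + 1 := ⟨s - 1, by omega⟩
      exact he2 r (by omega)
  · obtain ⟨u, hu, hφ⟩ := Set.not_subset.1 hker
    have hφ' : B₁ (v 0) (u 0) ≠ 0 := hφ
    refine ⟨fun i => if h : i < p + 1 then (B₁ (v 0) (u 0))⁻¹ • u ⟨i, h⟩ else 0, fun s hs => ?_,
      fun _ => ?_⟩
    · beta_reduce
      have h2 := congrFun (LinearMap.mem_ker.1 hu) ⟨s, by omega⟩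
      have h3 : B₁ (u ⟨s + 1, hs⟩) + B₂ (u ⟨s, by omega⟩) = 0 := h2
      rw [dif_pos hs, dif_pos (by omega), map_smul, map_smul,
        eq_neg_of_add_eq_zero_left h3]
      exact smul_neg _ _
    · beta_reduce
      rw [dif_pos (Nat.succ_pos p), map_smul, smul_eq_mul]
      exact inv_mul_cancel₀ hφ'

end KroneckerSummand

/-! ### Splitting off a Kronecker block. -/

section KroneckerSummand

variable {𝕜 V : Type*} [Field 𝕜] [CharZero 𝕜] [AddCommGroup V] [Module 𝕜 V]

lemma skew_self {B : LinearMap.BilinForm 𝕜 V} (h : ∀ x y, B x y = -B y x) (x : V) : B x x = 0 :=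
  self_eq_neg.1 (h x x)

/-- A family that has a dual family of functionals spans a complement of the common kernel. -/
lemma isCompl_of_dual_family {ι : Type*} [Fintype ι] [DecidableEq ι] {w : ι → V}
    {f : ι → Module.Dual 𝕜 V}
    (h : ∀ i j, f i (w j) = if i = j then 1 else 0) :
    LinearIndependent 𝕜 w ∧
      IsCompl (Submodule.span 𝕜 (Set.range w)) (⨅ i, LinearMap.ker (f i)) := by
  have hsum : ∀ (c : ι → 𝕜) i, f i (∑ j, c j • w j) = c i := fun c i => by
    simp [h]
  refine ⟨Fintype.linearIndependent_iff.2 fun c hc i => by rw [← hsum c i, hc, map_zero],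
    ⟨Submodule.disjoint_def.2 fun x hx hx' => ?_,
      codisjoint_iff.2 (eq_top_iff.2 fun x _ => ?_)⟩⟩
  · obtain ⟨c, rfl⟩ := (Submodule.mem_span_range_iff_exists_fun 𝕜).1 hx
    refine Finset.sum_eq_zero fun i _ => ?_
    rw [← hsum c i, LinearMap.mem_ker.1 ((Submodule.mem_iInf _).1 hx' i), zero_smul]
  · refine Submodule.mem_sup.2 ⟨∑ j, f j x • w j,
      (Submodule.mem_span_range_iff_exists_fun 𝕜).2 ⟨_, rfl⟩, x - ∑ j, f j x • w j,
      (Submodule.mem_iInf _).2 fun i => ?_, by abel⟩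
    rw [LinearMap.mem_ker, map_sub, hsum, sub_self]

/-- The relations between two chains that form a Kronecker pair. -/
structure IsKroneckerChain (B₁ B₂ : LinearMap.BilinForm 𝕜 V) (n : ℕ) (v u : ℕ → V) : Prop where
  vv : ∀ i j, B₁ (v i) (v j) = 0 ∧ B₂ (v i) (v j) = 0
  uu : ∀ i < n, ∀ j < n, B₁ (u i) (u j) = 0 ∧ B₂ (u i) (u j) = 0
  vu : ∀ i, ∀ j < n, B₁ (v i) (u j) = (if i = j then 1 else 0)
  uv : ∀ i, ∀ j < n, B₂ (u j) (v i) = (if i = j + 1 then 1 else 0)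

/-- The two recurrences and skew-symmetry move indices between the arguments of a pairing: `B₁ (v i)
(v j)` and `B₁ (u i) (u j)` depend only on `i + j`, and `B₁ (v i) (u j)` only on `i - j`. The values
then follow from `B₂ (v 0) = 0`, from the vanishing of `v` beyond `n`, and from skew-symmetry. -/
theorem IsPolynomialSolution.isKroneckerChain
    {B₁ B₂ : LinearMap.BilinForm 𝕜 V} (h₁ : ∀ x y, B₁ x y = -B₁ y x) (h₂ : ∀ x y, B₂ x y = -B₂ y x)
    {n : ℕ} {v u : ℕ → V} (hv : IsPolynomialSolution B₁ B₂ n v)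
    (hu : ∀ s, s + 1 < n → B₁ (u (s + 1)) = -B₂ (u s)) (hvu : 0 < n → B₁ (v 0) (u 0) = 1) :
    IsKroneckerChain B₁ B₂ n v u := by
  have hs : ∀ s x, B₂ (v (s + 1)) x = -B₁ (v s) x := fun s x => by rw [hv.succ]; rfl
  have h0 : ∀ x, B₂ (v 0) x = 0 := fun x => by rw [hv.zero]; rfl
  have hu' : ∀ s, s + 1 < n → ∀ x, B₁ (u (s + 1)) x = -B₂ (u s) x := fun s hs x => by
    rw [hu s hs]; rfl
  have hvv : ∀ j i, B₁ (v i) (v j) = 0 := fun j => by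
    induction j with
    | zero => exact fun i => by linear_combination hs i (v 0) - h₂ (v (i + 1)) (v 0) + h0 (v (i + 1))
    | succ j ih =>
      exact fun i => by
        linear_combination hs i (v (j + 1)) - h₂ (v (i + 1)) (v (j + 1)) + hs j (v (i + 1)) -
          h₁ (v j) (v (i + 1)) + ih (i + 1)
  have hshift : ∀ r i j, j + r < n → B₁ (v (i + r)) (u (j + r)) = B₁ (v i) (u j) := fun r => by
    induction r with
    | zero => exact fun i j _ => rfl
    | succ r ih =>
      intro i j hj
      rw [← ih i j (by omega), ← add_assoc, ← add_assoc]
      linear_combination h₁ (v (i + r + 1)) (u (j + r + 1)) - hu' (j + r) (by omega) (v (i + r + 1)) +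
        h₂ (v (i + r + 1)) (u (j + r)) - hs (i + r) (u (j + r))
  have hv0 : ∀ j, j + 1 < n → B₁ (v 0) (u (j + 1)) = 0 := fun j hj => by
    linear_combination h₁ (v 0) (u (j + 1)) - hu' j hj (v 0) + h₂ (v 0) (u j) - h0 (u j)
  have vu : ∀ i, ∀ j < n, B₁ (v i) (u j) = (if i = j then 1 else 0) := fun i j hj => by
    rcases le_or_gt i j with hij | hij
    · obtain ⟨d, rfl⟩ := Nat.exists_eq_add_of_le' hij
      have := hshift i 0 d hj
      rw [zero_add] at this
      rw [this]
      rcases d with _ | d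
      · simpa using hvu (by omega)
      · rw [hv0 d (by omega), if_neg (by omega)]
    -- For `i > j` both indices are raised until that of `u` is `n - 1`. The term of `v` after the
    -- resulting one has index above `n`, so it vanishes.
    · rw [← hshift (n - 1 - j) i j (by omega), if_neg (by omega)]
      have := hs (i + (n - 1 - j)) (u (j + (n - 1 - j)))
      rw [hv.eq_zero _ (by omega), map_zero, LinearMap.zero_apply] at this
      exact neg_eq_zero.1 this.symm
  have hswap : ∀ i j, i + 1 < n → j + 1 < n → B₁ (u (i + 1)) (u j) = B₁ (u i) (u (j + 1)) :=
    fun i j hi hj => by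
      linear_combination hu' i hi (u j) - h₂ (u i) (u j) + hu' j hj (u i) - h₁ (u i) (u (j + 1))
  have huu : ∀ d i, i + d < n → B₁ (u i) (u (i + d)) = 0 := fun d => by
    induction d using Nat.twoStepInduction with
    | zero => exact fun i _ => skew_self h₁ _
    | one =>
      intro i hi
      refine self_eq_neg.1 ?_
      linear_combination h₁ (u i) (u (i + 1)) - hswap i i hi hi
    | more d ih _ =>
      intro i hi
      rw [← add_assoc, ← hswap i (i + d + 1) (by omega) (by omega), add_right_comm]
      exact ih (i + 1) (by omega)
  have huu' : ∀ i < n, ∀ j < n, B₁ (u i) (u j) = 0 := fun i hi j hj => by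
    rcases le_total i j with hij | hij
    · obtain ⟨d, rfl⟩ := Nat.exists_eq_add_of_le hij
      exact huu d i hj
    · obtain ⟨d, rfl⟩ := Nat.exists_eq_add_of_le hij
      rw [h₁, huu d j hi, neg_zero]
  refine ⟨fun i j => ⟨hvv j i, ?_⟩, fun i hi j hj => ⟨huu' i hi j hj, ?_⟩, vu, fun i j hj => ?_⟩
  · rcases i with _ | i
    · exact h0 _
    · rw [hs, hvv, neg_zero]
  · by_cases hi' : i + 1 < n
    · linear_combination hu' i hi' (u j) - huu' (i + 1) hi' j hj
    · by_cases hj' : j + 1 < n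
      · linear_combination h₂ (u i) (u j) - hu' j hj' (u i) + huu' (j + 1) hj' i hi
      · obtain rfl : i = j := by omega
        exact skew_self h₂ _
  · rcases i with _ | i
    · rw [h₂, h0]; simp
    · rw [h₂, hs, neg_neg, vu i j hj]; simp

/-- The basis of a Kronecker pair that interlaces two chains. -/
def interlace (v u : ℕ → V) (i : ℕ) : V := if Even i then v (i / 2) else u (i / 2)

lemma interlace_two_mul (v u : ℕ → V) (i : ℕ) : interlace v u (2 * i) = v i := by
  simp [interlace]

lemma interlace_two_mul_add_one (v u : ℕ → V) (i : ℕ) : interlace v u (2 * i + 1) = u i := by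
  have h1 : ¬ Even (2 * i + 1) := by simp
  have h2 : (2 * i + 1) / 2 = i := by omega
  rw [interlace, if_neg h1, h2]

lemma IsKroneckerChain.interlace_apply {B₁ B₂ : LinearMap.BilinForm 𝕜 V}
    (h₁ : ∀ x y, B₁ x y = -B₁ y x) (h₂ : ∀ x y, B₂ x y = -B₂ y x) {n : ℕ} {v u : ℕ → V}
    (h : IsKroneckerChain B₁ B₂ n v u) {i j : ℕ} (hi : i < 2 * n + 1) (hj : j < 2 * n + 1) :
    B₁ (interlace v u i) (interlace v u j) = (if Even i ∧ j = i + 1 then 1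
        else if Even j ∧ i = j + 1 then -1 else 0) ∧
    B₂ (interlace v u i) (interlace v u j) = (if Odd i ∧ j = i + 1 then 1
        else if Odd j ∧ i = j + 1 then -1 else 0) := by
  rcases Nat.even_or_odd' i with ⟨a, rfl | rfl⟩ <;> rcases Nat.even_or_odd' j with ⟨b, rfl | rfl⟩
  · rw [interlace_two_mul, interlace_two_mul, (h.vv a b).1, (h.vv a b).2]
    constructor
    · rw [if_neg (by omega), if_neg (by omega)]
    · rw [if_neg (by omega), if_neg (by omega)]
  · rw [interlace_two_mul, interlace_two_mul_add_one, h.vu a b (by omega), h₂,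
      h.uv a b (by omega)]
    have e1 : ¬ Even (2 * b + 1) := by simp
    have e2 : ¬ Odd (2 * a) := by simp
    have e3 : Odd (2 * b + 1) := by simp
    have e4 : Even (2 * a) := by simp
    constructor
    · simp only [e4, e1, true_and, false_and, if_false]
      exact if_congr (by omega) rfl rfl
    · simp only [e2, e3, true_and, false_and, if_false]
      rw [apply_ite Neg.neg, neg_zero]
      exact if_congr (by omega) rfl rfl
  · rw [interlace_two_mul, interlace_two_mul_add_one, h.uv b a (by omega), h₁,
      h.vu b a (by omega)]
    have e1 : ¬ Even (2 * a + 1) := by simp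
    have e2 : ¬ Odd (2 * b) := by simp
    have e3 : Odd (2 * a + 1) := by simp
    have e4 : Even (2 * b) := by simp
    constructor
    · simp only [e4, e1, true_and, false_and, if_false]
      rw [apply_ite Neg.neg, neg_zero]
      exact if_congr (by omega) rfl rfl
    · simp only [e2, e3, true_and, false_and, if_false]
      exact if_congr (by omega) rfl rfl
  · rw [interlace_two_mul_add_one, interlace_two_mul_add_one, (h.uu a (by omega) b (by omega)).1,
      (h.uu a (by omega) b (by omega)).2]
    constructor
    · rw [if_neg (by omega), if_neg (by omega)]
    · rw [if_neg (by omega), if_neg (by omega)]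

/-- A pencil that degenerates for infinitely many parameters has a Kronecker summand. -/
theorem exists_kronecker_summand [FiniteDimensional 𝕜 V] {B₁ B₂ : LinearMap.BilinForm 𝕜 V}
    (h₁ : ∀ x y, B₁ x y = -B₁ y x) (h₂ : ∀ x y, B₂ x y = -B₂ y x)
    (hinf : {μ : 𝕜 | LinearMap.ker (B₁ + μ • B₂) ≠ ⊥}.Infinite) :
    ∃ (n : ℕ) (w : Fin (2 * n + 1) → V), LinearIndependent 𝕜 w ∧
      (∀ i j : Fin (2 * n + 1),
        B₁ (w i) (w j) = (if Even (i : ℕ) ∧ (j : ℕ) = i + 1 then 1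
          else if Even (j : ℕ) ∧ (i : ℕ) = j + 1 then -1 else 0) ∧
        B₂ (w i) (w j) = (if Odd (i : ℕ) ∧ (j : ℕ) = i + 1 then 1
          else if Odd (j : ℕ) ∧ (i : ℕ) = j + 1 then -1 else 0)) ∧
      ∃ U : Submodule 𝕜 V, IsCompl (Submodule.span 𝕜 (Set.range w)) U ∧
        ∀ x ∈ U, ∀ i, B₁ (w i) x = 0 ∧ B₂ (w i) x = 0 := by
  classical
  obtain ⟨n, v, hv, hmin⟩ : ∃ n v, IsPolynomialSolution B₁ B₂ n v ∧
      ∀ m < n, ∀ v', ¬ IsPolynomialSolution B₁ B₂ m v' := by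
    have hex := exists_isPolynomialSolution B₁ B₂ hinf
    obtain ⟨v, hv⟩ := Nat.find_spec hex
    exact ⟨_, v, hv, fun m hm v' hv' => Nat.find_min hex hm ⟨v', hv'⟩⟩
  obtain ⟨u, hu, hvu⟩ := hv.exists_dual_chain h₁ h₂ hmin
  have hc := hv.isKroneckerChain h₁ h₂ hu hvu
  -- The functional dual to `v n`. For `n > 0` it is `B₂ (u (n - 1))`, which also makes the
  -- complement orthogonal to `u (n - 1)`. For `n = 0` the vector `v 0` lies in both kernels and any
  -- functional with value `1` on it will do.
  obtain ⟨g, hg⟩ : ∃ g : Module.Dual 𝕜 V, (∀ i ≤ n, g (v i) = if i = n then 1 else 0) ∧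
      (∀ j < n, g (u j) = 0) ∧ (∀ s, s + 1 = n → g = B₂ (u s)) := by
    rcases n with _ | p
    · obtain ⟨g, hg⟩ := Module.Projective.exists_dual_eq_one 𝕜 hv.ne_zero
      refine ⟨g, fun i hi => ?_, fun j hj => absurd hj (by omega), fun s hs => absurd hs (by omega)⟩
      obtain rfl : i = 0 := by omega
      simpa using hg
    · refine ⟨B₂ (u p), fun i hi => ?_, fun j hj => (hc.uu p (by omega) j hj).2, fun s hs => ?_⟩
      · exact hc.uv i p (by omega)
      · rw [show s = p by omega]
  -- Apart from `g` when `n = 0`, each functional is a pairing with a vector of the chains. Hence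
  -- their common kernel is at once a complement of the span of `w` and orthogonal to it.
  let f : Fin (2 * n + 1) → Module.Dual 𝕜 V := fun i =>
    if Even (i : ℕ) then (if (i : ℕ) / 2 < n then LinearMap.flip B₁ (u (i / 2)) else g) else B₁ (v (i / 2))
  let w : Fin (2 * n + 1) → V := fun i => interlace v u i
  have hf0 : ∀ (a : ℕ) (ha : 2 * a < 2 * n + 1), f ⟨2 * a, ha⟩ =
      if a < n then LinearMap.flip B₁ (u a) else g := fun a ha => by
    simp [f]
  have hf1 : ∀ (a : ℕ) (ha : 2 * a + 1 < 2 * n + 1), f ⟨2 * a + 1, ha⟩ = B₁ (v a) := fun a ha => by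
    have h1 : ¬ Even (2 * a + 1) := by simp
    have h2 : (2 * a + 1) / 2 = a := by omega
    simp only [f, h1, if_false, h2]
  have hdual : ∀ i j, f i (w j) = if i = j then 1 else 0 := by
    rintro ⟨i, hi⟩ ⟨j, hj⟩
    simp only [Fin.mk.injEq]
    rcases Nat.even_or_odd' i with ⟨a, rfl | rfl⟩ <;>
      rcases Nat.even_or_odd' j with ⟨b, rfl | rfl⟩
    · rw [hf0]
      rw [show w ⟨2 * b, hj⟩ = v b from interlace_two_mul v u b]
      split_ifs with h3 h4 h4
      · rw [LinearMap.flip_apply, hc.vu b a h3, if_pos (by omega)]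
      · rw [LinearMap.flip_apply, hc.vu b a h3, if_neg (by omega)]
      · rw [hg.1 b (by omega), if_pos (by omega)]
      · rw [hg.1 b (by omega), if_neg (by omega)]
    · rw [hf0, if_neg (by omega : ¬ 2 * a = 2 * b + 1)]
      rw [show w ⟨2 * b + 1, hj⟩ = u b from interlace_two_mul_add_one v u b]
      split_ifs with h3
      · exact (hc.uu b (by omega) a h3).1
      · exact hg.2.1 b (by omega)
    · rw [hf1, if_neg (by omega : ¬ 2 * a + 1 = 2 * b)]
      rw [show w ⟨2 * b, hj⟩ = v b from interlace_two_mul v u b]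
      exact (hc.vv a b).1
    · rw [hf1]
      rw [show w ⟨2 * b + 1, hj⟩ = u b from interlace_two_mul_add_one v u b, hc.vu a b (by omega)]
      exact if_congr (by omega) rfl rfl
  obtain ⟨hli, hcompl⟩ := isCompl_of_dual_family hdual
  refine ⟨n, w, hli, fun i j => hc.interlace_apply h₁ h₂ i.2 j.2, _, hcompl, fun x hx => ?_⟩
  have hx' : ∀ i, f i x = 0 := fun i => LinearMap.mem_ker.1 ((Submodule.mem_iInf _).1 hx i)
  have hxu : ∀ a < n, B₁ (u a) x = 0 := fun a ha => by
    have h3 := hx' ⟨2 * a, by omega⟩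
    rw [hf0, if_pos ha, LinearMap.flip_apply] at h3
    rw [h₁, h3, neg_zero]
  have hxv : ∀ a < n, B₁ (v a) x = 0 := fun a ha => by
    have h3 := hx' ⟨2 * a + 1, by omega⟩
    rwa [hf1] at h3
  have hxg : g x = 0 := by
    have h3 := hx' ⟨2 * n, by omega⟩
    rwa [hf0, if_neg (lt_irrefl n)] at h3
  rintro ⟨i, hi⟩
  change B₁ (interlace v u i) x = 0 ∧ B₂ (interlace v u i) x = 0
  rcases Nat.even_or_odd' i with ⟨a, rfl | rfl⟩
  · rw [interlace_two_mul]
    constructor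
    · rcases lt_or_ge a n with ha | ha
      · exact hxv a ha
      · have := hv.succ a
        rw [hv.eq_zero (a + 1) (by omega), map_zero] at this
        rw [neg_eq_zero.1 this.symm]; rfl
    · rcases a with _ | a
      · rw [hv.zero]; rfl
      · rw [hv.succ, LinearMap.neg_apply, hxv a (by omega), neg_zero]
  · rw [interlace_two_mul_add_one]
    refine ⟨hxu a (by omega), ?_⟩
    rcases lt_or_ge (a + 1) n with ha | ha
    · have := LinearMap.congr_fun (hu a ha) x
      rw [hxu _ ha, LinearMap.neg_apply] at this
      exact neg_eq_zero.1 this.symm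
    · rw [← hg.2.2 a (by omega)]; exact hxg

end KroneckerSummand

/-! ### Indecomposable blocks and block decompositions. -/

section Blocks

variable {𝕜 V : Type*} [Field 𝕜] [CharZero 𝕜] [AddCommGroup V] [Module 𝕜 V]

/-- The restriction of `B₁ + μ • B₂` to `W` is nondegenerate. -/
def IsNondegenerateOn (B₁ B₂ : LinearMap.BilinForm 𝕜 V) (μ : 𝕜) (W : Submodule 𝕜 V) : Prop :=
  ∀ x ∈ W, (∀ y ∈ W, B₁ x y + μ * B₂ x y = 0) → x = 0

/-- An indecomposable block that degenerates for infinitely many parameters is Kronecker. -/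
theorem IsIndecomposable.isKroneckerBlock [FiniteDimensional 𝕜 V] {B₁ B₂ : LinearMap.BilinForm 𝕜 V}
    (h₁ : ∀ x y, B₁ x y = -B₁ y x) (h₂ : ∀ x y, B₂ x y = -B₂ y x) {W : Submodule 𝕜 V}
    (hW : IsIndecomposable B₁ B₂ W) (hinf : {μ | ¬ IsNondegenerateOn B₁ B₂ μ W}.Infinite) :
    IsKroneckerBlock B₁ B₂ W := by
  have hinf' : {μ : 𝕜 | LinearMap.ker (B₁.restrict W + μ • B₂.restrict W) ≠ ⊥}.Infinite := by
    refine hinf.mono fun μ hμ => ?_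
    simp only [IsNondegenerateOn, Set.mem_ofPred_eq, not_forall] at hμ
    obtain ⟨x, hx, hxy, hx0⟩ := hμ
    refine (Submodule.ne_bot_iff _).2 ⟨⟨x, hx⟩, LinearMap.ext fun y => ?_, ?_⟩
    · simpa using hxy y y.2
    · simpa using hx0
  obtain ⟨n, w, hli, htab, U, hU, hort⟩ := exists_kronecker_summand
    (B₁ := B₁.restrict W) (B₂ := B₂.restrict W) (fun x y => h₁ x y) (fun x y => h₂ x y) hinf'
  have hort' : ∀ x ∈ Submodule.span 𝕜 (Set.range w), ∀ y ∈ U,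
      B₁ (x : V) y = 0 ∧ B₂ (x : V) y = 0 := by
    intro x hx y hy
    induction hx using Submodule.span_induction with
    | mem x hx =>
      obtain ⟨i, rfl⟩ := hx
      exact hort y hy i
    | zero => simp
    | add x x' _ _ hx hx' => simp [hx, hx']
    | smul c x _ hx => simp [hx]
  have hU0 : U = ⊥ := by
    have hinj : Function.Injective W.subtype := W.injective_subtype
    rcases hW.2 ((Submodule.span 𝕜 (Set.range w)).map W.subtype) (U.map W.subtype)
      (by rw [← Submodule.map_sup, hU.sup_eq_top, Submodule.map_subtype_top])
      (by rw [← Submodule.map_inf _ hinj, hU.inf_eq_bot, Submodule.map_bot])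
      (by
        rintro _ ⟨x, hx, rfl⟩ _ ⟨y, hy, rfl⟩
        obtain ⟨e1, e2⟩ := hort' x hx y hy
        refine ⟨e1, e2, ?_, ?_⟩
        · rw [h₁]; exact neg_eq_zero.2 e1
        · rw [h₂]; exact neg_eq_zero.2 e2) with h | h
    · rw [← Submodule.map_bot W.subtype] at h
      have h := Submodule.map_injective_of_injective hinj h
      rw [Submodule.span_eq_bot] at h
      exact absurd (h _ ⟨0, rfl⟩) (hli.ne_zero 0)
    · rw [← Submodule.map_bot W.subtype] at h
      exact Submodule.map_injective_of_injective hinj h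
  have htop : ⊤ ≤ Submodule.span 𝕜 (Set.range w) := by
    rw [← hU.sup_eq_top, hU0, sup_bot_eq]
  refine ⟨n + 1, by omega, Module.Basis.mk hli htop, fun i j => ?_⟩
  have := htab i j
  rw [show (Module.Basis.mk hli htop) i = w i from Module.Basis.mk_apply _ _ _,
    show (Module.Basis.mk hli htop) j = w j from Module.Basis.mk_apply _ _ _]
  exact this

/-- A skew-symmetric form on a space of odd dimension is degenerate. -/
theorem not_isNondegenerateOn_of_odd [FiniteDimensional 𝕜 V] {B₁ B₂ : LinearMap.BilinForm 𝕜 V}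
    (h₁ : ∀ x y, B₁ x y = -B₁ y x) (h₂ : ∀ x y, B₂ x y = -B₂ y x) {W : Submodule 𝕜 V}
    (hW : Odd (Module.finrank 𝕜 W)) (μ : 𝕜) : ¬ IsNondegenerateOn B₁ B₂ μ W := by
  intro h
  let b := Module.finBasis 𝕜 W
  let A : Matrix (Fin (Module.finrank 𝕜 W)) (Fin (Module.finrank 𝕜 W)) 𝕜 :=
    Matrix.of fun i j => B₁ (b i : V) (b j) + μ * B₂ (b i : V) (b j)
  have hA : A.transpose = -A := by
    ext i j
    simp only [A, Matrix.transpose_apply, Matrix.of_apply, Matrix.neg_apply]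
    rw [h₁ (b j : V), h₂ (b j : V)]; ring
  have hdet : A.det = 0 := by
    have h3 : A.det = -A.det := by
      conv_lhs => rw [← Matrix.det_transpose, hA, Matrix.det_neg, Fintype.card_fin, hW.neg_one_pow]
      ring
    exact self_eq_neg.1 h3
  obtain ⟨v, hv, hv0⟩ := Matrix.exists_vecMul_eq_zero_iff.2 hdet
  have hx : (∑ i, v i • b i : W) = 0 := by
    refine Subtype.ext (h _ (∑ i, v i • b i : W).2 fun y hy => ?_)
    have hlin : ∀ z : W, B₁ ((∑ i, v i • b i : W) : V) z + μ * B₂ ((∑ i, v i • b i : W) : V) z = 0 := by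
      have : (B₁.restrict W + μ • B₂.restrict W) (∑ i, v i • b i) = 0 := by
        refine b.ext fun j => ?_
        have := congrFun hv0 j
        simp only [Matrix.vecMul, dotProduct, A, Matrix.of_apply, Pi.zero_apply] at this
        rw [LinearMap.zero_apply, ← this, map_sum, LinearMap.sum_apply]
        exact Finset.sum_congr rfl fun i _ => by rw [map_smul]; rfl
      exact fun z => LinearMap.congr_fun this z
    exact hlin ⟨y, hy⟩
  exact hv (funext fun i => Fintype.linearIndependent_iff.1 b.linearIndependent v hx i)

lemma iSupIndep_sumElim {ι κ : Type*} {X : ι → Submodule 𝕜 V} {Y : κ → Submodule 𝕜 V}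
    (hX : iSupIndep X) (hY : iSupIndep Y) (h : Disjoint (⨆ i, X i) (⨆ i, Y i)) :
    iSupIndep (Sum.elim X Y) := by
  classical
  rw [iSupIndep_iff_finsetSum_eq_zero_imp_eq_zero] at *
  intro s v hv hs
  rw [← Finset.toLeft_disjSum_toRight (u := s), Finset.sum_disjSum] at hs
  have hl : ∀ i ∈ s.toLeft, v (Sum.inl i) ∈ X i := fun i hi => hv _ (Finset.mem_toLeft.1 hi)
  have hr : ∀ i ∈ s.toRight, v (Sum.inr i) ∈ Y i := fun i hi => hv _ (Finset.mem_toRight.1 hi)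
  have hl0 : ∑ i ∈ s.toLeft, v (Sum.inl i) = 0 := by
    refine Submodule.disjoint_def.1 h _
      (Submodule.sum_mem _ fun i hi => Submodule.mem_iSup_of_mem i (hl i hi)) ?_
    rw [eq_neg_of_add_eq_zero_left hs]
    exact Submodule.neg_mem _
      (Submodule.sum_mem _ fun i hi => Submodule.mem_iSup_of_mem i (hr i hi))
  rw [hl0, zero_add] at hs
  rintro (i | i) hi
  · exact hX _ _ hl hl0 i (Finset.mem_toLeft.2 hi)
  · exact hY _ _ hr hs i (Finset.mem_toRight.2 hi)

/-- Block decompositions of a subspace exist. -/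
theorem exists_blocks [FiniteDimensional 𝕜 V] {B₁ B₂ : LinearMap.BilinForm 𝕜 V}
    (W : Submodule 𝕜 V) : ∃ (l : ℕ) (X : Fin l → Submodule 𝕜 V), iSupIndep X ∧ ⨆ i, X i = W ∧
      (∀ i j, i ≠ j → Orthogonal B₁ B₂ (X i) (X j)) ∧ ∀ i, IsIndecomposable B₁ B₂ (X i) := by
  induction hd : Module.finrank 𝕜 W using Nat.strong_induction_on generalizing W with
  | _ d ih =>
    by_cases h0 : W = ⊥
    · exact ⟨0, Fin.elim0, iSupIndep_subsingleton _, by rw [h0]; exact iSup_of_empty _,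
        fun i => i.elim0, fun i => i.elim0⟩
    by_cases hind : IsIndecomposable B₁ B₂ W
    · exact ⟨1, fun _ => W, iSupIndep_subsingleton _, iSup_const,
        fun i j hij => absurd (Subsingleton.elim i j) hij, fun _ => hind⟩
    simp only [IsIndecomposable, not_and, not_forall] at hind
    obtain ⟨W', W'', hsup, hinf, hort, hne⟩ := hind h0
    rw [not_or] at hne
    have hlt' : W' < W := lt_of_le_of_ne (hsup ▸ le_sup_left) fun h => hne.2 <| by
      rw [← hinf, inf_eq_right.2 (h ▸ hsup ▸ le_sup_right)]
    have hlt'' : W'' < W := lt_of_le_of_ne (hsup ▸ le_sup_right) fun h => hne.1 <| by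
      rw [← hinf, inf_eq_left.2 (h ▸ hsup ▸ le_sup_left)]
    obtain ⟨a, X, hX, hXs, hXo, hXi⟩ := ih _ (hd ▸ Submodule.finrank_lt_finrank_of_lt hlt') W' rfl
    obtain ⟨b, Y, hY, hYs, hYo, hYi⟩ := ih _ (hd ▸ Submodule.finrank_lt_finrank_of_lt hlt'') W'' rfl
    have hXW : ∀ i, X i ≤ W' := fun i => hXs ▸ le_iSup X i
    have hYW : ∀ i, Y i ≤ W'' := fun i => hYs ▸ le_iSup Y i
    have hort' : ∀ i j : Fin a ⊕ Fin b, i ≠ j →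
        Orthogonal B₁ B₂ (Sum.elim X Y i) (Sum.elim X Y j) := by
      rintro (i | i) (j | j) hij
      · exact hXo i j fun h => hij (h ▸ rfl)
      · exact fun x hx y hy => hort x (hXW i hx) y (hYW j hy)
      · intro x hx y hy
        obtain ⟨e1, e2, e3, e4⟩ := hort y (hXW j hy) x (hYW i hx)
        exact ⟨e3, e4, e1, e2⟩
      · exact hYo i j fun h => hij (h ▸ rfl)
    have hindec : ∀ i : Fin a ⊕ Fin b, IsIndecomposable B₁ B₂ (Sum.elim X Y i) := by
      rintro (i | i)
      exacts [hXi i, hYi i]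
    refine ⟨a + b, Sum.elim X Y ∘ finSumFinEquiv.symm,
      (iSupIndep_sumElim hX hY (by rw [hXs, hYs]; exact disjoint_iff.2 hinf)).comp
        finSumFinEquiv.symm.injective, ?_,
      fun i j hij => hort' _ _ (finSumFinEquiv.symm.injective.ne hij), fun i => hindec _⟩
    rw [← hsup, ← hXs, ← hYs]
    exact (finSumFinEquiv.symm.iSup_comp (g := Sum.elim X Y)).trans iSup_sum

theorem exists_isBlockDecomposition [FiniteDimensional 𝕜 V] (B₁ B₂ : LinearMap.BilinForm 𝕜 V) :
    ∃ (l : ℕ) (W : Fin l → Submodule 𝕜 V), IsBlockDecomposition B₁ B₂ W := by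
  obtain ⟨l, X, h1, h2, h3, h4⟩ := exists_blocks (B₁ := B₁) (B₂ := B₂) ⊤
  exact ⟨l, X, h1, h2, h3, h4⟩

end Blocks

/-! ### Frames of Kronecker blocks. -/

section Frames

variable {𝕜 V : Type*} [Field 𝕜] [CharZero 𝕜] [AddCommGroup V] [Module 𝕜 V]
  {B₁ B₂ : LinearMap.BilinForm 𝕜 V}

/-- Mutually orthogonal Kronecker bases `vec j 0, …, vec j (2 k_j - 2)` in `V` together with their
coordinate functionals. -/
structure KroneckerFrame (B₁ B₂ : LinearMap.BilinForm 𝕜 V) {ι : Type*} (k : ι → ℕ) where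
  vec : ι → ℕ → V
  coord : ι → ℕ → Module.Dual 𝕜 V
  pos : ∀ j, 1 ≤ k j
  coord_self : ∀ j i, i < 2 * k j - 1 → coord j i (vec j i) = 1
  coord_ne : ∀ j i j' i', i < 2 * k j - 1 → i' < 2 * k j' - 1 → j ≠ j' ∨ i ≠ i' →
    coord j i (vec j' i') = 0
  one_odd : ∀ x j s, s + 1 < k j → B₁ x (vec j (2 * s + 1)) = coord j (2 * s) x
  one_even : ∀ x j s, s + 1 < k j → B₁ x (vec j (2 * s)) = -coord j (2 * s + 1) x
  one_last : ∀ x j s, s + 1 = k j → B₁ x (vec j (2 * s)) = 0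
  two_odd : ∀ x j s, s + 1 < k j → B₂ x (vec j (2 * s + 1)) = -coord j (2 * s + 2) x
  two_even : ∀ x j s, s + 1 < k j → B₂ x (vec j (2 * s + 2)) = coord j (2 * s + 1) x
  two_zero : ∀ x j, B₂ x (vec j 0) = 0

/-- The orthogonal complement of the blocks of a frame. -/
def KroneckerFrame.complement {ι : Type*} {k : ι → ℕ} (F : KroneckerFrame B₁ B₂ k) :
    Submodule 𝕜 V :=
  ⨅ p : Σ j, Fin (2 * k j - 1), LinearMap.ker (F.coord p.1 p.2)

section Decomposition

variable {l : ℕ} {W : Fin l → Submodule 𝕜 V}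

lemma IsBlockDecomposition.isCompl (D : IsBlockDecomposition B₁ B₂ W) (i : Fin l) :
    IsCompl (W i) (⨆ j, ⨆ _ : j ≠ i, W j) :=
  ⟨D.independent i, codisjoint_iff.2 <| by
    rw [← D.span]
    refine le_antisymm (sup_le (le_iSup W i) (iSup₂_le fun j _ => le_iSup W j))
      (iSup_le fun j => ?_)
    by_cases h : j = i
    · exact h ▸ le_sup_left
    · exact le_sup_of_le_right (le_iSup₂_of_le j h le_rfl)⟩

/-- The projection onto a block. -/
def IsBlockDecomposition.proj (D : IsBlockDecomposition B₁ B₂ W) (i : Fin l) : V →ₗ[𝕜] W i :=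
  Submodule.projectionOnto _ _ (D.isCompl i)

lemma IsBlockDecomposition.proj_coe (D : IsBlockDecomposition B₁ B₂ W) {i : Fin l} (x : W i) :
    D.proj i x = x :=
  Submodule.projectionOnto_apply_left _ x

lemma IsBlockDecomposition.proj_of_ne (D : IsBlockDecomposition B₁ B₂ W) {i j : Fin l} (h : j ≠ i)
    {x : V} (hx : x ∈ W j) : D.proj i x = 0 :=
  (Submodule.projectionOnto_apply_eq_zero_iff _).2
    (Submodule.mem_iSup_of_mem j (Submodule.mem_iSup_of_mem h hx))

lemma IsBlockDecomposition.sum_proj (D : IsBlockDecomposition B₁ B₂ W) (x : V) :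
    ∑ i, (D.proj i x : V) = x := by
  have hx : x ∈ ⨆ i, W i := D.span ▸ Submodule.mem_top
  induction hx using Submodule.iSup_induction' with
  | mem i x hx =>
    rw [Finset.sum_eq_single i, D.proj_coe ⟨x, hx⟩]
    · intro j _ hj
      rw [D.proj_of_ne hj.symm hx]; rfl
    · simp
  | zero => simp
  | add x y _ _ hx hy => simp only [map_add, Submodule.coe_add, Finset.sum_add_distrib, hx, hy]

lemma IsBlockDecomposition.apply_proj (D : IsBlockDecomposition B₁ B₂ W) {i : Fin l} (x : V)
    {y : V} (hy : y ∈ W i) : B₁ (D.proj i x) y = B₁ x y ∧ B₂ (D.proj i x) y = B₂ x y := by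
  have h : ∀ j ∈ Finset.univ, j ≠ i → B₁ (D.proj j x) y = 0 ∧ B₂ (D.proj j x) y = 0 :=
    fun j _ hj => by
      obtain ⟨e1, e2, -, -⟩ := D.orthogonal j i hj _ (D.proj j x).2 y hy
      exact ⟨e1, e2⟩
  constructor
  · conv_rhs => rw [← D.sum_proj x, map_sum, LinearMap.sum_apply,
      Finset.sum_eq_single i (fun j hj hj' => (h j hj hj').1) (by simp)]
  · conv_rhs => rw [← D.sum_proj x, map_sum, LinearMap.sum_apply,
      Finset.sum_eq_single i (fun j hj hj' => (h j hj hj').2) (by simp)]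

end Decomposition

section KroneckerBasis

variable {W : Submodule 𝕜 V} {k : ℕ} {w : Module.Basis (Fin (2 * k - 1)) 𝕜 W}

/-- Everything is linear in `x`, so the table of pairings can be checked on basis vectors. In this
form, pairing with a basis vector is a coordinate functional up to sign, or zero. -/
lemma kroneckerBasis_pairings
    (h : ∀ i j : Fin (2 * k - 1),
      B₁ (w i) (w j) = (if Even (i : ℕ) ∧ (j : ℕ) = i + 1 then 1
        else if Even (j : ℕ) ∧ (i : ℕ) = j + 1 then -1 else 0) ∧
      B₂ (w i) (w j) = (if Odd (i : ℕ) ∧ (j : ℕ) = i + 1 then 1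
        else if Odd (j : ℕ) ∧ (i : ℕ) = j + 1 then -1 else 0)) (x : W) (s : ℕ) :
    (∀ hs : s + 1 < k,
      B₁ x (w ⟨2 * s + 1, by omega⟩) = w.coord ⟨2 * s, by omega⟩ x ∧
      B₁ x (w ⟨2 * s, by omega⟩) = -w.coord ⟨2 * s + 1, by omega⟩ x ∧
      B₂ x (w ⟨2 * s + 1, by omega⟩) = -w.coord ⟨2 * s + 2, by omega⟩ x ∧
      B₂ x (w ⟨2 * s + 2, by omega⟩) = w.coord ⟨2 * s + 1, by omega⟩ x) ∧
    (∀ hs : s + 1 = k, B₁ x (w ⟨2 * s, by omega⟩) = 0) ∧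
    (∀ hs : 0 < k, B₂ x (w ⟨0, by omega⟩) = 0) := by
  have key : ∀ (B : LinearMap.BilinForm 𝕜 V) (y : W) (f : Module.Dual 𝕜 W),
      (∀ i, B (w i) y = f (w i)) → B x y = f x := fun B y f hf =>
    LinearMap.congr_fun (w.ext hf : (B.restrict W).flip y = f) x
  have hc : ∀ a i : Fin (2 * k - 1), w.coord a (w i) = if (i : ℕ) = a then 1 else 0 := fun a i => by
    rw [Module.Basis.coord_apply, Module.Basis.repr_self, Finsupp.single_apply]
    exact if_congr Fin.ext_iff rfl rfl
  simp only [Nat.even_iff, Nat.odd_iff] at h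
  have hi : ∀ i : Fin (2 * k - 1), (i : ℕ) < 2 * k - 1 := fun i => i.2
  refine ⟨fun hs => ⟨key _ _ _ fun i => ?_, key _ _ (-_) fun i => ?_, key _ _ (-_) fun i => ?_,
    key _ _ _ fun i => ?_⟩, fun hs => key _ _ 0 fun i => ?_, fun hs => key _ _ 0 fun i => ?_⟩
  · rw [(h i _).1, hc]
    split_ifs <;> first | rfl | (exfalso; dsimp only at *; omega)
  · rw [(h i _).1, LinearMap.neg_apply, hc]
    split_ifs <;> first | rfl | (exfalso; dsimp only at *; omega) | exact neg_zero.symm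
  · rw [(h i _).2, LinearMap.neg_apply, hc]
    split_ifs <;> first | rfl | (exfalso; dsimp only at *; omega) | exact neg_zero.symm
  · rw [(h i _).2, hc]
    split_ifs <;> first | rfl | (exfalso; dsimp only at *; omega)
  · have := hi i
    rw [(h i _).1, LinearMap.zero_apply]
    split_ifs <;> first | rfl | (exfalso; dsimp only at *; omega)
  · rw [(h i _).2, LinearMap.zero_apply]
    split_ifs <;> first | rfl | (exfalso; dsimp only at *; first | omega | simp_all)

end KroneckerBasis

/-- A block decomposition yields a frame of its Kronecker blocks, whose complement is nondegenerate
for almost all parameters. -/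
theorem IsBlockDecomposition.exists_frame [FiniteDimensional 𝕜 V]
    (h₁ : ∀ x y, B₁ x y = -B₁ y x) (h₂ : ∀ x y, B₂ x y = -B₂ y x) {l : ℕ}
    {W : Fin l → Submodule 𝕜 V} (D : IsBlockDecomposition B₁ B₂ W) :
    ∃ (k : {i // IsKroneckerBlock B₁ B₂ (W i)} → ℕ) (F : KroneckerFrame B₁ B₂ k),
      (∀ j : {i // IsKroneckerBlock B₁ B₂ (W i)}, Module.finrank 𝕜 (W j) = 2 * k j - 1) ∧
      (∀ i, ¬ IsKroneckerBlock B₁ B₂ (W i) → W i ≤ F.complement) ∧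
      {μ | ¬ IsNondegenerateOn B₁ B₂ μ F.complement}.Finite := by
  choose k hk w hw using fun j : {i // IsKroneckerBlock B₁ B₂ (W i)} => j.2
  let F : KroneckerFrame B₁ B₂ k :=
    -- The values outside the index range of a block are irrelevant.
    { vec := fun j i => if h : i < 2 * k j - 1 then (w j ⟨i, h⟩ : V) else 0
      coord := fun j i => if h : i < 2 * k j - 1 then (w j).coord ⟨i, h⟩ ∘ₗ D.proj j else 0
      pos := hk
      coord_self := fun j i hi => by
        rw [dif_pos hi, dif_pos hi, LinearMap.comp_apply, D.proj_coe]
        simp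
      coord_ne := fun j i j' i' hi hi' hne => by
        rw [dif_pos hi, dif_pos hi', LinearMap.comp_apply]
        by_cases hj : j = j'
        · subst hj
          have hii : i' ≠ i := (hne.resolve_left fun h => h rfl).symm
          rw [D.proj_coe, Module.Basis.coord_apply, Module.Basis.repr_self,
            Finsupp.single_eq_of_ne fun h => hii (Fin.mk.inj_iff.1 h).symm]
        · rw [D.proj_of_ne (fun h => hj (Subtype.ext h.symm)) (w j' ⟨i', hi'⟩).2, map_zero]
      one_odd := fun x j s hs => by
        rw [dif_pos (show 2 * s + 1 < 2 * k j - 1 by omega),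
          dif_pos (show 2 * s < 2 * k j - 1 by omega), ← (D.apply_proj x (w j _).2).1]
        exact ((kroneckerBasis_pairings (hw j) (D.proj j x) s).1 hs).1
      one_even := fun x j s hs => by
        rw [dif_pos (show 2 * s + 1 < 2 * k j - 1 by omega),
          dif_pos (show 2 * s < 2 * k j - 1 by omega), ← (D.apply_proj x (w j _).2).1]
        exact ((kroneckerBasis_pairings (hw j) (D.proj j x) s).1 hs).2.1
      one_last := fun x j s hs => by
        rw [dif_pos (show 2 * s < 2 * k j - 1 by omega), ← (D.apply_proj x (w j _).2).1]
        exact (kroneckerBasis_pairings (hw j) (D.proj j x) s).2.1 hs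
      two_odd := fun x j s hs => by
        rw [dif_pos (show 2 * s + 1 < 2 * k j - 1 by omega),
          dif_pos (show 2 * s + 2 < 2 * k j - 1 by omega), ← (D.apply_proj x (w j _).2).2]
        exact ((kroneckerBasis_pairings (hw j) (D.proj j x) s).1 hs).2.2.1
      two_even := fun x j s hs => by
        rw [dif_pos (show 2 * s + 1 < 2 * k j - 1 by omega),
          dif_pos (show 2 * s + 2 < 2 * k j - 1 by omega), ← (D.apply_proj x (w j _).2).2]
        exact ((kroneckerBasis_pairings (hw j) (D.proj j x) s).1 hs).2.2.2
      two_zero := fun x j => by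
        have := hk j
        rw [dif_pos (show 0 < 2 * k j - 1 by omega), ← (D.apply_proj x (w j _).2).2]
        exact (kroneckerBasis_pairings (hw j) (D.proj j x) 0).2.2 (hk j) }
  have hFc : ∀ (x : V) j (i : Fin (2 * k j - 1)), F.coord j i x = (w j).coord i (D.proj j x) :=
    fun x j i => by
      change (if h : (i : ℕ) < 2 * k j - 1 then (w j).coord ⟨i, h⟩ ∘ₗ D.proj j else 0) x = _
      rw [dif_pos i.2]; rfl
  have hmem : ∀ x, x ∈ F.complement ↔ ∀ j : {i // IsKroneckerBlock B₁ B₂ (W i)},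
      D.proj j x = 0 := fun x => by
    rw [KroneckerFrame.complement, Submodule.mem_iInf]
    constructor
    · intro h j
      refine (w j).ext_elem fun i => ?_
      have := h ⟨j, i⟩
      rw [LinearMap.mem_ker, hFc] at this
      simpa using this
    · rintro h ⟨j, i⟩
      rw [LinearMap.mem_ker, hFc, h, map_zero]
  have hsub : ∀ i, ¬ IsKroneckerBlock B₁ B₂ (W i) → W i ≤ F.complement := fun i hi x hx =>
    (hmem x).2 fun j => D.proj_of_ne (fun h : i = j => hi (by rw [h]; exact j.2)) hx
  refine ⟨k, F, fun j => ?_, hsub, ?_⟩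
  · rw [Module.finrank_eq_card_basis (w j), Fintype.card_fin]
  -- Each of the finitely many blocks that are not Kronecker excludes only finitely many parameters.
  · have hfin : (⋃ i ∈ {i | ¬ IsKroneckerBlock B₁ B₂ (W i)},
        {μ | ¬ IsNondegenerateOn B₁ B₂ μ (W i)}).Finite :=
      (Set.toFinite _).biUnion fun i hi => by
        by_contra h
        exact hi ((D.indecomposable i).isKroneckerBlock h₁ h₂ h)
    refine hfin.subset fun μ hμ => ?_
    by_contra hnot
    simp only [Set.mem_iUnion, Set.mem_ofPred_eq, not_exists, not_not] at hnot
    refine hμ fun x hx hxy => ?_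
    rw [← D.sum_proj x]
    refine Finset.sum_eq_zero fun i _ => ?_
    by_cases hi : IsKroneckerBlock B₁ B₂ (W i)
    · rw [(hmem x).1 hx ⟨i, hi⟩]; rfl
    · refine hnot i hi _ (D.proj i x).2 fun y hy => ?_
      rw [(D.apply_proj x hy).1, (D.apply_proj x hy).2]
      exact hxy y (hsub i hi hy)

end Frames

/-! ### Dimension from a separating dual family. -/

section DualFamilies

variable {𝕜 V : Type*} [Field 𝕜] [CharZero 𝕜] [AddCommGroup V] [Module 𝕜 V]

lemma finrank_eq_card_of_dual_family [FiniteDimensional 𝕜 V] {ι : Type*} [Fintype ι]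
    [DecidableEq ι] {w : ι → V} {f : ι → Module.Dual 𝕜 V}
    (h : ∀ i j, f i (w j) = if i = j then 1 else 0) (hsep : ∀ x, (∀ i, f i x = 0) → x = 0) :
    Module.finrank 𝕜 V = Fintype.card ι := by
  obtain ⟨hli, hc⟩ := isCompl_of_dual_family h
  have hbot : ⨅ i, LinearMap.ker (f i) = ⊥ := (Submodule.eq_bot_iff _).2 fun x hx =>
    hsep x fun i => LinearMap.mem_ker.1 ((Submodule.mem_iInf _).1 hx i)
  have htop := hc.sup_eq_top
  rw [hbot, sup_bot_eq] at htop
  rw [← finrank_span_eq_card hli, htop, finrank_top]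

end DualFamilies

/-! ### Kernels of the pencil in a frame. -/

section FrameConsequences

variable {𝕜 V : Type*} [Field 𝕜] [CharZero 𝕜] [AddCommGroup V] [Module 𝕜 V]
  {B₁ B₂ : LinearMap.BilinForm 𝕜 V} {ι : Type*} {k : ι → ℕ}

lemma sigma_fin_ext_iff {d : ι → ℕ} (p q : Σ j, Fin (d j)) :
    p.1 = q.1 ∧ (p.2 : ℕ) = q.2 ↔ p = q := by
  refine ⟨fun h => ?_, fun h => h ▸ ⟨rfl, rfl⟩⟩
  obtain ⟨j, i⟩ := p
  obtain ⟨j', i'⟩ := q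
  obtain ⟨h1, h2⟩ := h
  dsimp only at h1 h2
  subst h1
  rw [Fin.ext h2]

namespace KroneckerFrame

open scoped Classical in
lemma coord_vec (F : KroneckerFrame B₁ B₂ k) {j j' : ι} {i i' : ℕ} (hi : i < 2 * k j - 1)
    (hi' : i' < 2 * k j' - 1) : F.coord j i (F.vec j' i') = if j = j' ∧ i = i' then 1 else 0 := by
  split_ifs with h
  · obtain ⟨rfl, rfl⟩ := h
    exact F.coord_self j i hi
  · exact F.coord_ne j i j' i' hi hi' (not_and_or.1 h)

lemma mem_complement (F : KroneckerFrame B₁ B₂ k) {x : V} :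
    x ∈ F.complement ↔ ∀ j i, i < 2 * k j - 1 → F.coord j i x = 0 := by
  rw [complement, Submodule.mem_iInf]
  exact ⟨fun h j i hi => h ⟨j, i, hi⟩, fun h p => h p.1 p.2 p.2.2⟩

lemma mem_complement_of_even_odd (F : KroneckerFrame B₁ B₂ k) {x : V}
    (he : ∀ j s, s < k j → F.coord j (2 * s) x = 0)
    (ho : ∀ j s, s + 1 < k j → F.coord j (2 * s + 1) x = 0) : x ∈ F.complement :=
  F.mem_complement.2 fun j i hi => by
    rcases Nat.even_or_odd' i with ⟨s, rfl | rfl⟩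
    · exact he j s (by omega)
    · exact ho j s (by omega)

theorem finrank_eq [FiniteDimensional 𝕜 V] [Fintype ι] (F : KroneckerFrame B₁ B₂ k) :
    Module.finrank 𝕜 V = ∑ j, (2 * k j - 1) + Module.finrank 𝕜 F.complement := by
  classical
  obtain ⟨hli, hc⟩ := isCompl_of_dual_family
    (w := fun p : Σ j, Fin (2 * k j - 1) => F.vec p.1 p.2) (f := fun p => F.coord p.1 p.2)
    (fun p q => by
      rw [F.coord_vec p.2.2 q.2.2]
      exact if_congr (sigma_fin_ext_iff p q) rfl rfl)
  have := Submodule.finrank_add_eq_of_isCompl hc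
  rw [finrank_span_eq_card hli, Fintype.card_sigma] at this
  simp only [Fintype.card_fin] at this
  exact this.symm

lemma two_vec_zero (F : KroneckerFrame B₁ B₂ k) (h₂ : ∀ x y, B₂ x y = -B₂ y x) (j : ι) : B₂ (F.vec j 0) = 0 :=
  LinearMap.ext fun x => by rw [h₂, F.two_zero, neg_zero]; rfl

lemma one_vec_last (F : KroneckerFrame B₁ B₂ k) (h₁ : ∀ x y, B₁ x y = -B₁ y x) {j : ι} {s : ℕ} (hs : s + 1 = k j) :
    B₁ (F.vec j (2 * s)) = 0 :=
  LinearMap.ext fun x => by rw [h₁, F.one_last x j s hs, neg_zero]; rfl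

lemma one_vec_even (F : KroneckerFrame B₁ B₂ k) (h₁ : ∀ x y, B₁ x y = -B₁ y x) {j : ι} {s : ℕ} (hs : s + 1 < k j) :
    B₁ (F.vec j (2 * s)) = F.coord j (2 * s + 1) :=
  LinearMap.ext fun x => by rw [h₁, F.one_even x j s hs, neg_neg]

lemma two_vec_even (F : KroneckerFrame B₁ B₂ k) (h₂ : ∀ x y, B₂ x y = -B₂ y x) {j : ι} {s : ℕ} (hs : s + 1 < k j) :
    B₂ (F.vec j (2 * (s + 1))) = -F.coord j (2 * s + 1) :=
  LinearMap.ext fun x => by rw [h₂, mul_add, mul_one, F.two_even x j s hs]; rfl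

/-- The element of the kernel of `B₁ + μ • B₂` in the block `j`. -/
def kerVec (F : KroneckerFrame B₁ B₂ k) (μ : 𝕜) (j : ι) : V :=
  ∑ s ∈ Finset.range (k j), μ ^ (k j - 1 - s) • F.vec j (2 * s)

/-- `B₁` of an even vector and `B₂` of the next one are opposite coordinate functionals, so the sum
telescopes. The ends drop out because `B₂` kills the first even vector and `B₁` the last. -/
lemma kerVec_mem (F : KroneckerFrame B₁ B₂ k) (h₁ : ∀ x y, B₁ x y = -B₁ y x) (h₂ : ∀ x y, B₂ x y = -B₂ y x) (μ : 𝕜) (j : ι) :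
    F.kerVec μ j ∈ LinearMap.ker (B₁ + μ • B₂) := by
  obtain ⟨K, hK⟩ := Nat.exists_eq_add_of_le' (F.pos j)
  rw [LinearMap.mem_ker, LinearMap.add_apply, LinearMap.smul_apply, kerVec, hK, map_sum, map_sum,
    Finset.sum_range_succ, Finset.sum_range_succ' (fun s => B₂ _)]
  simp only [map_smul]
  rw [F.one_vec_last h₁ hK.symm, mul_zero, F.two_vec_zero h₂, smul_zero, smul_zero, add_zero,
    add_zero, Finset.smul_sum, ← Finset.sum_add_distrib]
  refine Finset.sum_eq_zero fun s hs => ?_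
  have hs := Finset.mem_range.1 hs
  rw [F.one_vec_even h₁ (by omega), F.two_vec_even h₂ (by omega), smul_smul, ← pow_succ',
    smul_neg, show K + 1 - 1 - (s + 1) + 1 = K + 1 - 1 - s by omega, add_neg_cancel]

-- The coefficient at the last even vector is `μ ^ 0 = 1`, so the kernel vectors of different blocks
-- are independent for every `μ`, including `μ = 0`.
open scoped Classical in
lemma coord_kerVec (F : KroneckerFrame B₁ B₂ k) (μ : 𝕜) (j j' : ι) :
    F.coord j (2 * (k j - 1)) (F.kerVec μ j') = if j = j' then 1 else 0 := by
  have hj := F.pos j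
  have hj' := F.pos j'
  rw [kerVec, map_sum]
  split_ifs with h
  · subst h
    rw [Finset.sum_eq_single (k j - 1)]
    · rw [map_smul, F.coord_self _ _ (by omega), Nat.sub_self, pow_zero, one_smul]
    · intro s hs hne
      have := Finset.mem_range.1 hs
      rw [map_smul, F.coord_ne _ _ _ _ (by omega) (by omega) (Or.inr (by omega)), smul_zero]
    · intro h
      exact absurd (Finset.mem_range.2 (by omega)) h
  · refine Finset.sum_eq_zero fun s hs => ?_
    have := Finset.mem_range.1 hs
    rw [map_smul, F.coord_ne _ _ _ _ (by omega) (by omega) (Or.inl h), smul_zero]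

theorem card_le_finrank_ker [FiniteDimensional 𝕜 V] [Fintype ι] (F : KroneckerFrame B₁ B₂ k)
    (h₁ : ∀ x y, B₁ x y = -B₁ y x) (h₂ : ∀ x y, B₂ x y = -B₂ y x) (μ : 𝕜) :
    Fintype.card ι ≤ Module.finrank 𝕜 (LinearMap.ker (B₁ + μ • B₂)) := by
  classical
  have hli := (isCompl_of_dual_family (w := fun j =>
    (⟨F.kerVec μ j, F.kerVec_mem h₁ h₂ μ j⟩ : LinearMap.ker (B₁ + μ • B₂)))
    (f := fun j => (F.coord j (2 * (k j - 1))).comp (Submodule.subtype _))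
    (fun i j => F.coord_kerVec μ i j)).1
  exact hli.fintype_card_le_finrank

/-- Pair a kernel vector with the frame. The odd vectors determine its even coordinates from the
last one downwards, and the even vectors make its odd coordinates vanish from the first one upwards.
If the last even coordinates vanish too, the vector lies in the complement and is zero. -/
theorem finrank_ker [FiniteDimensional 𝕜 V] [Fintype ι] (F : KroneckerFrame B₁ B₂ k)
    (h₁ : ∀ x y, B₁ x y = -B₁ y x) (h₂ : ∀ x y, B₂ x y = -B₂ y x)
    {μ : 𝕜} (hμ : IsNondegenerateOn B₁ B₂ μ F.complement) :
    Module.finrank 𝕜 (LinearMap.ker (B₁ + μ • B₂)) = Fintype.card ι := by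
  classical
  refine finrank_eq_card_of_dual_family (w := fun j =>
    (⟨F.kerVec μ j, F.kerVec_mem h₁ h₂ μ j⟩ : LinearMap.ker (B₁ + μ • B₂)))
    (f := fun j => (F.coord j (2 * (k j - 1))).comp (Submodule.subtype _))
    (fun i j => F.coord_kerVec μ i j) ?_
  rintro ⟨x, hx⟩ hcx
  have hx' : ∀ y, B₁ x y + μ * B₂ x y = 0 := fun y => LinearMap.congr_fun (LinearMap.mem_ker.1 hx) y
  replace hcx : ∀ j, F.coord j (2 * (k j - 1)) x = 0 := hcx
  refine Subtype.ext (hμ x (F.mem_complement_of_even_odd ?_ ?_) fun y _ => hx' y)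
  · intro j s hs
    obtain ⟨d, hd⟩ := Nat.exists_eq_add_of_lt hs
    induction d generalizing s with
    | zero => rw [← hcx j]; congr 2; omega
    | succ d ih =>
      have e := hx' (F.vec j (2 * s + 1))
      rw [F.one_odd x j s (by omega), F.two_odd x j s (by omega)] at e
      have := ih (s + 1) (by omega) (by omega)
      rw [show 2 * (s + 1) = 2 * s + 2 by ring] at this
      rw [this, neg_zero, mul_zero, add_zero] at e
      exact e
  · intro j s
    induction s with
    | zero =>
      intro hs
      have e := hx' (F.vec j (2 * 0))
      rw [F.one_even x j 0 hs, mul_zero, F.two_zero, mul_zero, add_zero] at e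
      simpa using e
    | succ s ih =>
      intro hs
      have e := hx' (F.vec j (2 * (s + 1)))
      rw [F.one_even x j (s + 1) hs, mul_add, mul_one, F.two_even x j s (by omega),
        ih (by omega), mul_zero, add_zero] at e
      simpa [mul_add] using e

end KroneckerFrame

end FrameConsequences

/-! ### Solutions of the linear recurrence. -/

section Solutions

variable {𝕜 V : Type*} [Field 𝕜] [CharZero 𝕜] [AddCommGroup V] [Module 𝕜 V]
  {B₁ B₂ : LinearMap.BilinForm 𝕜 V} {ι : Type*} {k : ι → ℕ}

/-- Solutions of the linear anchored recurrence. -/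
structure IsSolution (B₁ B₂ : LinearMap.BilinForm 𝕜 V) (a : ℕ → V) : Prop where
  zero : B₁ (a 0) = 0
  succ : ∀ i, B₂ (a i) = -B₁ (a (i + 1))

/-- On a nondegenerate pair the anchored recurrence has only the trivial solution. -/
theorem eq_zero_of_isNondegenerateOn [FiniteDimensional 𝕜 V] {J : Submodule 𝕜 V} {μ : 𝕜}
    (hJ : IsNondegenerateOn B₁ B₂ μ J) {a : ℕ → V} (ha : ∀ i, a i ∈ J)
    (h0 : ∀ y ∈ J, B₁ (a 0) y = 0) (hs : ∀ i, ∀ y ∈ J, B₂ (a i) y = -B₁ (a (i + 1)) y) (i : ℕ) :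
    a i = 0 := by
  let R₁ : J →ₗ[𝕜] Module.Dual 𝕜 J := B₁.restrict J
  let R₂ : J →ₗ[𝕜] Module.Dual 𝕜 J := B₂.restrict J
  let b : ℕ → J := fun i => ⟨a i, ha i⟩
  have hb0 : R₁ (b 0) = 0 := LinearMap.ext fun y => h0 y y.2
  have hbs : ∀ i, R₂ (b i) = -R₁ (b (i + 1)) := fun i => LinearMap.ext fun y => hs i y y.2
  let S := Submodule.span 𝕜 (Set.range b)
  have hQ : Function.Injective (R₁ + μ • R₂) := by
    refine (injective_iff_map_eq_zero _).2 fun x hx => Subtype.ext (hJ x x.2 fun y hy => ?_)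
    exact LinearMap.congr_fun hx ⟨y, hy⟩
  -- The recurrence puts the image of `S` under the injective map `R₁ + μ • R₂` inside `R₁ S`. By
  -- dimension `R₁` is injective on `S`, after which the terms vanish one by one.
  have hle : S.map (R₁ + μ • R₂) ≤ S.map R₁ := by
    rw [Submodule.map_le_iff_le_comap, Submodule.span_le]
    rintro _ ⟨i, rfl⟩
    have h1 : R₁ (b i) ∈ S.map R₁ := ⟨_, Submodule.subset_span ⟨i, rfl⟩, rfl⟩
    have h2 : R₁ (b (i + 1)) ∈ S.map R₁ := ⟨_, Submodule.subset_span ⟨i + 1, rfl⟩, rfl⟩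
    change R₁ (b i) + μ • R₂ (b i) ∈ S.map R₁
    rw [hbs]
    exact Submodule.add_mem _ h1 (Submodule.smul_mem _ _ (Submodule.neg_mem _ h2))
  have hdim : Module.finrank 𝕜 S ≤ Module.finrank 𝕜 (S.map R₁) := by
    rw [(Submodule.equivMapOfInjective _ hQ S).finrank_eq]
    exact Submodule.finrank_mono hle
  have hinj : ∀ x ∈ S, R₁ x = 0 → x = 0 := by
    have h1 := LinearMap.finrank_range_add_finrank_ker (R₁.domRestrict S)
    rw [LinearMap.range_domRestrict] at h1
    have h2 : LinearMap.ker (R₁.domRestrict S) = ⊥ := Submodule.finrank_eq_zero.1 (by omega)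
    exact fun x hx hx0 => congrArg Subtype.val
      ((Submodule.eq_bot_iff _).1 h2 ⟨x, hx⟩ (LinearMap.mem_ker.2 hx0))
  have hb : ∀ i, b i = 0 := fun i => by
    induction i with
    | zero => exact hinj _ (Submodule.subset_span ⟨0, rfl⟩) hb0
    | succ i ih =>
      refine hinj _ (Submodule.subset_span ⟨i + 1, rfl⟩) ?_
      rw [← neg_eq_zero, ← hbs, ih, map_zero]
  exact congrArg Subtype.val (hb i)

namespace KroneckerFrame

/-- The recurrence moves odd coordinates up the block. They start as zeros because `B₁ (a 0) = 0`,
and only zeros enter from below because `B₂` kills the first vector. -/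
lemma coord_odd_solution (F : KroneckerFrame B₁ B₂ k) {a : ℕ → V} (ha : IsSolution B₁ B₂ a)
    (i : ℕ) (j : ι) (s : ℕ) (hs : s + 1 < k j) : F.coord j (2 * s + 1) (a i) = 0 := by
  induction i generalizing s with
  | zero => rw [← neg_eq_zero, ← F.one_even _ j s hs, ha.zero]; rfl
  | succ i ih =>
    rw [← neg_eq_zero, ← F.one_even _ j s hs, ← neg_eq_zero, ← LinearMap.neg_apply, ← ha.succ]
    rcases s with _ | s
    · exact F.two_zero _ j
    · rw [mul_add, mul_one, F.two_even _ j s (by omega)]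
      exact ih s (by omega)

/-- In even coordinates the recurrence is a shift towards the first vector; it does not constrain
the last even coordinate of the new term. -/
lemma coord_even_solution (F : KroneckerFrame B₁ B₂ k) {a : ℕ → V} (ha : IsSolution B₁ B₂ a)
    (i : ℕ) (j : ι) (s : ℕ) (hs : s + 1 < k j) :
    F.coord j (2 * s) (a (i + 1)) = F.coord j (2 * (s + 1)) (a i) := by
  rw [← F.one_odd _ j s hs, ← neg_inj, ← LinearMap.neg_apply, ← ha.succ, F.two_odd _ j s hs,
    mul_add, mul_one]

lemma coord_even_solution_zero (F : KroneckerFrame B₁ B₂ k) {a : ℕ → V} (ha : IsSolution B₁ B₂ a)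
    (j : ι) (s : ℕ) (hs : s + 1 < k j) : F.coord j (2 * s) (a 0) = 0 := by
  rw [← F.one_odd _ j s hs, ha.zero]; rfl

/-- The span of the even basis vectors of a frame. -/
def evenSpan (F : KroneckerFrame B₁ B₂ k) : Submodule 𝕜 V :=
  Submodule.span 𝕜 (Set.range fun p : Σ j, Fin (k j) => F.vec p.1 (2 * p.2))

lemma vec_mem_evenSpan (F : KroneckerFrame B₁ B₂ k) (j : ι) {s : ℕ} (hs : s < k j) :
    F.vec j (2 * s) ∈ F.evenSpan :=
  Submodule.subset_span ⟨⟨j, s, hs⟩, rfl⟩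

theorem finrank_evenSpan [Fintype ι] (F : KroneckerFrame B₁ B₂ k) :
    Module.finrank 𝕜 F.evenSpan = ∑ j, k j := by
  classical
  obtain ⟨hli, -⟩ := isCompl_of_dual_family
    (w := fun p : Σ j, Fin (k j) => F.vec p.1 (2 * p.2)) (f := fun p => F.coord p.1 (2 * p.2))
    (fun p q => by
      have := p.2.2
      have := q.2.2
      rw [F.coord_vec (by omega) (by omega)]
      exact if_congr ((and_congr_right fun _ => by omega).trans (sigma_fin_ext_iff p q)) rfl rfl)
  rw [evenSpan, finrank_span_eq_card hli, Fintype.card_sigma]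
  simp

/-- Solutions take values in the span of the even basis vectors. -/
theorem solution_mem_evenSpan [FiniteDimensional 𝕜 V] [Fintype ι] (F : KroneckerFrame B₁ B₂ k)
    (h₁ : ∀ x y, B₁ x y = -B₁ y x) (h₂ : ∀ x y, B₂ x y = -B₂ y x) {μ : 𝕜}
    (hμ : IsNondegenerateOn B₁ B₂ μ F.complement) {a : ℕ → V} (ha : IsSolution B₁ B₂ a) (i : ℕ) :
    a i ∈ F.evenSpan := by
  classical
  let e : ℕ → V := fun i => ∑ p : Σ j, Fin (k j), F.coord p.1 (2 * p.2) (a i) • F.vec p.1 (2 * p.2)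
  have he : ∀ i, e i ∈ F.evenSpan := fun i =>
    Submodule.sum_mem _ fun p _ => Submodule.smul_mem _ _ (F.vec_mem_evenSpan p.1 p.2.2)
  have hcompl : ∀ i, a i - e i ∈ F.complement := fun i => by
    refine F.mem_complement_of_even_odd (fun j s hs => ?_) fun j s hs => ?_
    · rw [map_sub, map_sum, Finset.sum_eq_single ⟨j, ⟨s, hs⟩⟩, map_smul,
        F.coord_self _ _ (by simpa using by omega), smul_eq_mul, mul_one, sub_self]
      · intro p _ hp
        have := p.2.2
        rw [map_smul, F.coord_ne _ _ _ _ (by omega) (by omega), smul_zero]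
        by_contra hcon
        simp only [not_or, not_not] at hcon
        exact hp ((sigma_fin_ext_iff _ _).1 ⟨hcon.1.symm, by simpa using hcon.2.symm⟩)
      · simp
    · rw [map_sub, F.coord_odd_solution ha i j s hs, map_sum, Finset.sum_eq_zero, sub_zero]
      intro p _
      have := p.2.2
      rw [map_smul, F.coord_ne _ _ _ _ (by omega) (by omega) (Or.inr (by omega)), smul_zero]
  have horth : ∀ x ∈ F.evenSpan, ∀ y ∈ F.complement, B₁ x y = 0 ∧ B₂ x y = 0 := by
    intro x hx y hy
    rw [F.mem_complement] at hy
    induction hx using Submodule.span_induction with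
    | mem x hx =>
      obtain ⟨⟨j, s, hs⟩, rfl⟩ := hx
      dsimp only
      constructor
      · by_cases h : s + 1 < k j
        · rw [F.one_vec_even h₁ h]
          exact hy j _ (by omega)
        · rw [F.one_vec_last h₁ (by omega)]; rfl
      · rcases s with _ | s
        · rw [mul_zero, F.two_vec_zero h₂]; rfl
        · rw [F.two_vec_even h₂ hs, LinearMap.neg_apply, hy j _ (by omega), neg_zero]
    | zero => simp
    | add x x' _ _ hx hx' => simp [hx, hx']
    | smul c x _ hx => simp [hx]
  -- The even vectors are orthogonal to the complement, so the differences still solve the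
  -- recurrence there, and they vanish by nondegeneracy.
  have hzero := eq_zero_of_isNondegenerateOn hμ (a := fun i => a i - e i) hcompl
    (fun y hy => by
      rw [map_sub, LinearMap.sub_apply, ha.zero, (horth _ (he 0) y hy).1, sub_zero]; rfl)
    (fun i y hy => by
      rw [map_sub, LinearMap.sub_apply, map_sub, LinearMap.sub_apply, ha.succ,
        (horth _ (he i) y hy).2, (horth _ (he (i + 1)) y hy).1, sub_zero, sub_zero]; rfl) i
  rw [sub_eq_zero.1 hzero]
  exact he i

/-- A subspace that contains the kernel of `B₁` and on which the recurrence can be continued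
contains the even basis vectors. -/
theorem evenSpan_le (F : KroneckerFrame B₁ B₂ k) (h₁ : ∀ x y, B₁ x y = -B₁ y x)
    (h₂ : ∀ x y, B₂ x y = -B₂ y x) {L : Submodule 𝕜 V} (hker : LinearMap.ker B₁ ≤ L)
    (hL : ∀ y ∈ L, ∃ y' ∈ L, B₂ y = -B₁ y') : F.evenSpan ≤ L := by
  -- Induction from the last even vector, which lies in `ker B₁`, downwards: the recurrence
  -- determines each even vector from the next one up to `ker B₁`.
  have h : ∀ d j s, s + 1 + d = k j → F.vec j (2 * s) ∈ L := fun d => by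
    induction d with
    | zero => exact fun j s hs => hker (LinearMap.mem_ker.2 (F.one_vec_last h₁ hs))
    | succ d ih =>
      intro j s hs
      obtain ⟨y, hy, hy'⟩ := hL _ (ih j (s + 1) (by omega))
      rw [F.two_vec_even h₂ (by omega), ← F.one_vec_even h₁ (by omega), neg_inj] at hy'
      have : F.vec j (2 * s) - y ∈ L := hker (by rw [LinearMap.mem_ker, map_sub, hy', sub_self])
      simpa using Submodule.add_mem _ this hy
  rw [evenSpan, Submodule.span_le]
  rintro _ ⟨⟨j, s, hs⟩, rfl⟩
  exact h (k j - (s + 1)) j s (by omega)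

end KroneckerFrame

end Solutions

/-! ### The number of Kronecker blocks and dimension counts. -/

section Counting

variable {𝕜 V : Type*} [Field 𝕜] [CharZero 𝕜] [AddCommGroup V] [Module 𝕜 V]
  [FiniteDimensional 𝕜 V] {B₁ B₂ : LinearMap.BilinForm 𝕜 V}

lemma exists_isNondegenerateOn {J : Submodule 𝕜 V}
    (h : {μ | ¬ IsNondegenerateOn B₁ B₂ μ J}.Finite) : ∃ μ, IsNondegenerateOn B₁ B₂ μ J := by
  obtain ⟨μ, hμ⟩ := h.infinite_compl.nonempty
  exact ⟨μ, not_not.1 hμ⟩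

/-- The number of Kronecker blocks is the least corank in the pencil, a quantity that does not
depend on the decomposition. This makes `kroneckerCount` computable from any decomposition and,
later, semicontinuous. -/
theorem IsBlockDecomposition.ncard_le_finrank_ker
    (h₁ : ∀ x y, B₁ x y = -B₁ y x) (h₂ : ∀ x y, B₂ x y = -B₂ y x) {l : ℕ}
    {W : Fin l → Submodule 𝕜 V} (D : IsBlockDecomposition B₁ B₂ W) :
    (∀ μ : 𝕜, {i | IsKroneckerBlock B₁ B₂ (W i)}.ncard ≤
      Module.finrank 𝕜 (LinearMap.ker (B₁ + μ • B₂))) ∧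
    ∃ μ : 𝕜, Module.finrank 𝕜 (LinearMap.ker (B₁ + μ • B₂)) =
      {i | IsKroneckerBlock B₁ B₂ (W i)}.ncard := by
  classical
  obtain ⟨k, F, -, -, hfin⟩ := D.exists_frame h₁ h₂
  have hc : {i | IsKroneckerBlock B₁ B₂ (W i)}.ncard =
      Fintype.card {i // IsKroneckerBlock B₁ B₂ (W i)} := by
    rw [← Nat.card_eq_fintype_card]; rfl
  rw [hc]
  obtain ⟨μ, hμ⟩ := exists_isNondegenerateOn hfin
  exact ⟨F.card_le_finrank_ker h₁ h₂, μ, F.finrank_ker h₁ h₂ hμ⟩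

theorem IsBlockDecomposition.kroneckerCount_eq
    (h₁ : ∀ x y, B₁ x y = -B₁ y x) (h₂ : ∀ x y, B₂ x y = -B₂ y x) {l : ℕ}
    {W : Fin l → Submodule 𝕜 V} (D : IsBlockDecomposition B₁ B₂ W) :
    kroneckerCount B₁ B₂ = {i | IsKroneckerBlock B₁ B₂ (W i)}.ncard := by
  have h : {r | ∃ (l : ℕ) (W : Fin l → Submodule 𝕜 V), IsBlockDecomposition B₁ B₂ W ∧
      r = {i | IsKroneckerBlock B₁ B₂ (W i)}.ncard} =
      {{i | IsKroneckerBlock B₁ B₂ (W i)}.ncard} := by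
    refine Set.eq_singleton_iff_unique_mem.2 ⟨⟨l, W, D, rfl⟩, ?_⟩
    rintro _ ⟨l', W', D', rfl⟩
    obtain ⟨hD, μ, hμ⟩ := D.ncard_le_finrank_ker h₁ h₂
    obtain ⟨hD', μ', hμ'⟩ := D'.ncard_le_finrank_ker h₁ h₂
    exact le_antisymm (hμ ▸ hD' μ) (hμ' ▸ hD μ')
  rw [kroneckerCount, h, csInf_singleton]

theorem kroneckerCount_le_finrank_ker
    (h₁ : ∀ x y, B₁ x y = -B₁ y x) (h₂ : ∀ x y, B₂ x y = -B₂ y x) (μ : 𝕜) :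
    kroneckerCount B₁ B₂ ≤ Module.finrank 𝕜 (LinearMap.ker (B₁ + μ • B₂)) := by
  obtain ⟨l, W, D⟩ := exists_isBlockDecomposition B₁ B₂
  rw [D.kroneckerCount_eq h₁ h₂]
  exact (D.ncard_le_finrank_ker h₁ h₂).1 μ

theorem exists_finrank_ker_eq_kroneckerCount
    (h₁ : ∀ x y, B₁ x y = -B₁ y x) (h₂ : ∀ x y, B₂ x y = -B₂ y x) :
    ∃ μ : 𝕜, Module.finrank 𝕜 (LinearMap.ker (B₁ + μ • B₂)) = kroneckerCount B₁ B₂ := by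
  obtain ⟨l, W, D⟩ := exists_isBlockDecomposition B₁ B₂
  rw [D.kroneckerCount_eq h₁ h₂]
  exact (D.ncard_le_finrank_ker h₁ h₂).2

/-- If solutions of the anchored recurrence span a space whose dimension is at least the action
dimension, then all blocks are Kronecker blocks. -/
theorem IsBlockDecomposition.isKroneckerBlock_of_solutions
    (h₁ : ∀ x y, B₁ x y = -B₁ y x) (h₂ : ∀ x y, B₂ x y = -B₂ y x) {l : ℕ}
    {W : Fin l → Submodule 𝕜 V} (D : IsBlockDecomposition B₁ B₂ W) {L : Submodule 𝕜 V}
    (hL : ∀ S : Submodule 𝕜 V, (∀ a, IsSolution B₁ B₂ a → ∀ i, a i ∈ S) → L ≤ S)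
    (hdim : linearActionDim B₁ B₂ ≤ Module.finrank 𝕜 L) (i : Fin l) :
    IsKroneckerBlock B₁ B₂ (W i) := by
  classical
  obtain ⟨k, F, -, hJ, hfin⟩ := D.exists_frame h₁ h₂
  obtain ⟨μ, hμ⟩ := exists_isNondegenerateOn hfin
  have hLe : Module.finrank 𝕜 L ≤ ∑ j, k j := by
    rw [← F.finrank_evenSpan]
    exact Submodule.finrank_mono (hL _ fun a ha i => F.solution_mem_evenSpan h₁ h₂ hμ ha i)
  have hcard : kroneckerCount B₁ B₂ = Fintype.card {i // IsKroneckerBlock B₁ B₂ (W i)} := by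
    rw [D.kroneckerCount_eq h₁ h₂, ← Nat.card_eq_fintype_card]; rfl
  have hsum : ∑ j, (2 * k j - 1) + Fintype.card {i // IsKroneckerBlock B₁ B₂ (W i)} =
      2 * ∑ j, k j := by
    rw [← Finset.card_univ, Finset.card_eq_sum_ones, ← Finset.sum_add_distrib, Finset.mul_sum]
    exact Finset.sum_congr rfl fun j _ => by have := F.pos j; omega
  have hN := F.finrank_eq
  -- The action dimension is `∑ j, k j` plus half the dimension of the complement. As this dimension
  -- is even, the division by two loses nothing, and the bound on `L` forces it to vanish.
  have hodd : ¬ Odd (Module.finrank 𝕜 F.complement) := fun h =>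
    not_isNondegenerateOn_of_odd h₁ h₂ h μ hμ
  have hJ0 : Module.finrank 𝕜 F.complement = 0 := by
    rw [linearActionDim] at hdim
    rw [Nat.odd_iff] at hodd
    omega
  by_contra hi
  refine (D.indecomposable i).1 (le_bot_iff.1 ?_)
  rw [← Submodule.finrank_eq_zero.1 hJ0]
  exact hJ i hi

/-- Indecomposable blocks of odd dimension are Kronecker blocks. -/
theorem IsIndecomposable.isKroneckerBlock_of_odd
    (h₁ : ∀ x y, B₁ x y = -B₁ y x) (h₂ : ∀ x y, B₂ x y = -B₂ y x) {W : Submodule 𝕜 V}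
    (hW : IsIndecomposable B₁ B₂ W) (hodd : Odd (Module.finrank 𝕜 W)) :
    IsKroneckerBlock B₁ B₂ W :=
  hW.isKroneckerBlock h₁ h₂ <| by
    rw [Set.eq_univ_of_forall (s := {μ | ¬ IsNondegenerateOn B₁ B₂ μ W})
      (not_isNondegenerateOn_of_odd h₁ h₂ hodd)]
    exact Set.infinite_univ

/-- If all blocks are Kronecker blocks, then they admit a frame with zero complement. -/
theorem IsBlockDecomposition.exists_frame_of_kronecker
    (h₁ : ∀ x y, B₁ x y = -B₁ y x) (h₂ : ∀ x y, B₂ x y = -B₂ y x) {l : ℕ}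
    {W : Fin l → Submodule 𝕜 V} (D : IsBlockDecomposition B₁ B₂ W)
    (hW : ∀ i, IsKroneckerBlock B₁ B₂ (W i)) :
    ∃ (k : Fin l → ℕ) (F : KroneckerFrame B₁ B₂ k),
      (∀ i, Module.finrank 𝕜 (W i) = 2 * k i - 1) ∧ F.complement = ⊥ := by
  classical
  obtain ⟨k, F, hk, -, hfin⟩ := D.exists_frame h₁ h₂
  let F' : KroneckerFrame B₁ B₂ (fun i => k ⟨i, hW i⟩) :=
    { vec := fun i => F.vec ⟨i, hW i⟩
      coord := fun i => F.coord ⟨i, hW i⟩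
      pos := fun i => F.pos _
      coord_self := fun i => F.coord_self _
      coord_ne := fun j i j' i' hi hi' h => F.coord_ne _ _ _ _ hi hi' <|
        h.imp_left fun hne heq => hne (congrArg Subtype.val heq)
      one_odd := fun x j => F.one_odd x _
      one_even := fun x j => F.one_even x _
      one_last := fun x j => F.one_last x _
      two_odd := fun x j => F.two_odd x _
      two_even := fun x j => F.two_even x _
      two_zero := fun x j => F.two_zero x _ }
  refine ⟨_, F', fun i => hk ⟨i, hW i⟩, Submodule.finrank_eq_zero.1 ?_⟩
  have hN := F'.finrank_eq
  have hV : Module.finrank 𝕜 V = ∑ i, Module.finrank 𝕜 (W i) := by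
    have hint := (DirectSum.isInternal_submodule_iff_iSupIndep_and_iSup_eq_top W).2
      ⟨D.independent, D.span⟩
    rw [Module.finrank_eq_card_basis (hint.collectedBasis fun i => Module.finBasis 𝕜 (W i))]
    simp
  simp only [fun i => hk ⟨i, hW i⟩] at hV
  omega

end Counting

/-! ### Finite solutions and block sizes. -/

section PolynomialSolutions

variable {𝕜 V Z : Type*} [Field 𝕜] [CharZero 𝕜] [AddCommGroup V] [Module 𝕜 V]
  [AddCommGroup Z] [Module 𝕜 Z]

/-- Extension of a finite sequence by zero. -/
def extendZero (𝕜 V : Type*) [Field 𝕜] [AddCommGroup V] [Module 𝕜 V] (n : ℕ) :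
    (Fin n → V) →ₗ[𝕜] ℕ → V :=
  LinearMap.pi fun i => if h : i < n then LinearMap.proj ⟨i, h⟩ else 0

lemma extendZero_of_lt {n i : ℕ} (h : i < n) (a : Fin n → V) :
    extendZero 𝕜 V n a i = a ⟨i, h⟩ := by
  rw [extendZero, LinearMap.pi_apply, dif_pos h]; rfl

lemma extendZero_of_le {n i : ℕ} (h : n ≤ i) (a : Fin n → V) : extendZero 𝕜 V n a i = 0 := by
  rw [extendZero, LinearMap.pi_apply, dif_neg (by omega)]; rfl

/-- The operator whose kernel consists of the finite solutions of the recurrence. -/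
def recurrenceMap (R₁ R₂ : V →ₗ[𝕜] Z) (n : ℕ) : (Fin n → V) →ₗ[𝕜] Fin (n + 1) → Z :=
  LinearMap.pi fun i => R₁ ∘ₗ LinearMap.proj (i : ℕ) ∘ₗ extendZero 𝕜 V n +
    if (i : ℕ) = 0 then 0 else R₂ ∘ₗ LinearMap.proj ((i : ℕ) - 1) ∘ₗ extendZero 𝕜 V n

/-- There are `n + 1` equations for `n` terms: the last one says that `R₂` kills the last term, so
the extension by zero solves the infinite recurrence. -/
lemma mem_ker_recurrenceMap {R₁ R₂ : V →ₗ[𝕜] Z} {n : ℕ} {a : Fin n → V} :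
    a ∈ LinearMap.ker (recurrenceMap R₁ R₂ n) ↔ R₁ (extendZero 𝕜 V n a 0) = 0 ∧
      ∀ i, R₂ (extendZero 𝕜 V n a i) = -R₁ (extendZero 𝕜 V n a (i + 1)) := by
  have h : a ∈ LinearMap.ker (recurrenceMap R₁ R₂ n) ↔ ∀ i : Fin (n + 1),
      R₁ (extendZero 𝕜 V n a i) + (if (i : ℕ) = 0 then (0 : V →ₗ[𝕜] Z) else
        R₂) (extendZero 𝕜 V n a (i - 1)) = 0 := by
    rw [LinearMap.mem_ker, funext_iff]
    refine forall_congr' fun i => ?_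
    rw [recurrenceMap, LinearMap.pi_apply]
    split_ifs <;> rfl
  rw [h]
  constructor
  · refine fun h => ⟨by simpa using h 0, fun i => ?_⟩
    rcases lt_or_ge i n with hi | hi
    · have := h ⟨i + 1, by omega⟩
      simp only [Nat.add_one_ne_zero, if_false, add_tsub_cancel_right] at this
      exact eq_neg_of_add_eq_zero_right this
    · rw [extendZero_of_le hi, extendZero_of_le (by omega), map_zero, map_zero, neg_zero]
  · rintro ⟨h0, hs⟩ ⟨i, hi⟩
    rcases i with _ | i
    · simpa using h0
    · simp only [Nat.add_one_ne_zero, if_false, add_tsub_cancel_right]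
      rw [hs, add_neg_cancel]

variable {B₁ B₂ : LinearMap.BilinForm 𝕜 V} {ι : Type*} {k : ι → ℕ}

/-- The number of finite solutions of given length in terms of the sizes of the Kronecker
blocks. -/
theorem KroneckerFrame.finrank_ker_recurrenceMap [FiniteDimensional 𝕜 V] [Fintype ι]
    (F : KroneckerFrame B₁ B₂ k)
    (h₁ : ∀ x y, B₁ x y = -B₁ y x) (h₂ : ∀ x y, B₂ x y = -B₂ y x) (hF : F.complement = ⊥)
    (n : ℕ) : Module.finrank 𝕜 (LinearMap.ker (recurrenceMap B₁ B₂ n)) = ∑ j, (n + 1 - k j) := by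
  classical
  -- A basis of the finite solutions: starting at index `p.2`, run through the even vectors of a
  -- block from the last, killed by `B₁`, to the first, killed by `B₂`. This takes `k j` places out
  -- of `n` and leaves `n + 1 - k j` possible starts.
  let e : (Σ j, Fin (n + 1 - k j)) → ℕ → V := fun p i =>
    if (p.2 : ℕ) ≤ i ∧ i ≤ p.2 + (k p.1 - 1) then F.vec p.1 (2 * (k p.1 - 1 - (i - p.2))) else 0
  let e' : (Σ j, Fin (n + 1 - k j)) → Fin n → V := fun p i => e p i
  have hee : ∀ p i, extendZero 𝕜 V n (e' p) i = e p i := fun p i => by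
    rcases lt_or_ge i n with hi | hi
    · rw [extendZero_of_lt hi]
    · have := p.2.2
      have := F.pos p.1
      rw [extendZero_of_le hi]
      exact (if_neg (by omega)).symm
  have he : ∀ p, e' p ∈ LinearMap.ker (recurrenceMap B₁ B₂ n) := fun p => by
    have hk := F.pos p.1
    rw [mem_ker_recurrenceMap]
    simp only [hee]
    constructor
    · by_cases h : (p.2 : ℕ) = 0
      · simp only [e, h]
        rw [if_pos (by omega)]
        exact F.one_vec_last h₁ (by omega)
      · simp only [e]
        rw [if_neg (by omega), map_zero]
    · intro i
      simp only [e]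
      by_cases hlo : (p.2 : ℕ) ≤ i
      · rcases lt_trichotomy i (p.2 + (k p.1 - 1)) with hi | hi | hi
        · rw [if_pos (by omega), if_pos (by omega), show k p.1 - 1 - (i - p.2) =
            (k p.1 - 1 - (i + 1 - p.2)) + 1 by omega, F.two_vec_even h₂ (by omega),
            F.one_vec_even h₁ (by omega)]
        · rw [if_pos (by omega), if_neg (by omega), show k p.1 - 1 - (i - p.2) = 0 by omega,
            mul_zero, F.two_vec_zero h₂, map_zero, neg_zero]
        · rw [if_neg (by omega), if_neg (by omega), map_zero, map_zero, neg_zero]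
      · rw [if_neg (by omega), map_zero]
        by_cases hi : (p.2 : ℕ) = i + 1
        · rw [if_pos (by omega), F.one_vec_last h₁ (by omega), neg_zero]
        · rw [if_neg (by omega), map_zero, neg_zero]
  -- The dual functionals read the last even coordinate at the starting index; a basis solution has
  -- such a coordinate only there.
  rw [finrank_eq_card_of_dual_family (w := fun p =>
      (⟨e' p, he p⟩ : LinearMap.ker (recurrenceMap B₁ B₂ n)))
    (f := fun p => F.coord p.1 (2 * (k p.1 - 1)) ∘ₗ LinearMap.proj (p.2 : ℕ) ∘ₗ extendZero 𝕜 V n ∘ₗ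
      Submodule.subtype _), Fintype.card_sigma]
  · simp
  · intro p q
    have hp := F.pos p.1
    have hq := F.pos q.1
    change F.coord p.1 (2 * (k p.1 - 1)) (extendZero 𝕜 V n (e' q) p.2) = _
    rw [hee]
    simp only [e]
    by_cases h : (q.2 : ℕ) ≤ p.2 ∧ (p.2 : ℕ) ≤ q.2 + (k q.1 - 1)
    · rw [if_pos h, F.coord_vec (by omega) (by omega)]
      refine if_congr (Iff.trans ?_ (sigma_fin_ext_iff p q)) rfl rfl
      refine and_congr_right fun hpq => ?_
      have hkk : k p.1 = k q.1 := congrArg k hpq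
      have : k q.1 - 1 ≥ (p.2 : ℕ) - q.2 := by omega
      omega
    · rw [if_neg h, map_zero, if_neg]
      rintro rfl
      exact h ⟨le_rfl, by omega⟩
  · rintro ⟨a, ha⟩ hz
    have hz' : ∀ j m, m < n + 1 - k j → F.coord j (2 * (k j - 1)) (extendZero 𝕜 V n a m) = 0 :=
      fun j m hm => hz ⟨j, m, hm⟩
    obtain ⟨ha0, has⟩ := mem_ker_recurrenceMap.1 ha
    have hsol : IsSolution B₁ B₂ (extendZero 𝕜 V n a) := ⟨ha0, has⟩
    have hshift : ∀ j d s i, s + d < k j →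
        F.coord j (2 * s) (extendZero 𝕜 V n a (i + d)) =
          F.coord j (2 * (s + d)) (extendZero 𝕜 V n a i) := fun j d => by
      induction d with
      | zero => exact fun s i _ => rfl
      | succ d ih =>
        intro s i hs
        rw [← add_assoc, F.coord_even_solution hsol _ _ _ (by omega), ih (s + 1) i (by omega)]
        congr 3; omega
    -- For a start too late to fit, the last even coordinate would travel down the block into a term
    -- beyond the end, which is zero.
    have hz2 : ∀ j m, F.coord j (2 * (k j - 1)) (extendZero 𝕜 V n a m) = 0 := fun j m => by
      have := F.pos j
      rcases lt_or_ge m (n + 1 - k j) with hm | hm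
      · exact hz' j m hm
      · have := hshift j (k j - 1) 0 m (by omega)
        rw [zero_add, extendZero_of_le (by omega), map_zero] at this
        exact this.symm
    have hall : ∀ i, extendZero 𝕜 V n a i = 0 := fun i => by
      have hmem : extendZero 𝕜 V n a i ∈ F.complement := by
        refine F.mem_complement_of_even_odd (fun j s hs => ?_)
          fun j s hs => F.coord_odd_solution hsol i j s hs
        rcases le_or_gt (k j - 1 - s) i with hi | hi
        · obtain ⟨c, rfl⟩ := Nat.exists_eq_add_of_le' hi
          rw [hshift j _ s c (by omega), show s + (k j - 1 - s) = k j - 1 by omega]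
          exact hz2 j c
        · have := hshift j i s 0 (by omega)
          rw [zero_add] at this
          rw [this]
          exact F.coord_even_solution_zero hsol j _ (by omega)
      rw [hF] at hmem
      exact (Submodule.mem_bot 𝕜).1 hmem
    refine Subtype.ext (funext fun i => ?_)
    have := hall i
    rwa [extendZero_of_lt i.2] at this

end PolynomialSolutions

/-- The numbers `∑ j, (n + 1 - k_j)` determine the positive numbers `k_j`. -/
theorem exists_equiv_of_sum_eq {l l' : ℕ} {k : Fin l → ℕ} {k' : Fin l' → ℕ} {N : ℕ}
    (hk : ∀ j, 1 ≤ k j ∧ k j ≤ N) (hk' : ∀ j, 1 ≤ k' j ∧ k' j ≤ N)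
    (h : ∀ n ≤ N, ∑ j, (n + 1 - k j) = ∑ j, (n + 1 - k' j)) :
    ∃ σ : Fin l ≃ Fin l', ∀ j, k j = k' (σ j) := by
  -- The second difference of `c ↦ (c - q)⁺` is the indicator of `c = q`. It is written additively
  -- because subtraction truncates.
  have hcount : ∀ {p : ℕ} (q : Fin p → ℕ), (∀ j, 1 ≤ q j) → ∀ c, 1 ≤ c →
      (Finset.univ.filter fun j => q j = c).card + 2 * ∑ j, (c - q j) =
        ∑ j, (c + 1 - q j) + ∑ j, (c - 1 - q j) := by
    intro p q hq c hc
    rw [Finset.card_filter, Finset.mul_sum, ← Finset.sum_add_distrib, ← Finset.sum_add_distrib]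
    refine Finset.sum_congr rfl fun j _ => ?_
    have := hq j
    split_ifs <;> omega
  have hs : ∀ n ≤ N + 1, ∑ j, (n - k j) = ∑ j, (n - k' j) := fun n hn => by
    rcases n with _ | n
    · simp
    · exact h n (by omega)
  have hcard : ∀ c, Fintype.card {j // k j = c} = Fintype.card {j // k' j = c} := fun c => by
    rw [Fintype.card_subtype, Fintype.card_subtype]
    by_cases hc : 1 ≤ c ∧ c ≤ N
    · have e1 := hcount k (fun j => (hk j).1) c hc.1
      have e2 := hcount k' (fun j => (hk' j).1) c hc.1
      rw [hs c (by omega), hs (c + 1) (by omega), hs (c - 1) (by omega)] at e1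
      omega
    · rw [Finset.filter_false_of_mem fun j _ => by have := hk j; omega,
        Finset.filter_false_of_mem fun j _ => by have := hk' j; omega]
      rfl
  refine ⟨Equiv.ofFiberEquiv fun c => Fintype.equivOfCardEq (hcard c), fun j => ?_⟩
  exact (Equiv.ofFiberEquiv_map _ j).symm

/-! ### Initial segments of solutions as bases. -/

section Pivots

variable {𝕜 V : Type*} [Field 𝕜] [AddCommGroup V] [Module 𝕜 V]

/-- The vector `v p` is not a combination of the vectors of smaller rank. -/
def IsPivot (𝕜 : Type*) {V : Type*} [Field 𝕜] [AddCommGroup V] [Module 𝕜 V] {I : Type*}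
    (ρ : I → ℕ) (v : I → V) (p : I) : Prop :=
  v p ∉ Submodule.span 𝕜 (v '' {q | ρ q < ρ p})

/-- In a nontrivial relation the term of highest rank would be a combination of vectors of smaller
rank. -/
lemma linearIndependent_pivots {I : Type*} {ρ : I → ℕ} (hρ : Function.Injective ρ) (v : I → V) :
    LinearIndependent 𝕜 fun p : {p // IsPivot 𝕜 ρ v p} => v p := by
  classical
  rw [linearIndependent_iff']
  intro s c hc p hp
  by_contra hcp
  obtain ⟨q, hq, hmax⟩ := (s.filter fun q => c q ≠ 0).exists_max_image (fun q => ρ q)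
    ⟨p, Finset.mem_filter.2 ⟨hp, hcp⟩⟩
  obtain ⟨hqs, hcq⟩ := Finset.mem_filter.1 hq
  refine q.2 ?_
  rw [← Finset.add_sum_erase _ _ hqs] at hc
  rw [← inv_smul_smul₀ hcq (v q), eq_neg_of_add_eq_zero_left hc]
  refine Submodule.smul_mem _ _ (Submodule.neg_mem _ (Submodule.sum_mem _ fun j hj => ?_))
  obtain ⟨hjq, hjs⟩ := Finset.mem_erase.1 hj
  by_cases hcj : c j = 0
  · rw [hcj, zero_smul]; exact Submodule.zero_mem _
  · refine Submodule.smul_mem _ _ (Submodule.subset_span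
      ⟨j, show ρ j < ρ q from lt_of_le_of_ne ?_ ?_, rfl⟩)
    · exact hmax j (Finset.mem_filter.2 ⟨hjs, hcj⟩)
    · exact fun h => hjq (Subtype.ext (hρ h))

lemma mem_span_pivots {I : Type*} (ρ : I → ℕ) (v : I → V) (p : I) :
    v p ∈ Submodule.span 𝕜 (v '' {q | IsPivot 𝕜 ρ v q}) := by
  induction hd : ρ p using Nat.strong_induction_on generalizing p with
  | _ d ih =>
    by_cases hp : IsPivot 𝕜 ρ v p
    · exact Submodule.subset_span ⟨p, hp, rfl⟩
    · refine Submodule.span_le.2 ?_ (not_not.1 hp)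
      rintro _ ⟨q, hq, rfl⟩
      exact ih _ (hd ▸ hq) q rfl

/-- Solutions of the anchored recurrence whose initial terms form a basis of the kernel have
initial segments that form a basis of the span of all terms. -/
theorem exists_basis_of_solutions [FiniteDimensional 𝕜 V] {B₁ B₂ : LinearMap.BilinForm 𝕜 V} {r : ℕ}
    {a : Fin r → ℕ → V} (ha : ∀ t i, B₂ (a t i) = -B₁ (a t (i + 1)))
    (hli : LinearIndependent 𝕜 fun t => a t 0)
    (hker : LinearMap.ker B₁ ≤ Submodule.span 𝕜 (Set.range fun t => a t 0)) :
    ∃ k : Fin r → ℕ, LinearIndependent 𝕜 (fun p : Σ t, Fin (k t + 1) => a p.1 p.2) ∧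
      ∀ t i, a t i ∈ Submodule.span 𝕜 (Set.range fun p : Σ t, Fin (k t + 1) => a p.1 p.2) := by
  classical
  -- Order by the index first and by the sequence second. Raising both indices by one preserves this
  -- order, and all initial terms come before the others.
  let ρ : Fin r × ℕ → ℕ := fun p => p.2 * r + p.1
  let v : Fin r × ℕ → V := fun p => a p.1 p.2
  have hρ : Function.Injective ρ := by
    rintro ⟨t, i⟩ ⟨s, j⟩ h
    have ht := t.2
    have hs := s.2
    have h' : i * r + t = j * r + s := h
    have hij : i = j := by
      have e1 : (t + r * i : ℕ) / r = i := by
        rw [Nat.add_mul_div_left _ _ (by omega), Nat.div_eq_of_lt ht, zero_add]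
      have e2 : (s + r * j : ℕ) / r = j := by
        rw [Nat.add_mul_div_left _ _ (by omega), Nat.div_eq_of_lt hs, zero_add]
      rw [← e1, ← e2, add_comm, mul_comm r i, h', add_comm (s : ℕ), mul_comm r j]
    subst hij
    exact Prod.ext (Fin.ext (by simpa using h')) rfl
  -- Shift the relation expressing `a t i` through earlier terms by one step of the recurrence. The
  -- error lies in `ker B₁`, which the initial terms span. Hence the pivots of each sequence form an
  -- initial segment.
  have hstep : ∀ t i, ¬ IsPivot 𝕜 ρ v (t, i) → ¬ IsPivot 𝕜 ρ v (t, i + 1) := by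
    intro t i h
    have hmem := not_not.1 h
    have key : ∀ y ∈ Submodule.span 𝕜 (v '' {q | ρ q < ρ (t, i)}),
        ∃ y' ∈ Submodule.span 𝕜 (v '' {q | ρ q < ρ (t, i + 1)}), B₂ y = -B₁ y' := by
      intro y hy
      induction hy using Submodule.span_induction with
      | mem y hy =>
        obtain ⟨⟨s, j⟩, hq, rfl⟩ := hy
        refine ⟨v (s, j + 1), Submodule.subset_span ⟨_, ?_, rfl⟩, ha s j⟩
        have hq : j * r + s < i * r + t := hq
        change (j + 1) * r + s < (i + 1) * r + t
        linarith
      | zero => exact ⟨0, Submodule.zero_mem _, by simp⟩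
      | add y z _ _ hy hz =>
        obtain ⟨y', hy', ey⟩ := hy
        obtain ⟨z', hz', ez⟩ := hz
        exact ⟨y' + z', Submodule.add_mem _ hy' hz', by rw [map_add, ey, ez, map_add, neg_add]⟩
      | smul c y _ hy =>
        obtain ⟨y', hy', ey⟩ := hy
        exact ⟨c • y', Submodule.smul_mem _ _ hy', by rw [map_smul, ey, map_smul, smul_neg]⟩
    obtain ⟨y', hy', ey⟩ := key _ hmem
    have hz : a t (i + 1) - y' ∈ LinearMap.ker B₁ := by
      have h3 : -B₁ (a t (i + 1)) = -B₁ y' := (ha t i).symm.trans ey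
      rw [LinearMap.mem_ker, map_sub, neg_inj.1 h3, sub_self]
    have hle : Submodule.span 𝕜 (Set.range fun t => a t 0) ≤
        Submodule.span 𝕜 (v '' {q | ρ q < ρ (t, i + 1)}) := by
      refine Submodule.span_mono ?_
      rintro _ ⟨s, rfl⟩
      refine ⟨(s, 0), ?_, rfl⟩
      change 0 * r + s < (i + 1) * r + t
      have := s.2
      rw [zero_mul, zero_add, add_mul, one_mul]
      omega
    have := Submodule.add_mem _ (hle (hker hz)) hy'
    rw [sub_add_cancel] at this
    exact not_not.2 this
  have hzero : ∀ t, IsPivot 𝕜 ρ v (t, 0) := by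
    intro t h
    refine hli.notMem_span_image (s := {s | s < t}) (x := t) (lt_irrefl t)
      (Submodule.span_mono ?_ h)
    rintro _ ⟨⟨s, j⟩, hq, rfl⟩
    have hq : j * r + s < 0 * r + t := hq
    have ht := t.2
    rw [zero_mul, zero_add] at hq
    rcases j with _ | j
    · exact ⟨s, Fin.lt_def.2 (by omega), rfl⟩
    · rw [add_mul, one_mul] at hq; omega
  have hP := linearIndependent_pivots (𝕜 := 𝕜) hρ v
  -- Pivots are independent, so by finite dimension no sequence consists of pivots only.
  have hex : ∀ t, ∃ i, ¬ IsPivot 𝕜 ρ v (t, i) := fun t => by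
    by_contra! h
    have hinf := hP.comp (fun i : ℕ => ⟨(t, i), h i⟩) fun i j hij =>
      (Prod.ext_iff.1 (Subtype.ext_iff.1 hij)).2
    exact not_finite_iff_infinite.2 inferInstance hinf.finite
  have hiff : ∀ t i, i < Nat.find (hex t) ↔ IsPivot 𝕜 ρ v (t, i) := fun t i => by
    refine ⟨fun h => not_not.1 (Nat.find_min (hex t) h), fun h => ?_⟩
    by_contra! hle
    have : ∀ d, ¬ IsPivot 𝕜 ρ v (t, Nat.find (hex t) + d) := fun d => by
      induction d with
      | zero => exact Nat.find_spec (hex t)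
      | succ d ih => exact hstep _ _ ih
    obtain ⟨d, rfl⟩ := Nat.exists_eq_add_of_le hle
    exact this d h
  have hpos : ∀ t, 0 < Nat.find (hex t) := fun t => (hiff t 0).2 (hzero t)
  -- The first non-pivot has positive index because `a t 0` is a pivot, so subtracting one and
  -- counting `k t + 1` terms is exact.
  refine ⟨fun t => Nat.find (hex t) - 1, ?_, fun t i => ?_⟩
  · have := hP.comp (fun p : Σ t, Fin (Nat.find (hex t) - 1 + 1) =>
      (⟨(p.1, p.2), (hiff _ _).1 (by have := hpos p.1; have := p.2.2; omega)⟩ :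
        {p // IsPivot 𝕜 ρ v p})) fun p q hpq => by
      have h := Prod.ext_iff.1 (Subtype.ext_iff.1 hpq)
      exact (sigma_fin_ext_iff p q).1 ⟨h.1, h.2⟩
    exact this
  · refine Submodule.span_mono ?_ (mem_span_pivots (𝕜 := 𝕜) ρ v (t, i))
    rintro _ ⟨⟨s, j⟩, hq, rfl⟩
    have := (hiff s j).2 hq
    exact ⟨⟨s, ⟨j, by change j < Nat.find (hex s) - 1 + 1; omega⟩⟩, rfl⟩

end Pivots

/-! ### Semicontinuity of kernels. -/

section Semicontinuity

variable {𝕜 : Type*} [RCLike 𝕜]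

/-- The dimension of the kernel is upper semicontinuous. -/
lemma eventually_finrank_ker_le {X A Z : Type*} [TopologicalSpace X] [AddCommGroup A] [Module 𝕜 A]
    [FiniteDimensional 𝕜 A] [NormedAddCommGroup Z] [NormedSpace 𝕜 Z] {T : X → A →ₗ[𝕜] Z} {x₀ : X}
    (hT : ∀ a, ContinuousAt (fun x => T x a) x₀) :
    ∀ᶠ x in 𝓝 x₀, Module.finrank 𝕜 (LinearMap.ker (T x)) ≤
      Module.finrank 𝕜 (LinearMap.ker (T x₀)) := by
  let b := Module.finBasis 𝕜 (LinearMap.range (T x₀))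
  choose c hc using fun i => (b i).2
  -- Independence of finitely many vectors is an open condition, so the rank cannot drop near `x₀`.
  have hli : LinearIndependent 𝕜 fun i => T x₀ (c i) := by
    simp only [hc]
    exact b.linearIndependent.map' _ (Submodule.ker_subtype _)
  have hcont : ContinuousAt (fun x i => T x (c i)) x₀ := continuousAt_pi.2 fun i => hT (c i)
  filter_upwards [hcont.eventually hli.eventually] with x hx
  have h1 : LinearIndependent 𝕜 fun i => (⟨T x (c i), c i, rfl⟩ : LinearMap.range (T x)) :=
    LinearIndependent.of_comp (Submodule.subtype _) hx
  have h2 := h1.fintype_card_le_finrank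
  rw [Fintype.card_fin] at h2
  have h3 := LinearMap.finrank_range_add_finrank_ker (T x)
  have h4 := LinearMap.finrank_range_add_finrank_ker (T x₀)
  omega

/-- An upper semicontinuous function with natural values is constant on an open set that still
adheres to a given point. -/
lemma exists_isOpen_const {X : Type*} [TopologicalSpace X] {f : X → ℕ}
    (hf : ∀ x, ∀ᶠ y in 𝓝 x, f y ≤ f x) {O : Set X} (hO : IsOpen O) {x₀ : X} (hx₀ : x₀ ∈ closure O) :
    ∃ O' ⊆ O, IsOpen O' ∧ x₀ ∈ closure O' ∧ ∀ x ∈ O', ∀ y ∈ O', f x = f y := by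
  classical
  have hopen : ∀ c, IsOpen {x | f x ≤ c} := fun c => isOpen_iff_mem_nhds.2 fun x hx => by
    filter_upwards [hf x] with y hy using hy.trans hx
  -- Take the least `c` such that `{f ≤ c}` inside `O` adheres to `x₀`. The closure of `{f < c}`
  -- then misses `x₀`, and removing it leaves only the value `c`.
  have hex : ∃ c, x₀ ∈ closure (O ∩ {x | f x ≤ c}) := by
    refine ⟨f x₀, ?_⟩
    rw [Set.inter_comm]
    exact (hopen _).inter_closure ⟨le_refl (f x₀), hx₀⟩
  have hnot : x₀ ∉ closure (O ∩ {x | f x < Nat.find hex}) := by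
    rcases hc : Nat.find hex with _ | c
    · simp
    · have := Nat.find_min hex (m := c) (by omega)
      simpa only [Nat.lt_succ_iff] using this
  have heq : ∀ x ∈ (closure (O ∩ {x | f x < Nat.find hex}))ᶜ ∩ (O ∩ {x | f x ≤ Nat.find hex}),
      f x = Nat.find hex := fun x hx => by
    by_contra hne
    exact hx.1 (subset_closure ⟨hx.2.1, lt_of_le_of_ne hx.2.2 hne⟩)
  exact ⟨_, fun x hx => hx.2.1, isClosed_closure.isOpen_compl.inter (hO.inter (hopen _)),
    isClosed_closure.isOpen_compl.inter_closure ⟨hnot, Nat.find_spec hex⟩,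
    fun x hx y hy => (heq x hx).trans (heq y hy).symm⟩

end Semicontinuity

/-! ### Kernels of brackets and of the recurrence near a point. -/

section Brackets

variable {𝕜 : Type*} [RCLike 𝕜] {E : Type*} [NormedAddCommGroup E] [NormedSpace 𝕜 E]
  [FiniteDimensional 𝕜 E] {M : Type*} [TopologicalSpace M] [ChartedSpace E M]

instance finiteDimensional_cotangent (m : M) : FiniteDimensional 𝕜 (Cotangent 𝕜 E m) :=
  inferInstanceAs (FiniteDimensional 𝕜 (E →L[𝕜] 𝕜))

lemma finrank_cotangent (m : M) :
    Module.finrank 𝕜 (Cotangent 𝕜 E m) = Module.finrank 𝕜 (E →L[𝕜] 𝕜) := rfl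

variable [IsManifold 𝓘(𝕜, E) ∞ M]

lemma continuousAt_chartOperator {P : TensorField 𝕜 E M} (hP : IsBracket P) (m : M)
    (β : E →L[𝕜] 𝕜) : ContinuousAt (fun m' => chartOperator P m (chartAt E m m') β) m := by
  have h1 : ContinuousAt (chartOperator P m) (chartAt E m m) :=
    (contDiffOn_chartOperator hP m).continuousOn.continuousAt
      ((chartAt E m).open_target.mem_nhds (mem_chart_target E m))
  exact (h1.comp (f := chartAt E m) ((chartAt E m).continuousAt (mem_chart_source E m))).clm_apply
    continuousAt_const

/-- Semicontinuity needs operators on one fixed space; the chart at `m` identifies the nearby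
cotangent spaces with the dual of the model space. -/
lemma eventually_finrank_ker_bracket_le {P : TensorField 𝕜 E M} (hP : IsBracket P) (m : M) :
    ∀ᶠ m' in 𝓝 m, Module.finrank 𝕜 (LinearMap.ker (P m')) ≤
      Module.finrank 𝕜 (LinearMap.ker (P m)) := by
  filter_upwards [eventually_finrank_ker_le
    (T := fun m' => (chartOperator P m (chartAt E m m')).toLinearMap)
    (continuousAt_chartOperator hP m), (chartAt E m).open_source.mem_nhds (mem_chart_source E m)]
    with m' h hm'
  rwa [finrank_ker_chartOperator P m hm', finrank_ker_chartOperator P m (mem_chart_source E m)] at h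

lemma chartOperator_eq_neg_iff (P₁ P₂ : TensorField 𝕜 E M) (m₀ : M) {m : M}
    (hm : m ∈ (chartAt E m₀).source) (β β' : E →L[𝕜] 𝕜) :
    chartOperator P₂ m₀ (chartAt E m₀ m) β = -chartOperator P₁ m₀ (chartAt E m₀ m) β' ↔
      P₂ m (chartCotangent m₀ hm β) = -P₁ m (chartCotangent m₀ hm β') := by
  constructor
  · intro h0
    ext α
    obtain ⟨γ, rfl⟩ := (chartCotangent m₀ hm).surjective α
    rw [← chartOperator_apply P₂ m₀ hm β γ, h0, map_neg, chartOperator_apply P₁ m₀ hm β' γ]; rfl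
  · intro h0
    refine sub_eq_zero.1 (eq_zero_of_forall_dual (𝕜 := 𝕜) fun γ => ?_)
    rw [map_sub, map_neg, chartOperator_apply P₂ m₀ hm β γ, h0, chartOperator_apply P₁ m₀ hm β' γ]
    exact sub_self _

lemma finrank_ker_recurrenceMap_chart (P₁ P₂ : TensorField 𝕜 E M) (n : ℕ) (m₀ : M) {m : M}
    (hm : m ∈ (chartAt E m₀).source) :
    Module.finrank 𝕜 (LinearMap.ker
      (recurrenceMap (chartOperator P₁ m₀ (chartAt E m₀ m)).toLinearMap
        (chartOperator P₂ m₀ (chartAt E m₀ m)).toLinearMap n)) =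
      Module.finrank 𝕜 (LinearMap.ker (recurrenceMap (P₁ m) (P₂ m) n)) := by
  let c := LinearEquiv.piCongrRight fun _ : Fin n => chartCotangent (𝕜 := 𝕜) m₀ hm
  have hext : ∀ a i, extendZero 𝕜 (Cotangent 𝕜 E m) n (c a) i =
      chartCotangent m₀ hm (extendZero 𝕜 (E →L[𝕜] 𝕜) n a i) := fun a i => by
    rcases lt_or_ge i n with hi | hi
    · rw [extendZero_of_lt hi, extendZero_of_lt hi]; rfl
    · rw [extendZero_of_le hi, extendZero_of_le hi, map_zero]
  have h : LinearMap.ker (recurrenceMap (chartOperator P₁ m₀ (chartAt E m₀ m)).toLinearMap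
        (chartOperator P₂ m₀ (chartAt E m₀ m)).toLinearMap n) =
      (LinearMap.ker (recurrenceMap (P₁ m) (P₂ m) n)).comap c.toLinearMap := by
    ext a
    rw [Submodule.mem_comap, mem_ker_recurrenceMap, mem_ker_recurrenceMap]
    change _ ↔ P₁ m (extendZero 𝕜 (Cotangent 𝕜 E m) n (c a) 0) = 0 ∧
      ∀ i, P₂ m (extendZero 𝕜 (Cotangent 𝕜 E m) n (c a) i) =
        -P₁ m (extendZero 𝕜 (Cotangent 𝕜 E m) n (c a) (i + 1))
    simp only [hext]
    exact and_congr (chartOperator_eq_zero_iff P₁ m₀ hm _)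
      (forall_congr' fun i => chartOperator_eq_neg_iff P₁ P₂ m₀ hm _ _)
  rw [h]
  exact LinearEquiv.finrank_eq (c.ofSubmodule' _)

lemma eventually_finrank_ker_recurrenceMap_le {P₁ P₂ : TensorField 𝕜 E M} (h₁ : IsBracket P₁)
    (h₂ : IsBracket P₂) (n : ℕ) (m : M) :
    ∀ᶠ m' in 𝓝 m, Module.finrank 𝕜 (LinearMap.ker (recurrenceMap (P₁ m') (P₂ m') n)) ≤
      Module.finrank 𝕜 (LinearMap.ker (recurrenceMap (P₁ m) (P₂ m) n)) := by
  filter_upwards [eventually_finrank_ker_le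
    (T := fun m' => recurrenceMap (chartOperator P₁ m (chartAt E m m')).toLinearMap
        (chartOperator P₂ m (chartAt E m m')).toLinearMap n)
    (fun a => continuousAt_pi.2 fun i => by
      refine ContinuousAt.add (continuousAt_chartOperator h₁ m _) ?_
      split_ifs
      · exact continuousAt_const
      · exact continuousAt_chartOperator h₂ m _),
    (chartAt E m).open_source.mem_nhds (mem_chart_source E m)] with m' h hm'
  rwa [finrank_ker_recurrenceMap_chart P₁ P₂ n m hm',
    finrank_ker_recurrenceMap_chart P₁ P₂ n m (mem_chart_source E m)] at h

end Brackets

/-! ### From integrability to homogeneity. -/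

section Converse

variable {𝕜 : Type*} [RCLike 𝕜] {E : Type*} [NormedAddCommGroup E] [NormedSpace 𝕜 E]
  [FiniteDimensional 𝕜 E] {M : Type*} [TopologicalSpace M] [ChartedSpace E M]

lemma IsBlockDecomposition.comp_equiv {𝕜 V : Type*} [Field 𝕜] [AddCommGroup V] [Module 𝕜 V]
    {B₁ B₂ : LinearMap.BilinForm 𝕜 V} {l l' : ℕ} {W : Fin l → Submodule 𝕜 V}
    (D : IsBlockDecomposition B₁ B₂ W) (σ : Fin l' ≃ Fin l) :
    IsBlockDecomposition B₁ B₂ fun i => W (σ i) where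
  independent := D.independent.comp σ.injective
  span := by rw [← D.span]; exact σ.iSup_comp
  orthogonal := fun i j h => D.orthogonal _ _ (σ.injective.ne h)
  indecomposable := fun i => D.indecomposable _

variable [IsManifold 𝓘(𝕜, E) ∞ M]

/-- Every covector is the differential of a local function, so conditions on brackets with all local
functions are pointwise conditions on covectors. -/
lemma eq_zero_of_bracket {P : TensorField 𝕜 E M} {m : M} {U : Set M} (hU : IsOpen U) (hm : m ∈ U)
    (α : Cotangent 𝕜 E m)
    (h : ∀ V : Set M, IsOpen V → V ⊆ U → ∀ f : M → 𝕜, SmoothOn E f V → m ∈ V →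
      P m α (diffAt E f m) = 0) : P m α = 0 := by
  ext β
  obtain ⟨f, hf, rfl⟩ := exists_smoothOn_diffAt m β
  exact h (U ∩ (chartAt E m).source) (hU.inter (chartAt E m).open_source) Set.inter_subset_left f
    (ContMDiffOn.mono hf Set.inter_subset_right) ⟨hm, mem_chart_source E m⟩

lemma IsAnchoredFamily.isSolution {P₁ P₂ : TensorField 𝕜 E M} {H : ℕ → M → 𝕜} {U : Set M}
    (h : IsAnchoredFamily P₁ P₂ H U) (hU : IsOpen U) {m : M} (hm : m ∈ U) :
    IsSolution (P₁ m) (P₂ m) fun i => diffAt E (H i) m := by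
  refine ⟨eq_zero_of_bracket hU hm _ fun V hV hVU f hf hmV => h.anchored.2 V hV hVU f hf m hmV,
    fun i => ?_⟩
  ext β
  obtain ⟨f, hf, rfl⟩ := exists_smoothOn_diffAt m β
  exact h.recurrence i (U ∩ (chartAt E m).source) (hU.inter (chartAt E m).open_source)
    Set.inter_subset_left f (ContMDiffOn.mono hf Set.inter_subset_right) m
    ⟨hm, mem_chart_source E m⟩

/-- Choose `μ` for which the corank at `m` equals the number of Kronecker blocks. For this `μ` the
corank cannot increase near `m`, and it bounds the number of Kronecker blocks at every point. -/
lemma eventually_linearActionDim_le {P₁ P₂ : TensorField 𝕜 E M} (hP : IsBihamiltonian P₁ P₂)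
    (m : M) :
    ∀ᶠ m' in 𝓝 m, linearActionDim (P₁ m') (P₂ m') ≤ linearActionDim (P₁ m) (P₂ m) := by
  obtain ⟨μ, hμ⟩ := exists_finrank_ker_eq_kroneckerCount (hP.poisson₁.skew m) (hP.poisson₂.skew m)
  filter_upwards [eventually_finrank_ker_bracket_le (hP.compatible 1 μ).toIsBracket m] with m' h
  have h1 := kroneckerCount_le_finrank_ker (hP.poisson₁.skew m') (hP.poisson₂.skew m') μ
  have e : ∀ m, ((1 : 𝕜) • P₁ + μ • P₂) m = P₁ m + μ • P₂ m := fun m => by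
    rw [Pi.add_apply, Pi.smul_apply, Pi.smul_apply, one_smul]
  rw [e, e, hμ] at h
  exact Nat.div_le_div_right (Nat.add_le_add_left (h1.trans h) _)

/-- If the Lenard scheme provides a maximal number of functions at a point, then all blocks are
Kronecker blocks there. -/
lemma exists_kronecker_frame {P₁ P₂ : TensorField 𝕜 E M} (hP : IsBihamiltonian P₁ P₂)
    {U : Set M} (hU : IsOpen U) {r : ℕ} {H : Fin r → ℕ → M → 𝕜} {k : Fin r → ℕ}
    (hH : ∀ t, IsAnchoredFamily P₁ P₂ (H t) U) {m : M} (hm : m ∈ U)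
    (hli : LinearIndependent 𝕜 fun p : Σ t : Fin r, Fin (k t + 1) => diffAt E (H p.1 p.2) m)
    (hdim : linearActionDim (P₁ m) (P₂ m) ≤ ∑ t, (k t + 1)) :
    ∃ (l : ℕ) (W : Fin l → Submodule 𝕜 (Cotangent 𝕜 E m)) (q : Fin l → ℕ)
      (F : KroneckerFrame (P₁ m) (P₂ m) q), IsBlockDecomposition (P₁ m) (P₂ m) W ∧
      (∀ i, Module.finrank 𝕜 (W i) = 2 * q i - 1) ∧ F.complement = ⊥ := by
  obtain ⟨l, W, D⟩ := exists_isBlockDecomposition (P₁ m) (P₂ m)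
  have hW := D.isKroneckerBlock_of_solutions (hP.poisson₁.skew m) (hP.poisson₂.skew m)
    (L := Submodule.span 𝕜 (Set.range
      fun p : Σ t : Fin r, Fin (k t + 1) => diffAt E (H p.1 p.2) m))
    (fun S hS => Submodule.span_le.2 <| by
      rintro _ ⟨p, rfl⟩
      exact hS _ ((hH p.1).isSolution hU hm) p.2)
    (by
      rw [finrank_span_eq_card hli, Fintype.card_sigma]
      simpa using hdim)
  obtain ⟨q, F, hq, hF⟩ := D.exists_frame_of_kronecker (hP.poisson₁.skew m) (hP.poisson₂.skew m) hW
  exact ⟨l, W, q, F, D, hq, hF⟩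

/-- The uniform bound makes the `liminf` in `actionDimAt` a genuine lower limit: the supremum of an
unbounded set of naturals would be a default value. -/
lemma linearActionDim_le {P₁ P₂ : TensorField 𝕜 E M} (hP : IsBihamiltonian P₁ P₂) (m : M) :
    linearActionDim (P₁ m) (P₂ m) ≤ Module.finrank 𝕜 (E →L[𝕜] 𝕜) := by
  have h1 := kroneckerCount_le_finrank_ker (hP.poisson₁.skew m) (hP.poisson₂.skew m) 0
  have h2 := Submodule.finrank_le (LinearMap.ker (P₁ m + (0 : 𝕜) • P₂ m))
  have h3 := finrank_cotangent (𝕜 := 𝕜) (E := E) m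
  rw [linearActionDim]
  omega

lemma frequently_linearActionDim_le {P₁ P₂ : TensorField 𝕜 E M} (hP : IsBihamiltonian P₁ P₂)
    (m₀ : M) : ∃ᶠ m in 𝓝 m₀, linearActionDim (P₁ m) (P₂ m) ≤ actionDimAt P₁ P₂ m₀ := by
  have hb : (𝓝 m₀).IsBoundedUnder (· ≤ ·) fun m => linearActionDim (P₁ m) (P₂ m) :=
    Filter.isBoundedUnder_of ⟨_, linearActionDim_le hP⟩
  refine (Filter.frequently_lt_of_liminf_lt (b := actionDimAt P₁ P₂ m₀ + 1)
    hb.isCoboundedUnder_ge (Nat.lt_succ_self _)).mono fun m hm => Nat.lt_succ_iff.1 hm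

/-- Restrict to open sets that keep adhering to `m₀`, though they may not contain it: first the
action dimension is at most its lower limit, then the differentials are also independent, then the
spaces of finite solutions have constant dimensions. The first two conditions force Kronecker
blocks, the third fixes their sizes. -/
theorem exists_isHomogeneousOn {P₁ P₂ : TensorField 𝕜 E M} (hP : IsBihamiltonian P₁ P₂) {m₀ : M}
    (h : IsStrictlyLenardIntegrableAt P₁ P₂ m₀) :
    ∃ U : Set M, IsOpen U ∧ m₀ ∈ closure U ∧ IsHomogeneousOn P₁ P₂ U := by
  obtain ⟨U, hU, hm₀, r, H, k, hH, hd⟩ := h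
  obtain ⟨V, hV, hVU, hUV, hVli⟩ := hH.independent
  let A := {m | linearActionDim (P₁ m) (P₂ m) ≤ actionDimAt P₁ P₂ m₀}
  have hA : IsOpen A := isOpen_iff_mem_nhds.2 fun m hm => by
    filter_upwards [eventually_linearActionDim_le hP m] with m' h using h.trans hm
  have hmA : m₀ ∈ closure A := mem_closure_iff_frequently.2 (frequently_linearActionDim_le hP m₀)
  have hmAV : m₀ ∈ closure (A ∩ V) := by
    have h1 : m₀ ∈ closure (U ∩ A) := hU.inter_closure ⟨hm₀, hmA⟩
    have h2 : U ∩ A ⊆ closure (A ∩ V) := fun m hm => hA.inter_closure ⟨hm.2, hUV hm.1⟩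
    exact closure_minimal h2 isClosed_closure h1
  -- No block size exceeds `N`, so the lengths `n ≤ N` suffice to recover the sizes.
  let N := Module.finrank 𝕜 (E →L[𝕜] 𝕜)
  obtain ⟨O, hOAV, hO, hmO, hconst⟩ : ∃ O ⊆ A ∩ V, IsOpen O ∧ m₀ ∈ closure O ∧ ∀ n < N + 1,
      ∀ m ∈ O, ∀ m' ∈ O, Module.finrank 𝕜 (LinearMap.ker (recurrenceMap (P₁ m) (P₂ m) n)) =
        Module.finrank 𝕜 (LinearMap.ker (recurrenceMap (P₁ m') (P₂ m') n)) := by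
    induction N + 1 with
    | zero => exact ⟨A ∩ V, subset_rfl, hA.inter hV, hmAV, fun n hn => absurd hn (by omega)⟩
    | succ d ih =>
      obtain ⟨O, hOAV, hO, hmO, hconst⟩ := ih
      obtain ⟨O', hO'O, hO', hmO', hconst'⟩ := exists_isOpen_const
        (eventually_finrank_ker_recurrenceMap_le hP.poisson₁.toIsBracket hP.poisson₂.toIsBracket d)
        hO hmO
      refine ⟨O', hO'O.trans hOAV, hO', hmO', fun n hn m hm m' hm' => ?_⟩
      rcases Nat.lt_succ_iff_lt_or_eq.1 hn with hn | rfl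
      · exact hconst n hn m (hO'O hm) m' (hO'O hm')
      · exact hconst' m hm m' hm'
  have hframe : ∀ m ∈ O, ∃ (l : ℕ) (W : Fin l → Submodule 𝕜 (Cotangent 𝕜 E m)) (q : Fin l → ℕ)
      (F : KroneckerFrame (P₁ m) (P₂ m) q), IsBlockDecomposition (P₁ m) (P₂ m) W ∧
      (∀ i, Module.finrank 𝕜 (W i) = 2 * q i - 1) ∧ F.complement = ⊥ := fun m hm =>
    exists_kronecker_frame hP hU hH.family (hVU (hOAV hm).2) (hVli m (hOAV hm).2)
      (hd ▸ (hOAV hm).1)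
  obtain ⟨m₁, hm₁⟩ : O.Nonempty := closure_nonempty_iff.1 ⟨m₀, hmO⟩
  obtain ⟨l, W, q, F, D, hq, hF⟩ := hframe m₁ hm₁
  have hle : ∀ {m : M} {l : ℕ} {W : Fin l → Submodule 𝕜 (Cotangent 𝕜 E m)} {q : Fin l → ℕ}
      (F : KroneckerFrame (P₁ m) (P₂ m) q), (∀ i, Module.finrank 𝕜 (W i) = 2 * q i - 1) →
      ∀ i, 1 ≤ q i ∧ q i ≤ N := by
    intro m l W q F hq i
    have h1 := F.pos i
    have h2 : Module.finrank 𝕜 (W i) ≤ N := Submodule.finrank_le (W i)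
    rw [hq] at h2
    exact ⟨h1, by omega⟩
  refine ⟨O, hO, hmO, l, q, F.pos, fun m hm => ?_⟩
  obtain ⟨l', W', q', F', D', hq', hF'⟩ := hframe m hm
  obtain ⟨σ, hσ⟩ := exists_equiv_of_sum_eq (N := N) (hle F hq) (hle F' hq') fun n hn => by
    rw [← F.finrank_ker_recurrenceMap (hP.poisson₁.skew m₁) (hP.poisson₂.skew m₁) hF,
      ← F'.finrank_ker_recurrenceMap (hP.poisson₁.skew m) (hP.poisson₂.skew m) hF']
    exact hconst n (by omega) m₁ hm₁ m hm
  exact ⟨fun i => W' (σ i), D'.comp_equiv σ, fun i => by rw [hq', hσ]⟩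

end Converse

/-! ### Pairs of forms with Kronecker blocks only. -/

section Pointwise

variable {𝕜 V : Type*} [Field 𝕜] [CharZero 𝕜] [AddCommGroup V] [Module 𝕜 V]
  [FiniteDimensional 𝕜 V] {B₁ B₂ : LinearMap.BilinForm 𝕜 V}

lemma isNondegenerateOn_bot (μ : 𝕜) : IsNondegenerateOn B₁ B₂ μ ⊥ :=
  fun _ hx _ => (Submodule.mem_bot 𝕜).1 hx

/-- Blocks of dimensions `2 k_i - 1` admit a frame, and the action dimension is `∑ i, k_i`. -/
theorem IsBlockDecomposition.exists_frame_of_finrank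
    (h₁ : ∀ x y, B₁ x y = -B₁ y x) (h₂ : ∀ x y, B₂ x y = -B₂ y x) {l : ℕ}
    {W : Fin l → Submodule 𝕜 V} (D : IsBlockDecomposition B₁ B₂ W) {k : Fin l → ℕ}
    (hk : ∀ i, 1 ≤ k i) (hW : ∀ i, Module.finrank 𝕜 (W i) = 2 * k i - 1) :
    (∃ F : KroneckerFrame B₁ B₂ k, F.complement = ⊥) ∧ linearActionDim B₁ B₂ = ∑ i, k i := by
  have hKr : ∀ i, IsKroneckerBlock B₁ B₂ (W i) := fun i =>
    (D.indecomposable i).isKroneckerBlock_of_odd h₁ h₂ (by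
      have := hk i
      rw [hW, Nat.odd_iff]; omega)
  obtain ⟨q, F, hq, hF⟩ := D.exists_frame_of_kronecker h₁ h₂ hKr
  obtain rfl : q = k := funext fun i => by
    have := hk i
    have := F.pos i
    have := hq i
    have := hW i
    omega
  refine ⟨⟨F, hF⟩, ?_⟩
  have hcount : kroneckerCount B₁ B₂ = l := by
    rw [D.kroneckerCount_eq h₁ h₂, Set.eq_univ_of_forall (s := {i | IsKroneckerBlock B₁ B₂ (W i)})
      hKr, Set.ncard_univ, Nat.card_fin]
  have hN := F.finrank_eq
  rw [hF, finrank_bot, add_zero] at hN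
  have hsum : ∑ j, (2 * q j - 1) + l = 2 * ∑ j, q j := by
    have h3 : ∑ j, (2 * q j - 1) + ∑ _j : Fin l, 1 = 2 * ∑ j, q j := by
      rw [← Finset.sum_add_distrib, Finset.mul_sum]
      exact Finset.sum_congr rfl fun j _ => by have := F.pos j; omega
    simpa using h3
  rw [linearActionDim, hcount]
  omega

lemma KroneckerFrame.finrank_ker_one {l : ℕ} {k : Fin l → ℕ} (F : KroneckerFrame B₁ B₂ k)
    (h₁ : ∀ x y, B₁ x y = -B₁ y x) (h₂ : ∀ x y, B₂ x y = -B₂ y x) (hF : F.complement = ⊥) :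
    Module.finrank 𝕜 (LinearMap.ker B₁) = l := by
  have h := F.finrank_ker h₁ h₂ (μ := 0) (hF ▸ isNondegenerateOn_bot 0)
  rwa [zero_smul, add_zero, Fintype.card_fin] at h

lemma KroneckerFrame.ker_le_span {l : ℕ} {k : Fin l → ℕ} (F : KroneckerFrame B₁ B₂ k)
    (h₁ : ∀ x y, B₁ x y = -B₁ y x) (h₂ : ∀ x y, B₂ x y = -B₂ y x) (hF : F.complement = ⊥)
    {a : Fin l → V} (ha : ∀ t, B₁ (a t) = 0) (hli : LinearIndependent 𝕜 a) :
    LinearMap.ker B₁ ≤ Submodule.span 𝕜 (Set.range a) := by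
  refine (Submodule.eq_of_le_of_finrank_eq (Submodule.span_le.2 ?_) ?_).ge
  · rintro _ ⟨t, rfl⟩
    exact ha t
  · rw [finrank_span_eq_card hli, F.finrank_ker_one h₁ h₂ hF, Fintype.card_fin]

/-- Solutions whose initial terms span the kernel of `B₁` span the space of even vectors. -/
lemma KroneckerFrame.span_solutions_eq {l : ℕ} {k : Fin l → ℕ} (F : KroneckerFrame B₁ B₂ k)
    (h₁ : ∀ x y, B₁ x y = -B₁ y x) (h₂ : ∀ x y, B₂ x y = -B₂ y x) (hF : F.complement = ⊥)
    {a : Fin l → ℕ → V} (ha : ∀ t, IsSolution B₁ B₂ (a t))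
    (hli : LinearIndependent 𝕜 fun t => a t 0) :
    Submodule.span 𝕜 (Set.range fun p : Fin l × ℕ => a p.1 p.2) = F.evenSpan := by
  refine le_antisymm (Submodule.span_le.2 ?_) (F.evenSpan_le h₁ h₂ ?_ ?_)
  · rintro _ ⟨p, rfl⟩
    exact F.solution_mem_evenSpan h₁ h₂ (μ := 0) (hF ▸ isNondegenerateOn_bot 0) (ha p.1) p.2
  · refine (F.ker_le_span h₁ h₂ hF (fun t => (ha t).zero) hli).trans (Submodule.span_mono ?_)
    rintro _ ⟨t, rfl⟩
    exact ⟨(t, 0), rfl⟩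
  · intro y hy
    induction hy using Submodule.span_induction with
    | mem y hy =>
      obtain ⟨⟨t, i⟩, rfl⟩ := hy
      exact ⟨a t (i + 1), Submodule.subset_span ⟨(t, i + 1), rfl⟩, (ha t).succ i⟩
    | zero => exact ⟨0, Submodule.zero_mem _, by simp⟩
    | add y z _ _ hy hz =>
      obtain ⟨y', hy', ey⟩ := hy
      obtain ⟨z', hz', ez⟩ := hz
      exact ⟨y' + z', Submodule.add_mem _ hy' hz', by rw [map_add, ey, ez, map_add, neg_add]⟩
    | smul c y _ hy =>
      obtain ⟨y', hy', ey⟩ := hy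
      exact ⟨c • y', Submodule.smul_mem _ _ hy', by rw [map_smul, ey, map_smul, smul_neg]⟩

end Pointwise

/-! ### From homogeneity to integrability. -/

section Integrability

variable {𝕜 : Type*} [RCLike 𝕜] {E : Type*} [NormedAddCommGroup E] [NormedSpace 𝕜 E]
  [FiniteDimensional 𝕜 E] {M : Type*} [TopologicalSpace M] [ChartedSpace E M]

lemma generically_of_forall {U : Set M} (hU : IsOpen U) {p : M → Prop} (h : ∀ m ∈ U, p m) :
    Generically U p :=
  ⟨U, hU, subset_rfl, subset_closure, h⟩

variable [IsManifold 𝓘(𝕜, E) ∞ M]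

lemma diffAt_comp_chart (m₀ : M) {m : M} (hm : m ∈ (chartAt E m₀).source) {G : Set E}
    (hG : IsOpen G) (hmG : chartAt E m₀ m ∈ G) {f : E → 𝕜} (hf : ContDiffOn 𝕜 ∞ f G) :
    diffAt E (f ∘ chartAt E m₀) m = chartCotangent m₀ hm (fderiv 𝕜 f (chartAt E m₀ m)) :=
  diffAt_eq_chartCotangent m₀ hm Filter.EventuallyEq.rfl
    ((hf.differentiableOn (by simp)).differentiableAt (hG.mem_nhds hmG))

/-- Linear independence of differentials is an open condition. -/
lemma isOpen_linearIndependent_diffAt {ι : Type*} [Finite ι] (m₀ : M) {G : Set E} (hG : IsOpen G)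
    {f : ι → E → 𝕜} (hf : ∀ p, ContDiffOn 𝕜 ∞ (f p) G) :
    IsOpen {m | m ∈ (chartAt E m₀).source ∩ chartAt E m₀ ⁻¹' G ∧
      LinearIndependent 𝕜 fun p => diffAt E (f p ∘ chartAt E m₀) m} := by
  have h1 : ContinuousOn (fun x p => fderiv 𝕜 (f p) x) G :=
    continuousOn_pi.2 fun p => (hf p).continuousOn_fderiv_of_isOpen hG (by simp)
  have h2 := (chartAt E m₀).isOpen_inter_preimage
    (h1.isOpen_inter_preimage hG (isOpen_setOfPred_linearIndependent (𝕜 := 𝕜)))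
  convert h2 using 1
  ext m
  simp only [Set.mem_ofPred_eq, Set.mem_inter_iff, Set.mem_preimage, and_assoc]
  refine and_congr_right fun hm => and_congr_right fun hmG => ?_
  simp only [fun p => diffAt_comp_chart m₀ hm hG hmG (hf p)]
  exact ⟨fun h => LinearIndependent.of_comp (chartCotangent m₀ hm).toLinearMap h,
    fun h => h.map' (chartCotangent m₀ hm).toLinearMap (chartCotangent m₀ hm).ker⟩

/-- Sequences of functions near `m₀` that solve the anchored recurrence. -/
lemma exists_lenard_functions {P₁ P₂ : TensorField 𝕜 E M} (hP : IsBihamiltonian P₁ P₂) {l : ℕ}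
    (hker : ∀ m, ∀ μ : 𝕜, Module.finrank 𝕜 (LinearMap.ker (P₁ m + μ • P₂ m)) = l) (m₀ : M) :
    ∃ G : Set E, IsOpen G ∧ chartAt E m₀ m₀ ∈ G ∧ ∃ H : Fin l → ℕ → E → 𝕜,
      (∀ t i, ContDiffOn 𝕜 ∞ (H t i) G) ∧
      (∀ m ∈ (chartAt E m₀).source ∩ chartAt E m₀ ⁻¹' G, ∀ t, IsSolution (P₁ m) (P₂ m) fun i =>
        diffAt E (H t i ∘ chartAt E m₀) m) ∧
      LinearIndependent 𝕜 fun t => diffAt E (H t 0 ∘ chartAt E m₀) m₀ := by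
  have e : ∀ μ : 𝕜, chartOperator ((1 : 𝕜) • P₁ + μ • P₂) m₀ =
      fun x => chartOperator P₁ m₀ x + μ • chartOperator P₂ m₀ x := fun μ => funext fun x => by
    rw [chartOperator_add_smul, one_smul]
  obtain ⟨G, hG, hmG, -, H, hH, hH0, hHs, hli⟩ := exists_lenard_sequences (𝕜 := 𝕜)
    (chartAt E m₀).open_target (mem_chart_target E m₀)
    (contDiffOn_chartOperator hP.poisson₁.toIsBracket m₀)
    (contDiffOn_chartOperator hP.poisson₂.toIsBracket m₀)
    (fun x hx μ α β => by
      have := chartOperator_skew (hP.compatible 1 μ).toIsBracket m₀ hx α β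
      rwa [e] at this)
    (fun x hx μ α β γ => by
      have := chartOperator_jacobi (hP.compatible 1 μ) m₀ hx α β γ
      rwa [e] at this)
    (l := l)
    (fun x hx μ => by
      have hm := (chartAt E m₀).map_target hx
      have := finrank_ker_chartOperator ((1 : 𝕜) • P₁ + μ • P₂) m₀ hm
      rw [(chartAt E m₀).right_inv hx, e, Pi.add_apply, Pi.smul_apply, Pi.smul_apply, one_smul,
        hker] at this
      exact this)
  have hd : ∀ m (hm : m ∈ (chartAt E m₀).source), chartAt E m₀ m ∈ G → ∀ t i,
      diffAt E (H t i ∘ chartAt E m₀) m =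
        chartCotangent m₀ hm (fderiv 𝕜 (H t i) (chartAt E m₀ m)) := fun m hm hmG t i =>
    diffAt_comp_chart m₀ hm hG hmG (hH t i)
  refine ⟨G, hG, hmG, H, hH, fun m hm t => ⟨?_, fun i => ?_⟩, ?_⟩
  · rw [hd m hm.1 hm.2]
    exact (chartOperator_eq_zero_iff P₁ m₀ hm.1 _).1 (hH0 _ hm.2 t)
  · rw [hd m hm.1 hm.2, hd m hm.1 hm.2]
    exact (chartOperator_eq_neg_iff P₁ P₂ m₀ hm.1 _ _).1 (hHs _ hm.2 t i)
  · simp only [hd m₀ (mem_chart_source E m₀) hmG]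
    exact hli.map' _ (chartCotangent m₀ (mem_chart_source E m₀)).ker

/-- The lengths `q` are found at the single point `m₀`, where the solutions span the even vectors;
this gives `∑ (q t + 1) = ∑ k i`, and only these totals are compared. Independence spreads to a
neighbourhood `U`. At each point of `U` the even vectors again span dimension `∑ k i`, so the
independent differentials exhaust that span and all further terms depend on them. -/
theorem isStrictlyLenardIntegrableAt {P₁ P₂ : TensorField 𝕜 E M} (hP : IsBihamiltonian P₁ P₂)
    (h : IsHomogeneousOn P₁ P₂ Set.univ) (m₀ : M) : IsStrictlyLenardIntegrableAt P₁ P₂ m₀ := by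
  obtain ⟨l, k, hk, hW⟩ := h
  have hs₁ := fun m => hP.poisson₁.skew m
  have hs₂ := fun m => hP.poisson₂.skew m
  have hfr : ∀ m, (∃ F : KroneckerFrame (P₁ m) (P₂ m) k, F.complement = ⊥) ∧
      linearActionDim (P₁ m) (P₂ m) = ∑ i, k i := fun m => by
    obtain ⟨W, D, hWd⟩ := hW m trivial
    exact D.exists_frame_of_finrank (hs₁ m) (hs₂ m) hk hWd
  choose F hF using fun m => (hfr m).1
  have hdim : actionDimAt P₁ P₂ m₀ = ∑ i, k i := by
    rw [actionDimAt]
    simp only [fun m => (hfr m).2]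
    exact Filter.liminf_const _
  -- The zero complement is nondegenerate for every `μ`, so the corank is `l` in the whole pencil,
  -- as the smooth dependence of Casimir functions on `μ` requires.
  obtain ⟨G, hG, hmG, H, hH, hsol, hli⟩ := exists_lenard_functions hP (l := l) (fun m μ => by
    rw [(F m).finrank_ker (hs₁ m) (hs₂ m) ((hF m) ▸ isNondegenerateOn_bot μ), Fintype.card_fin]) m₀
  have hm₀ : m₀ ∈ (chartAt E m₀).source ∩ chartAt E m₀ ⁻¹' G := ⟨mem_chart_source E m₀, hmG⟩
  obtain ⟨q, hqli, hqspan⟩ := exists_basis_of_solutions (fun t => (hsol m₀ hm₀ t).succ) hli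
    ((F m₀).ker_le_span (hs₁ m₀) (hs₂ m₀) (hF m₀) (fun t => (hsol m₀ hm₀ t).zero) hli)
  have hcard : ∑ t, (q t + 1) = ∑ i, k i := by
    have h1 := (F m₀).span_solutions_eq (hs₁ m₀) (hs₂ m₀) (hF m₀) (hsol m₀ hm₀) hli
    have h2 : Submodule.span 𝕜 (Set.range fun p : Σ t : Fin l, Fin (q t + 1) =>
        diffAt E (H p.1 p.2 ∘ chartAt E m₀) m₀) = (F m₀).evenSpan := by
      rw [← h1]
      refine le_antisymm (Submodule.span_mono ?_) (Submodule.span_le.2 ?_)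
      · rintro _ ⟨p, rfl⟩
        exact ⟨(p.1, p.2), rfl⟩
      · rintro _ ⟨p, rfl⟩
        exact hqspan p.1 p.2
    rw [← (F m₀).finrank_evenSpan, ← h2, finrank_span_eq_card hqli, Fintype.card_sigma]
    simp
  obtain ⟨U, hU, hmU⟩ : ∃ U : Set M, IsOpen U ∧ ∀ m, m ∈ U ↔
      m ∈ (chartAt E m₀).source ∩ chartAt E m₀ ⁻¹' G ∧ LinearIndependent 𝕜
        fun p : Σ t : Fin l, Fin (q t + 1) => diffAt E (H p.1 p.2 ∘ chartAt E m₀) m :=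
    ⟨_, isOpen_linearIndependent_diffAt m₀ hG (f := fun p : Σ t : Fin l, Fin (q t + 1) => H p.1 p.2)
      fun p => hH p.1 p.2, fun m => Iff.rfl⟩
  have hUG : ∀ m ∈ U, m ∈ (chartAt E m₀).source ∩ chartAt E m₀ ⁻¹' G := fun m hm => ((hmU m).1 hm).1
  have hUli : ∀ m ∈ U, LinearIndependent 𝕜
      fun p : Σ t : Fin l, Fin (q t + 1) => diffAt E (H p.1 p.2 ∘ chartAt E m₀) m :=
    fun m hm => ((hmU m).1 hm).2
  have hsm : ∀ t i, SmoothOn E (H t i ∘ chartAt E m₀) U := fun t i =>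
    ContMDiffOn.mono (smoothOn_comp_chart m₀ (hH t i)) hUG
  have hli0 : ∀ m ∈ U, LinearIndependent 𝕜 fun t => diffAt E (H t 0 ∘ chartAt E m₀) m :=
    fun m hm => (hUli m hm).comp (fun t : Fin l => (⟨t, 0⟩ : Σ t : Fin l, Fin (q t + 1)))
      fun t s hts => congrArg Sigma.fst hts
  have hspan : ∀ m ∈ U, ∀ t i, diffAt E (H t i ∘ chartAt E m₀) m ∈
      Submodule.span 𝕜 (Set.range
        fun p : Σ t : Fin l, Fin (q t + 1) => diffAt E (H p.1 p.2 ∘ chartAt E m₀) m) := fun m hm t i => by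
    have hmem : ∀ t i, diffAt E (H t i ∘ chartAt E m₀) m ∈ (F m).evenSpan := fun t i =>
      (F m).solution_mem_evenSpan (hs₁ m) (hs₂ m) (μ := 0) ((hF m) ▸ isNondegenerateOn_bot 0)
        (hsol m (hUG m hm) t) i
    rw [Submodule.eq_of_le_of_finrank_eq (S₂ := (F m).evenSpan) (Submodule.span_le.2 ?_) ?_]
    · exact hmem t i
    · rintro _ ⟨p, rfl⟩
      exact hmem p.1 p.2
    · rw [finrank_span_eq_card (hUli m hm), (F m).finrank_evenSpan, Fintype.card_sigma, ← hcard]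
      simp
  have hcas : ∀ t, IsCasimirOn P₁ (H t 0 ∘ chartAt E m₀) U := fun t =>
    ⟨hsm t 0, fun V _ hVU g _ m hm => by
      rw [bracket, (hsol m (hUG m (hVU hm)) t).zero]; rfl⟩
  refine ⟨U, hU, (hmU m₀).2 ⟨hm₀, hqli⟩, l, fun t i => H t i ∘ chartAt E m₀, q, ⟨⟨hcas, ?_, ?_⟩, ?_, ?_, ?_⟩,
    hcard.trans hdim.symm⟩
  · exact generically_of_forall hU hli0
  · intro V hV hVU g hg
    refine generically_of_forall hV fun m hm => ?_
    -- At every point of `U` the `l` independent initial differentials fill the `l`-dimensional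
    -- kernel of `P₁`, so maximality holds pointwise.
    refine (F m).ker_le_span (hs₁ m) (hs₂ m) (hF m) (fun t => (hsol m (hUG m (hVU hm)) t).zero)
      (hli0 m (hVU hm)) ?_
    exact LinearMap.mem_ker.2 (eq_zero_of_bracket hV hm _ fun V' hV' hVV' f hf hmV' =>
      hg.2 V' hV' hVV' f hf m hmV')
  · refine fun t => ⟨hsm t, hcas t, fun i V _ hVU g _ m hm => ?_⟩
    rw [bracket, bracket, (hsol m (hUG m (hVU hm)) t).succ]; rfl
  · exact generically_of_forall hU hUli
  · exact fun t i => generically_of_forall hU fun m hm => hspan m hm t i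

end Integrability

end Bihamiltonian

end

theorem mainTheorem7 {𝕜 : Type*} [RCLike 𝕜]
    {E : Type*} [NormedAddCommGroup E] [NormedSpace 𝕜 E] [FiniteDimensional 𝕜 E]
    {M : Type*} [TopologicalSpace M] [ChartedSpace E M]
    [IsManifold (modelWithCornersSelf 𝕜 E) ((⊤ : ℕ∞) : WithTop ℕ∞) M]
    (P₁ P₂ : Bihamiltonian.TensorField 𝕜 E M) (hP : Bihamiltonian.IsBihamiltonian P₁ P₂) :
    (Bihamiltonian.IsHomogeneousOn P₁ P₂ Set.univ →
      ∀ m₀ : M, Bihamiltonian.IsStrictlyLenardIntegrableAt P₁ P₂ m₀) ∧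
    (∀ m₀ : M, Bihamiltonian.IsStrictlyLenardIntegrableAt P₁ P₂ m₀ →
      ∃ U : Set M, IsOpen U ∧ m₀ ∈ closure U ∧ Bihamiltonian.IsHomogeneousOn P₁ P₂ U) :=
  ⟨fun h m₀ => Bihamiltonian.isStrictlyLenardIntegrableAt hP h m₀,
    fun _ h => Bihamiltonian.exists_isHomogeneousOn hP h⟩
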